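/- Let $G\subset\mathbb C$ be a domain (open and connected), and let $f$ be a Gaussian analytic function in $G$: almost surely $f(z)=\sum_{n}\zeta_n f_n(z)$ for all $z\in G$ (as a limit of partial sums), where $\zeta_n$ are independent standard complex Gaussian random variables (with density $\pi^{-1}e^{-|\zeta|^2}$ on $\mathbb C$), $f_n$ are analytic in $G$, and $\sum_n|f_n|^2$ converges locally uniformly on $G$. Call $f$ *$d$-nondegenerate* if no non-zero linear functional of the form \[ Lg=\sum_{w\in S}\ \sum_{0\le l<m_w} a_{w,l}\,g^{(l)}(w), \] with $S\subset G$ finite, $a_{w,l}\in\mathbb C$, and multiplicities $m_w\ge 0$ such that $\sum_{w\in S}m_w\le d$, satisfies $Lf=0$ almost surely (here $L$ is non-zero if at least one coefficient $a_{w,l}$, $0\le l<m_w$, is non-zero). For pairwise distinct $z_1,\dots,z_k\in G$, the $k$-point function of the zeros of $f$ is \[ \rho_f(z_1,\dots,z_k)=\lim_{\epsilon\to0+}\frac{p_\epsilon(z_1,\dots,z_k)}{(\pi\epsilon^2)^k}, \] where $p_\epsilon(z_1,\dots,z_k)$ is the probability that each of the disks $\{|w-z_j|\le\epsilon\}$,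 $1\le j\le k$, contains at least one zero of $f$ in $G$. **Theorem (Local universality of repulsion).** Let $f$ be a $2k$-nondegenerate Gaussian analytic function in the domain $G$. Then the $k$-point function $\rho_f$ is well defined, that is, the above limit exists and is finite for all pairwise distinct $z_1,\dots,z_k\in G$. Moreover, for every compact set $K\subset G$ there exists a positive constant $C=C(k,f,K)$ such that, for any configuration of pairwise distinct points $z_1,\dots,z_k\in K$, \[ C^{-1}\prod_{i<j}|z_i-z_j|^2\ \le\ \rho_f(z_1,\dots,z_k)\ \le\ C\prod_{i<j}|z_i-z_j|^2 . \] -/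

import Mathlib

open MeasureTheory ProbabilityTheory Filter Topology

/-- The law of a standard complex Gaussian variable: density `π⁻¹ exp (-|z|²)` with respect to
the area measure on `ℂ`. -/
noncomputable def stdComplexGaussian : Measure ℂ :=
  (volume : Measure ℂ).withDensity
    (fun z => ENNReal.ofReal (Real.pi⁻¹ * Real.exp (-‖z‖ ^ 2)))

/-- `F` is a Gaussian analytic function in `G`: almost surely `F z = ∑ₙ ζₙ fₙ(z)` on `G` (limit of
partial sums), with `ζₙ` independent standard complex Gaussian variables, `fₙ` analytic in `G`,
and `∑ₙ |fₙ|²` locally uniformly convergent on `G`. -/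
def IsGaussianAnalyticFunction {Ω : Type*} [MeasurableSpace Ω] (μ : Measure Ω)
    (G : Set ℂ) (F : Ω → ℂ → ℂ) : Prop :=
  ∃ (ζ : ℕ → Ω → ℂ) (f : ℕ → ℂ → ℂ),
    (∀ n, Measurable (ζ n)) ∧
    (∀ n, μ.map (ζ n) = stdComplexGaussian) ∧
    iIndepFun ζ μ ∧
    (∀ n, DifferentiableOn ℂ (f n) G) ∧
    SummableLocallyUniformlyOn (fun n z => ‖f n z‖ ^ 2) G ∧
    ∀ᵐ ω ∂μ, ∀ z ∈ G,
      Tendsto (fun N => ∑ n ∈ Finset.range N, ζ n ω * f n z) atTop (𝓝 (F ω z))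

/-- `F` is `d`-nondegenerate in `G`: no non-zero linear functional
`L g = ∑_{w ∈ S} ∑_{l < m w} a_{w,l} g⁽ˡ⁾(w)`, with finitely many nodes `w ∈ G` of total
multiplicity `∑ m w ≤ d`, annihilates `F` almost surely. -/
def IsNondegenerate {Ω : Type*} [MeasurableSpace Ω] (μ : Measure Ω)
    (G : Set ℂ) (F : Ω → ℂ → ℂ) (d : ℕ) : Prop :=
  ∀ (S : Finset ℂ) (m : ℂ → ℕ) (a : ℂ → ℕ → ℂ),
    (∀ w ∈ S, w ∈ G) → ∑ w ∈ S, m w ≤ d →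
    (∀ᵐ ω ∂μ, ∑ w ∈ S, ∑ l ∈ Finset.range (m w), a w l * iteratedDeriv l (F ω) w = 0) →
    ∀ w ∈ S, ∀ l < m w, a w l = 0

/-- The probability that each closed disk `{|w - z j| ≤ ε}` contains at least one zero of `F`
(the zero set being a subset of `G`). -/
noncomputable def zeroHitProb {Ω : Type*} [MeasurableSpace Ω] (μ : Measure Ω)
    (G : Set ℂ) (F : Ω → ℂ → ℂ) {k : ℕ} (ε : ℝ) (z : Fin k → ℂ) : ℝ :=
  μ.real {ω | ∀ j, ∃ w ∈ G, ‖w - z j‖ ≤ ε ∧ F ω w = 0}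

/-- `ρ` is the `k`-point function of the zeros of `F` in `G`: off the diagonal it is the limit of
`p_ε (z) / (π ε²)ᵏ` as `ε → 0+`. -/
def IsKPointFunction {Ω : Type*} [MeasurableSpace Ω] (μ : Measure Ω)
    (G : Set ℂ) (F : Ω → ℂ → ℂ) (k : ℕ) (ρ : (Fin k → ℂ) → ℝ) : Prop :=
  ∀ z : Fin k → ℂ, (∀ j, z j ∈ G) → Function.Injective z →
    Tendsto (fun ε : ℝ => zeroHitProb μ G F ε z / (Real.pi * ε ^ 2) ^ k) (𝓝[>] 0) (𝓝 (ρ z))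

/-! Fix `z₀ ∈ Gᵏ`, coincidences allowed. Nondegeneracy supplies `k` of the functions `fₙ`, say `φₐ`,
whose matrix `B` of divided differences at `z₀` is invertible
(`GaussianSeries.exists_det_divDiff_ne_zero`). Write `F = ∑ xₐ φₐ + R` with `x` a standard Gaussian
vector in `ℂᵏ` independent of `R`, and freeze `R`. For distinct nodes `z` near `z₀` put `A =
(φₐ(z_j))`; exactly one `x*` makes `g = ∑ x*ₐ φₐ + R` vanish at all nodes. Substituting `x = x* + ε
A⁻¹ v` turns the function into `g + ε p` with `p(z_j) = v_j`, and as `ε → 0` the condition that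
every disk contains a zero becomes `|v_j| ≤ |g'(z_j)|` for all `j`, up to a null set of `v`. So the
conditional limit is `π⁻ᵏ |det A|⁻² exp(-|x*|²) ∏ |g'(z_j)|²` (`gaussian_hit_tendsto`). A bound
polynomial in the supremum of `|R|` (`gaussian_hit_le`) and moments of such suprema
(`GaussianSeries.exists_compact_bound`) allow averaging over `R` by dominated convergence
(`GaussianSeries.zeroHit_tendsto`).

Repulsion is then Newton interpolation. With `Δ = ∏_{i<j} |z_i - z_j|²` one has `|det A|² = Δ |det
B|²` (`norm_det_eval_sq`), while `g'(z_j) = g[z₁, …, z_k, z_j] ∏_{l ≠ j} (z_j - z_l)`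
(`deriv_eq_of_divDiff`), so the derivatives contribute `Δ²`. Hence `ρ = Δ²/Δ = Δ` times the mean of
`kacRiceDensity`, which involves only divided differences and is therefore continuous in `z` across
coincidences.

That mean is positive at `z₀`: the divided differences `g[z₁, …, z_k, z_j]` are nonzero functionals
of `F`, hence almost surely nonzero by a zero-one law (`GaussianSeries.ae_residual_ne_zero`). This
gives two-sided bounds near each `z₀` (`GaussianSeries.local_bound`), and compactness of `Kᵏ` makes
the constant uniform. -/

/-! ### Algebra of divided differences. -/

/-- Iterated divided differences of `g` in Newton form: `newton z g n w = g[z₀, …, zₙ₋₁, w]`. -/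
noncomputable def newton (z : ℕ → ℂ) (g : ℂ → ℂ) : ℕ → ℂ → ℂ
  | 0 => g
  | n + 1 => dslope (newton z g n) (z n)

theorem newton_congr {z z' : ℕ → ℂ} (g : ℂ → ℂ) {n : ℕ} (h : ∀ i < n, z i = z' i) :
    newton z g n = newton z' g n := by
  induction n with
  | zero => rfl
  | succ n ih => simp only [newton]; rw [ih fun i hi => h i (by omega), h n (by omega)]

theorem newton_differentiableOn {G : Set ℂ} (hG : IsOpen G) {z : ℕ → ℂ} {g : ℂ → ℂ} {n : ℕ}
    (hz : ∀ i < n, z i ∈ G) (hg : DifferentiableOn ℂ g G) :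
    DifferentiableOn ℂ (newton z g n) G := by
  induction n with
  | zero => exact hg
  | succ n ih =>
    exact (Complex.differentiableOn_dslope (hG.mem_nhds (hz n (by omega)))).2
      (ih fun i hi => hz i (by omega))

theorem dslope_add_fun {f g : ℂ → ℂ} {a : ℂ} (hf : DifferentiableAt ℂ f a)
    (hg : DifferentiableAt ℂ g a) :
    dslope (fun w => f w + g w) a = fun w => dslope f a w + dslope g a w := by
  ext w
  rcases eq_or_ne w a with rfl | h
  · simp only [dslope_same]
    exact deriv_fun_add hf hg
  · simp only [dslope_of_ne _ h, slope_def_field]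
    ring

theorem dslope_const_mul_fun {f : ℂ → ℂ} {a : ℂ} (c : ℂ) (hf : DifferentiableAt ℂ f a) :
    dslope (fun w => c * f w) a = fun w => c * dslope f a w := by
  ext w
  rcases eq_or_ne w a with rfl | h
  · simp only [dslope_same]
    exact deriv_const_mul c hf
  · simp only [dslope_of_ne _ h, slope_def_field]
    ring

theorem newton_add {G : Set ℂ} (hG : IsOpen G) {z : ℕ → ℂ} {n : ℕ} (hz : ∀ i < n, z i ∈ G)
    {f g : ℂ → ℂ} (hf : DifferentiableOn ℂ f G) (hg : DifferentiableOn ℂ g G) :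
    newton z (fun w => f w + g w) n = fun w => newton z f n w + newton z g n w := by
  induction n with
  | zero => rfl
  | succ n ih =>
    have hz' : ∀ i < n, z i ∈ G := fun i hi => hz i (by omega)
    have hn := hG.mem_nhds (hz n (by omega))
    simp only [newton]
    rw [ih hz', dslope_add_fun ((newton_differentiableOn hG hz' hf).differentiableAt hn)
      ((newton_differentiableOn hG hz' hg).differentiableAt hn)]

theorem newton_const_mul {G : Set ℂ} (hG : IsOpen G) {z : ℕ → ℂ} {n : ℕ} (hz : ∀ i < n, z i ∈ G)
    {f : ℂ → ℂ} (c : ℂ) (hf : DifferentiableOn ℂ f G) :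
    newton z (fun w => c * f w) n = fun w => c * newton z f n w := by
  induction n with
  | zero => rfl
  | succ n ih =>
    have hz' : ∀ i < n, z i ∈ G := fun i hi => hz i (by omega)
    have hn := hG.mem_nhds (hz n (by omega))
    simp only [newton]
    rw [ih hz', dslope_const_mul_fun c ((newton_differentiableOn hG hz' hf).differentiableAt hn)]

theorem newton_sum {G : Set ℂ} (hG : IsOpen G) {z : ℕ → ℂ} {n : ℕ} (hz : ∀ i < n, z i ∈ G)
    {ι : Type*} (s : Finset ι) (x : ι → ℂ) {f : ι → ℂ → ℂ}
    (hf : ∀ i ∈ s, DifferentiableOn ℂ (f i) G) :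
    newton z (fun w => ∑ i ∈ s, x i * f i w) n = fun w => ∑ i ∈ s, x i * newton z (f i) n w := by
  classical
  induction s using Finset.induction_on with
  | empty =>
    have := newton_const_mul hG hz (f := fun _ => 0) 0 (differentiableOn_const 0)
    simpa using this
  | insert a s ha ih =>
    simp only [Finset.sum_insert ha]
    have h1 := hf a (Finset.mem_insert_self _ _)
    have h2 : ∀ i ∈ s, DifferentiableOn ℂ (f i) G := fun i hi => hf i (Finset.mem_insert_of_mem hi)
    rw [newton_add hG hz (h1.const_mul (x a))
      (DifferentiableOn.fun_sum fun i hi => (h2 i hi).const_mul (x i)),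
      newton_const_mul hG hz _ h1, ih h2]

theorem newton_interpolation (z : ℕ → ℂ) (g : ℂ → ℂ) (n : ℕ) (w : ℂ) :
    g w = ∑ i ∈ Finset.range n, newton z g i (z i) * ∏ l ∈ Finset.range i, (w - z l)
      + newton z g n w * ∏ l ∈ Finset.range n, (w - z l) := by
  induction n with
  | zero => simp [newton]
  | succ n ih =>
    rw [Finset.sum_range_succ, Finset.prod_range_succ, add_assoc]
    nth_rewrite 1 [ih]
    have h := sub_smul_dslope (newton z g n) (z n) w
    simp only [smul_eq_mul] at h
    simp only [newton]
    linear_combination -(∏ l ∈ Finset.range n, (w - z l)) * h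

/-- Each divided difference cancels one factor, because the product vanishes at the node. These
polynomials are the test functions dual to the divided differences. -/
theorem newton_nodal {z : ℕ → ℂ} {i n : ℕ} (h : n ≤ i) :
    newton z (fun w => ∏ l ∈ Finset.range i, (w - z l)) n
      = fun w => ∏ l ∈ Finset.Ico n i, (w - z l) := by
  induction n with
  | zero => simp [newton]
  | succ n ih =>
    simp only [newton]
    rw [ih (by omega)]
    have e : (fun w => ∏ l ∈ Finset.Ico n i, (w - z l))
        = fun w => (w - z n) * ∏ l ∈ Finset.Ico (n + 1) i, (w - z l) := by
      ext w; rw [Finset.prod_eq_prod_Ico_succ_bot (by omega)]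
    rw [e]
    set q : ℂ → ℂ := fun w => ∏ l ∈ Finset.Ico (n + 1) i, (w - z l) with hq
    have hqd : DifferentiableAt ℂ q (z n) := by
      rw [hq]; fun_prop
    ext w
    rcases eq_or_ne w (z n) with rfl | hw
    · rw [dslope_same]
      have h1 : HasDerivAt (fun w => w - z n) 1 (z n) := (hasDerivAt_id (z n)).sub_const _
      have := (h1.mul hqd.hasDerivAt).deriv
      simp only [sub_self, zero_mul, add_zero, one_mul] at this
      exact this
    · rw [dslope_of_ne _ hw, slope_def_field]
      have := sub_ne_zero.2 hw
      simp only [sub_self, zero_mul, sub_zero]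
      exact mul_div_cancel_left₀ _ this

/-! ### Divided differences as functionals of the kind allowed in nondegeneracy. -/

/-- Triangularity: the nodal polynomial of degree `m` is killed by all divided differences of order
below `m` and has the value `1` at order `m`, so coefficients vanish from the top down. -/
theorem newton_functional_eq_zero {G : Set ℂ} {z : ℕ → ℂ} {m : ℕ} {c : ℕ → ℂ}
    (h : ∀ g : ℂ → ℂ, DifferentiableOn ℂ g G →
      ∑ i ∈ Finset.range m, c i * newton z g i (z i) = 0) : ∀ i < m, c i = 0 := by
  induction m with
  | zero => simp
  | succ m ih =>
    have key : c m = 0 := by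
      have := h (fun w => ∏ l ∈ Finset.range m, (w - z l)) (by fun_prop)
      rw [Finset.sum_range_succ, newton_nodal le_rfl, Finset.sum_eq_zero] at this
      · simpa using this
      · intro i hi
        have hi := Finset.mem_range.1 hi
        rw [newton_nodal hi.le]
        simp only [mul_eq_zero]
        exact Or.inr (Finset.prod_eq_zero (Finset.left_mem_Ico.2 hi) (sub_self _))
    intro i hi
    rcases Nat.lt_succ_iff_lt_or_eq.1 hi with hi | rfl
    · refine ih (fun g hg => ?_) i hi
      have := h g hg
      rwa [Finset.sum_range_succ, key, zero_mul, add_zero] at this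
    · exact key

/-- A function vanishing at the nodes with multiplicity is divided by one factor `w - z n` at each
stage. This lowers the order at `z n` by one and leaves all other orders unchanged. -/
theorem newton_order {G : Set ℂ} (hG : IsOpen G) {z : ℕ → ℂ} {m : ℕ} (hz : ∀ i < m, z i ∈ G)
    {g : ℂ → ℂ} (hg : DifferentiableOn ℂ g G)
    (ho : ∀ w ∈ G, (((Finset.range m).filter (z · = w)).card : ℕ∞) ≤ analyticOrderAt g w)
    {n : ℕ} (hn : n ≤ m) : ∀ w ∈ G,
      (((Finset.Ico n m).filter (z · = w)).card : ℕ∞) ≤ analyticOrderAt (newton z g n) w := by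
  induction n with
  | zero => simpa [newton] using ho
  | succ n ih =>
    intro w hw
    have ih := ih (by omega)
    have hd := newton_differentiableOn hG (n := n + 1) (fun i hi => hz i (by omega)) hg
    have hd0 := newton_differentiableOn hG (n := n) (fun i hi => hz i (by omega)) hg
    have hzn := hz n (by omega)
    have e : Finset.Ico n m = insert n (Finset.Ico (n + 1) m) := by
      ext; simp; omega
    have h0 : newton z g n (z n) = 0 := by
      have h1 := ih (z n) hzn
      by_contra hne
      rw [(hd0.analyticAt (hG.mem_nhds hzn)).analyticOrderAt_eq_zero.2 hne] at h1
      rw [e, Finset.filter_insert] at h1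
      simp at h1
    have hfac : newton z g n = (fun w => w - z n) * newton z g (n + 1) := by
      ext x
      have := sub_smul_dslope (newton z g n) (z n) x
      simp only [smul_eq_mul, h0, sub_zero] at this
      simp only [newton, Pi.mul_apply, this]
    have ihw := ih w hw
    have ha1 : AnalyticAt ℂ (fun w => w - z n) w := by fun_prop
    rw [hfac, analyticOrderAt_mul ha1 (hd.analyticAt (hG.mem_nhds hw))] at ihw
    by_cases hwz : z n = w
    · have ho1 : analyticOrderAt (fun w => w - z n) w = 1 := by
        rw [show (1 : ℕ∞) = ((1 : ℕ) : ℕ∞) from rfl, ha1.analyticOrderAt_eq_natCast]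
        exact ⟨fun _ => 1, by fun_prop, one_ne_zero, by simp [hwz]⟩
      rw [ho1, e, Finset.filter_insert, if_pos hwz, Finset.card_insert_of_notMem (by simp)] at ihw
      push_cast at ihw
      rw [add_comm] at ihw
      exact (ENat.add_le_add_iff_left (by simp)).1 ihw
    · have ho1 : analyticOrderAt (fun w => w - z n) w = 0 :=
        ha1.analyticOrderAt_eq_zero.2 (sub_ne_zero.2 (Ne.symm hwz))
      rw [ho1, zero_add, e, Finset.filter_insert, if_neg hwz] at ihw
      exact ihw

/-- Analytic functions on `G`. -/
def analyticFunctions (G : Set ℂ) : Submodule ℂ (ℂ → ℂ) where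
  carrier := {g | DifferentiableOn ℂ g G}
  add_mem' hf hg := hf.add hg
  zero_mem' := differentiableOn_const 0
  smul_mem' c _ hf := hf.const_smul c

/-- No explicit confluent formula is needed: a functional vanishing on the common kernel of finitely
many functionals lies in their span. Functions whose derivatives vanish to the multiplicity of each
node have zero divided differences by `newton_order`. -/
theorem newton_functional_span {G : Set ℂ} (hG : IsOpen G) {z : ℕ → ℂ} {m : ℕ}
    (hz : ∀ i < m, z i ∈ G) (c : ℕ → ℂ) :
    ∃ a : ℂ → ℕ → ℂ, ∀ g : ℂ → ℂ, DifferentiableOn ℂ g G →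
      ∑ i ∈ Finset.range m, c i * newton z g i (z i)
        = ∑ w ∈ (Finset.range m).image z,
            ∑ l ∈ Finset.range ((Finset.range m).filter (z · = w)).card,
              a w l * iteratedDeriv l g w := by
  classical
  let S := (Finset.range m).image z
  let M : ℂ → ℕ := fun w => ((Finset.range m).filter (z · = w)).card
  have hS : ∀ w ∈ S, w ∈ G := by
    intro w hw
    obtain ⟨i, hi, rfl⟩ := Finset.mem_image.1 hw
    exact hz i (Finset.mem_range.1 hi)
  let T := (S.sigma fun w => Finset.range (M w))
  have hsm : ∀ (g : ℂ → ℂ) (hg : DifferentiableOn ℂ g G) (l : ℕ) (w : ℂ) (hw : w ∈ G),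
      ContDiffAt ℂ l g w := fun g hg l w hw => (hg.analyticAt (hG.mem_nhds hw)).contDiffAt
  let E : T → (analyticFunctions G →ₗ[ℂ] ℂ) := fun p =>
    { toFun := fun g => iteratedDeriv p.1.2 g.1 p.1.1
      map_add' := fun f g => by
        have hp := hS _ (Finset.mem_sigma.1 p.2).1
        exact iteratedDeriv_add (hsm _ f.2 _ _ hp) (hsm _ g.2 _ _ hp)
      map_smul' := fun c f => by
        have hp := hS _ (Finset.mem_sigma.1 p.2).1
        exact iteratedDeriv_const_smul_field c f.1 }
  let D : analyticFunctions G →ₗ[ℂ] ℂ :=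
    { toFun := fun g => ∑ i ∈ Finset.range m, c i * newton z g.1 i (z i)
      map_add' := fun f g => by
        rw [← Finset.sum_add_distrib]
        refine Finset.sum_congr rfl fun i hi => ?_
        have hi := Finset.mem_range.1 hi
        have := congrFun (newton_add hG (n := i) (fun j hj => hz j (by omega)) f.2 g.2) (z i)
        rw [← mul_add, ← this]
        rfl
      map_smul' := fun c' f => by
        rw [RingHom.id_apply, smul_eq_mul, Finset.mul_sum]
        refine Finset.sum_congr rfl fun i hi => ?_
        have hi := Finset.mem_range.1 hi
        have := congrFun (newton_const_mul hG (n := i) (fun j hj => hz j (by omega)) c' f.2) (z i)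
        rw [mul_left_comm, ← this]
        rfl }
  have hker : ⨅ p, (E p).ker ≤ D.ker := by
    intro g hg
    rw [Submodule.mem_iInf] at hg
    have ho : ∀ w ∈ G, (((Finset.range m).filter (z · = w)).card : ℕ∞) ≤ analyticOrderAt g.1 w := by
      intro w hw
      rw [natCast_le_analyticOrderAt_iff_iteratedDeriv_eq_zero
        (DifferentiableOn.analyticAt g.2 (hG.mem_nhds hw))]
      intro l hl
      have hwS : w ∈ S := by
        obtain ⟨i, hi⟩ := Finset.card_pos.1 (lt_of_le_of_lt (Nat.zero_le _) hl)
        obtain ⟨hi, hw⟩ := Finset.mem_filter.1 hi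
        exact Finset.mem_image.2 ⟨i, hi, hw⟩
      exact hg ⟨⟨w, l⟩, Finset.mem_sigma.2 ⟨hwS, Finset.mem_range.2 hl⟩⟩
    change ∑ i ∈ Finset.range m, c i * newton z g.1 i (z i) = 0
    refine Finset.sum_eq_zero fun i hi => ?_
    have hi := Finset.mem_range.1 hi
    have h1 := newton_order hG hz g.2 ho hi.le (z i) (hz i hi)
    have : newton z g.1 i (z i) = 0 := by
      by_contra hne
      rw [((newton_differentiableOn hG (fun j hj => hz j (by omega)) g.2).analyticAt
        (hG.mem_nhds (hz i hi))).analyticOrderAt_eq_zero.2 hne] at h1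
      have : i ∈ (Finset.Ico i m).filter (z · = z i) := by simp [hi]
      rw [nonpos_iff_eq_zero, Nat.cast_eq_zero, Finset.card_eq_zero] at h1
      simp [h1] at this
    rw [this, mul_zero]
  obtain ⟨b, hb⟩ := (Submodule.mem_span_range_iff_exists_fun ℂ).1 (mem_span_of_iInf_ker_le_ker hker)
  refine ⟨fun w l => if h : (⟨w, l⟩ : Σ _ : ℂ, ℕ) ∈ T then b ⟨⟨w, l⟩, h⟩ else 0, fun g hg => ?_⟩
  have h1 := LinearMap.congr_fun hb ⟨g, hg⟩
  change _ = ∑ i ∈ Finset.range m, c i * newton z g i (z i) at h1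
  rw [← h1, LinearMap.sum_apply]
  change _ = ∑ w ∈ S, ∑ l ∈ Finset.range (M w), _
  rw [Finset.sum_sigma', ← Finset.sum_coe_sort (S.sigma fun w => Finset.range (M w))]
  refine Finset.sum_congr rfl fun p _ => ?_
  have e : (if h : (⟨p.1.1, p.1.2⟩ : Σ _ : ℂ, ℕ) ∈ T then b ⟨⟨p.1.1, p.1.2⟩, h⟩ else 0) = b p :=
    dif_pos p.2
  exact (congrArg (· * iteratedDeriv p.1.2 g p.1.1) e).symm

/-- Nondegeneracy, expressed through divided differences. -/
theorem IsNondegenerate.newton_coeff_eq_zero {Ω : Type*} [MeasurableSpace Ω] {μ : Measure Ω} {G : Set ℂ}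
    (hG : IsOpen G) {F : Ω → ℂ → ℂ} {d : ℕ} (h : IsNondegenerate μ G F d)
    (hF : ∀ᵐ ω ∂μ, DifferentiableOn ℂ (F ω) G) {z : ℕ → ℂ} {m : ℕ} (hm : m ≤ d)
    (hz : ∀ i < m, z i ∈ G) {c : ℕ → ℂ}
    (h0 : ∀ᵐ ω ∂μ, ∑ i ∈ Finset.range m, c i * newton z (F ω) i (z i) = 0) :
    ∀ i < m, c i = 0 := by
  classical
  obtain ⟨a, ha⟩ := newton_functional_span hG hz c
  have h1 := h ((Finset.range m).image z) (fun w => ((Finset.range m).filter (z · = w)).card) a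
    (by
      intro w hw
      obtain ⟨i, hi, rfl⟩ := Finset.mem_image.1 hw
      exact hz i (Finset.mem_range.1 hi))
    (by
      -- Sorting the `m` indices by the value of the node shows that the multiplicities add up to
      -- `m`.
      rw [← Finset.card_eq_sum_card_image, Finset.card_range]
      exact hm)
    (by filter_upwards [h0, hF] with ω h0 hF; rw [← ha _ hF, h0])
  refine newton_functional_eq_zero (G := G) (z := z) fun g hg => ?_
  rw [ha g hg]
  exact Finset.sum_eq_zero fun w hw => Finset.sum_eq_zero fun l hl => by
    rw [h1 w hw l (Finset.mem_range.1 hl), zero_mul]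

/-! ### Continuity and uniform bounds for divided differences. -/

theorem IsCompact.eventually_forall_of_prod {P X : Type*} [TopologicalSpace X] {l : Filter P}
    {K : Set X} (hK : IsCompact K) {p : P → X → Prop}
    (h : ∀ w ∈ K, ∀ᶠ q in l ×ˢ 𝓝 w, p q.1 q.2) : ∀ᶠ x in l, ∀ w ∈ K, p x w := by
  refine hK.induction_on (p := fun s => ∀ᶠ x in l, ∀ w ∈ s, p x w) (by simp)
    (fun s t hst ht => ht.mono fun x hx w hw => hx w (hst hw))
    (fun s t hs ht => ?_) fun w hw => ?_
  · filter_upwards [hs, ht] with x h1 h2 w hw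
    exact hw.elim (h1 w) (h2 w)
  · obtain ⟨u, hu, v, hv, huv⟩ := eventually_prod_iff.1 (h w hw)
    exact ⟨{y | v y}, mem_nhdsWithin_of_mem_nhds hv, hu.mono fun x hx y hy => huv hx hy⟩

theorem dslope_diffContOnCl {G : Set ℂ} (hG : IsOpen G) {g : ℂ → ℂ} (hg : DifferentiableOn ℂ g G)
    {a c : ℂ} {r : ℝ} (ha : a ∈ G) (hr : Metric.closedBall c r ⊆ G) :
    DiffContOnCl ℂ (dslope g a) (Metric.ball c r) :=
  (((Complex.differentiableOn_dslope (hG.mem_nhds ha)).2 hg).mono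
    ((closure_mono Metric.ball_subset_closedBall).trans
      (Metric.isClosed_closedBall.closure_eq.trans_subset hr))).diffContOnCl

/-- Divided differences are continuous for continuous convergence of analytic functions. -/
theorem dslope_tendsto {P : Type*} {l : Filter P} {G : Set ℂ} (hG : IsOpen G)
    {g : P → ℂ → ℂ} {g₀ : ℂ → ℂ} {a : P → ℂ} {a₀ : ℂ}
    (hg : ∀ᶠ p in l, DifferentiableOn ℂ (g p) G) (hg₀ : DifferentiableOn ℂ g₀ G)
    (ha : Tendsto a l (𝓝 a₀)) (ha₀ : a₀ ∈ G)
    (h : ∀ w ∈ G, Tendsto (fun q : P × ℂ => g q.1 q.2) (l ×ˢ 𝓝 w) (𝓝 (g₀ w))) :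
    ∀ w ∈ G, Tendsto (fun q : P × ℂ => dslope (g q.1) (a q.1) q.2) (l ×ˢ 𝓝 w)
      (𝓝 (dslope g₀ a₀ w)) := by
  have hd₀ := (Complex.differentiableOn_dslope (hG.mem_nhds ha₀)).2 hg₀
  have off : ∀ w ∈ G, w ≠ a₀ → Tendsto (fun q : P × ℂ => dslope (g q.1) (a q.1) q.2) (l ×ˢ 𝓝 w)
      (𝓝 (dslope g₀ a₀ w)) := by
    intro w hw hwa
    have h1 : Tendsto (fun q : P × ℂ => a q.1) (l ×ˢ 𝓝 w) (𝓝 a₀) := ha.comp tendsto_fst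
    have h2 : Tendsto (fun q : P × ℂ => q.2) (l ×ˢ 𝓝 w) (𝓝 w) := tendsto_snd
    have h3 : Tendsto (fun q : P × ℂ => g q.1 (a q.1)) (l ×ˢ 𝓝 w) (𝓝 (g₀ a₀)) :=
      (h a₀ ha₀).comp (tendsto_fst.prodMk h1)
    have h4 := (((h w hw).sub h3).div (h2.sub h1) (sub_ne_zero.2 hwa))
    rw [dslope_of_ne _ hwa, slope_def_field]
    refine h4.congr' ?_
    filter_upwards [(h2.sub h1).eventually_ne (sub_ne_zero.2 hwa)] with q hq
    simp [dslope_of_ne _ (sub_ne_zero.1 hq), slope_def_field]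
  intro w hw
  rcases ne_or_eq w a₀ with hwa | rfl
  · exact off w hw hwa
  obtain ⟨r, hr, hrG⟩ := Metric.nhds_basis_closedBall.mem_iff.1 (hG.mem_nhds hw)
  rw [Metric.tendsto_nhds]
  intro ε hε
  -- At the limiting node the quotient degenerates to `0 / 0`. Convergence is known away from it,
  -- hence uniformly on a surrounding circle, and the maximum principle carries it inside.
  have hS : ∀ᶠ p in l, ∀ x ∈ Metric.sphere w r,
      ‖dslope (g p) (a p) x - dslope g₀ w x‖ < ε / 2 := by
    refine (isCompact_sphere w r).eventually_forall_of_prod fun x hx => ?_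
    have hxG := hrG (Metric.sphere_subset_closedBall hx)
    have hc : Tendsto (fun q : P × ℂ => dslope g₀ w q.2) (l ×ˢ 𝓝 x) (𝓝 (dslope g₀ w x)) :=
      (hd₀.continuousOn.continuousAt (hG.mem_nhds hxG)).tendsto.comp tendsto_snd
    have := ((off x hxG (Metric.ne_of_mem_sphere hx hr.ne')).sub hc).norm
    rw [sub_self, norm_zero] at this
    exact this.eventually_lt_const (by positivity)
  have hB : ∀ᶠ p in l, ∀ x ∈ Metric.closedBall w r,
      ‖dslope (g p) (a p) x - dslope g₀ w x‖ ≤ ε / 2 := by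
    filter_upwards [hS, hg, ha.eventually (hG.mem_nhds hw)] with p h1 h2 h3 x hx
    have hdc := (dslope_diffContOnCl hG h2 h3 hrG).sub (dslope_diffContOnCl hG hg₀ hw hrG)
    refine Complex.norm_le_of_forall_mem_frontier_norm_le Metric.isBounded_ball hdc
      (fun y hy => ?_) (z := x) ?_
    · rw [frontier_ball _ hr.ne'] at hy
      exact (h1 y hy).le
    · rwa [closure_ball _ hr.ne']
  have hc : Tendsto (fun q : P × ℂ => dslope g₀ w q.2) (l ×ˢ 𝓝 w) (𝓝 (dslope g₀ w w)) :=
    (hd₀.continuousOn.continuousAt (hG.mem_nhds hw)).tendsto.comp tendsto_snd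
  filter_upwards [tendsto_fst.eventually hB,
    tendsto_snd.eventually (Metric.closedBall_mem_nhds w hr),
    Metric.tendsto_nhds.1 hc (ε / 2) (by positivity)] with q h1 h2 h3
  have := h1 q.2 h2
  rw [← dist_eq_norm] at this
  linarith [dist_triangle (dslope (g q.1) (a q.1) q.2) (dslope g₀ w q.2) (dslope g₀ w w)]

theorem newton_tendsto {P : Type*} {l : Filter P} {G : Set ℂ} (hG : IsOpen G)
    {g : P → ℂ → ℂ} {g₀ : ℂ → ℂ} {z : P → ℕ → ℂ} {z₀ : ℕ → ℂ} {n : ℕ}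
    (hg : ∀ᶠ p in l, DifferentiableOn ℂ (g p) G) (hg₀ : DifferentiableOn ℂ g₀ G)
    (hz : ∀ i < n, Tendsto (fun p => z p i) l (𝓝 (z₀ i))) (hz₀ : ∀ i < n, z₀ i ∈ G)
    (h : ∀ w ∈ G, Tendsto (fun q : P × ℂ => g q.1 q.2) (l ×ˢ 𝓝 w) (𝓝 (g₀ w))) :
    ∀ w ∈ G, Tendsto (fun q : P × ℂ => newton (z q.1) (g q.1) n q.2) (l ×ˢ 𝓝 w)
      (𝓝 (newton z₀ g₀ n w)) := by
  induction n with
  | zero => exact h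
  | succ n ih =>
    have hz' : ∀ᶠ p in l, ∀ i < n, z p i ∈ G := by
      have : ∀ᶠ p in l, ∀ i ∈ Finset.range n, z p i ∈ G := by
        rw [Filter.eventually_all_finset]
        intro i hi
        have hi := Finset.mem_range.1 hi
        exact (hz i (by omega)).eventually (hG.mem_nhds (hz₀ i (by omega)))
      exact this.mono fun p hp i hi => hp i (Finset.mem_range.2 hi)
    have ih := ih (fun i hi => hz i (by omega)) (fun i hi => hz₀ i (by omega))
    have h1 : ∀ᶠ p in l, DifferentiableOn ℂ (newton (z p) (g p) n) G := by
      filter_upwards [hg, hz'] with p h1 h2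
      exact newton_differentiableOn hG h2 h1
    have h2 : DifferentiableOn ℂ (newton z₀ g₀ n) G :=
      newton_differentiableOn hG (fun i hi => hz₀ i (by omega)) hg₀
    simp only [newton]
    exact dslope_tendsto (g := fun p => newton (z p) (g p) n) (a := fun p => z p n) hG h1 h2
      (hz n (by omega)) (hz₀ n (by omega)) ih

theorem newton_tendsto_at {P : Type*} {l : Filter P} {G : Set ℂ} (hG : IsOpen G)
    {g : P → ℂ → ℂ} {g₀ : ℂ → ℂ} {z : P → ℕ → ℂ} {z₀ : ℕ → ℂ} {n : ℕ} {w : P → ℂ} {w₀ : ℂ}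
    (hg : ∀ᶠ p in l, DifferentiableOn ℂ (g p) G) (hg₀ : DifferentiableOn ℂ g₀ G)
    (hz : ∀ i < n, Tendsto (fun p => z p i) l (𝓝 (z₀ i))) (hz₀ : ∀ i < n, z₀ i ∈ G)
    (h : ∀ w ∈ G, Tendsto (fun q : P × ℂ => g q.1 q.2) (l ×ˢ 𝓝 w) (𝓝 (g₀ w)))
    (hw : Tendsto w l (𝓝 w₀)) (hw₀ : w₀ ∈ G) :
    Tendsto (fun p => newton (z p) (g p) n (w p)) l (𝓝 (newton z₀ g₀ n w₀)) :=
  (newton_tendsto hG hg hg₀ hz hz₀ h w₀ hw₀).comp (tendsto_id.prodMk hw)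

/-- Newton divided differences depend continuously on the nodes, coincident ones included. -/
theorem newton_tendsto_nodes {P : Type*} {l : Filter P} {G : Set ℂ} (hG : IsOpen G)
    {g : ℂ → ℂ} {z : P → ℕ → ℂ} {z₀ : ℕ → ℂ} {n : ℕ} {w : P → ℂ} {w₀ : ℂ}
    (hg : DifferentiableOn ℂ g G)
    (hz : ∀ i < n, Tendsto (fun p => z p i) l (𝓝 (z₀ i))) (hz₀ : ∀ i < n, z₀ i ∈ G)
    (hw : Tendsto w l (𝓝 w₀)) (hw₀ : w₀ ∈ G) :
    Tendsto (fun p => newton (z p) g n (w p)) l (𝓝 (newton z₀ g n w₀)) :=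
  newton_tendsto_at hG (g := fun _ => g) (Eventually.of_forall fun _ => hg) hg hz hz₀
    (fun _ hw => (hg.continuousOn.continuousAt (hG.mem_nhds hw)).tendsto.comp tendsto_snd) hw hw₀

/-- At distance at least `δ` from `a` the quotient is estimated directly; closer in, the maximum
principle on the disk of radius `δ` gives the same bound. -/
theorem dslope_norm_le {G : Set ℂ} (hG : IsOpen G) {h : ℂ → ℂ} (hh : DifferentiableOn ℂ h G)
    {a w : ℂ} {δ m : ℝ} (hδ : 0 < δ) (ha : Metric.closedBall a δ ⊆ G)
    (hm : ∀ x ∈ Metric.closedBall a δ, ‖h x‖ ≤ m) (hw : ‖h w‖ ≤ m) :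
    ‖dslope h a w‖ ≤ 2 * m / δ := by
  have haG : a ∈ G := ha (Metric.mem_closedBall_self hδ.le)
  have hm0 : 0 ≤ m := (norm_nonneg _).trans hw
  have far : ∀ x, ‖h x‖ ≤ m → δ ≤ dist x a → ‖dslope h a x‖ ≤ 2 * m / δ := by
    intro x hx hxa
    have hne : x ≠ a := by
      rintro rfl
      rw [dist_self] at hxa
      linarith
    rw [dslope_of_ne _ hne, slope_def_field, norm_div, ← dist_eq_norm x a]
    have h1 := norm_sub_le (h x) (h a)
    have h2 := hm a (Metric.mem_closedBall_self hδ.le)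
    exact div_le_div₀ (by positivity) (by linarith) hδ hxa
  rcases le_or_gt δ (dist w a) with hd | hd
  · exact far w hw hd
  · refine Complex.norm_le_of_forall_mem_frontier_norm_le Metric.isBounded_ball
      (dslope_diffContOnCl hG hh haG ha) (fun y hy => ?_) (z := w)
      (subset_closure (Metric.mem_ball.2 hd))
    rw [frontier_ball _ hδ.ne'] at hy
    exact far y (hm y (Metric.sphere_subset_closedBall hy)) (Metric.mem_sphere.1 hy).ge

/-- Each division enlarges the compact set by a small thickening inside `G`. The set and the
constant depend neither on the function nor on how close the nodes are. -/
theorem newton_norm_le {G : Set ℂ} (hG : IsOpen G) (n : ℕ) {S : Set ℂ} (hS : IsCompact S)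
    (hSG : S ⊆ G) : ∃ K, IsCompact K ∧ K ⊆ G ∧ ∃ C : ℝ, 0 ≤ C ∧ ∀ z : ℕ → ℂ, (∀ i < n, z i ∈ S) →
      ∀ h : ℂ → ℂ, DifferentiableOn ℂ h G → ∀ m : ℝ, (∀ x ∈ K, ‖h x‖ ≤ m) →
        ∀ w ∈ S, ‖newton z h n w‖ ≤ C * m := by
  induction n generalizing S with
  | zero => exact ⟨S, hS, hSG, 1, zero_le_one, fun z _ h _ m hm w hw => by simpa [newton] using hm w hw⟩
  | succ n ih =>
    obtain ⟨δ, hδ, hδG⟩ := hS.exists_cthickening_subset_open hG hSG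
    have hsub : S ⊆ Metric.cthickening δ S := Metric.self_subset_cthickening S
    obtain ⟨K, hK, hKG, C, hC, hb⟩ := ih hS.cthickening hδG
    refine ⟨K, hK, hKG, 2 * C / δ, by positivity, fun z hz h hh m hm w hw => ?_⟩
    have hb := hb z (fun i hi => hsub (hz i (by omega))) h hh m hm
    have hball := Metric.closedBall_subset_cthickening (hz n (by omega)) δ
    have := dslope_norm_le hG (newton_differentiableOn hG (z := z) (n := n)
      (fun i hi => hSG (hz i (by omega))) hh) hδ (hball.trans hδG)
      (fun x hx => hb x (hball hx)) (hb w (hsub hw))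
    simp only [newton]
    exact this.trans_eq (by ring)

/-! ### Gaussian measure on `ℂᵏ` and affine substitution. -/

theorem lintegral_fin_prod_eq_prod {n : ℕ} {E : Type*} [MeasurableSpace E]
    {μ : Fin n → Measure E} [∀ i, SigmaFinite (μ i)] {f : Fin n → E → ENNReal}
    (hf : ∀ i, Measurable (f i)) :
    ∫⁻ x : Fin n → E, ∏ i, f i (x i) ∂(Measure.pi μ) = ∏ i, ∫⁻ x, f i x ∂(μ i) := by
  induction n with
  | zero => simp
  | succ n ih =>
    calc
      _ = ∫⁻ x : E × (Fin n → E), f 0 x.1 * ∏ i : Fin n, f (Fin.succ i) (x.2 i)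
            ∂((μ 0).prod (Measure.pi (fun i ↦ μ i.succ))) := by
        rw [← ((measurePreserving_piFinSuccAbove μ 0).symm).lintegral_comp (by fun_prop)]
        refine lintegral_congr fun x => ?_
        rw [Fin.prod_univ_succ]
        rfl
      _ = (∫⁻ x, f 0 x ∂μ 0) * ∏ i : Fin n, ∫⁻ x, f (Fin.succ i) x ∂(μ i.succ) := by
        rw [← ih (μ := fun i => μ i.succ) (f := fun i => f i.succ) fun i => hf _]
        exact lintegral_prod_mul (μ := μ 0) (ν := Measure.pi fun i : Fin n => μ i.succ)
          (f := f 0) (g := fun y : Fin n → E => ∏ i, f i.succ (y i)) (hf 0).aemeasurable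
          (Finset.measurable_fun_prod _ fun i _ => (hf _).comp (measurable_pi_apply i)).aemeasurable
      _ = ∏ i, ∫⁻ x, f i x ∂(μ i) := by rw [Fin.prod_univ_succ]

/-- Density of `k` independent standard complex Gaussian variables. -/
noncomputable def gaussianWeight {k : ℕ} (x : Fin k → ℂ) : ENNReal :=
  ∏ a, ENNReal.ofReal (Real.pi⁻¹ * Real.exp (-‖x a‖ ^ 2))

theorem continuous_gaussianWeight {k : ℕ} : Continuous (gaussianWeight (k := k)) := by
  have : gaussianWeight (k := k)
      = fun x => ENNReal.ofReal (∏ a, (Real.pi⁻¹ * Real.exp (-‖x a‖ ^ 2))) := by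
    ext x
    rw [ENNReal.ofReal_prod_of_nonneg fun _ _ => by positivity]
    rfl
  rw [this]
  exact ENNReal.continuous_ofReal.comp (by fun_prop)

theorem gaussianWeight_eq {k : ℕ} (x : Fin k → ℂ) :
    gaussianWeight x = ENNReal.ofReal (Real.pi⁻¹ ^ k * Real.exp (-∑ a, ‖x a‖ ^ 2)) := by
  rw [gaussianWeight, ← ENNReal.ofReal_prod_of_nonneg fun _ _ => by positivity,
    Finset.prod_mul_distrib, ← Finset.sum_neg_distrib, Real.exp_sum]
  simp

theorem gaussianWeight_le_one {k : ℕ} (x : Fin k → ℂ) : gaussianWeight x ≤ 1 := by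
  refine Finset.prod_le_one' fun a _ => ?_
  rw [ENNReal.ofReal_le_one]
  have h1 : Real.pi⁻¹ ≤ 1 := inv_le_one_of_one_le₀ (by linarith [Real.pi_gt_three])
  have h2 : Real.exp (-‖x a‖ ^ 2) ≤ 1 := Real.exp_le_one_iff.2 (by nlinarith [sq_nonneg ‖x a‖])
  exact mul_le_one₀ h1 (Real.exp_nonneg _) h2

instance : SigmaFinite stdComplexGaussian := SigmaFinite.withDensity_ofReal _

theorem pi_stdComplexGaussian (k : ℕ) :
    Measure.pi (fun _ : Fin k => stdComplexGaussian)
      = (volume : Measure (Fin k → ℂ)).withDensity gaussianWeight := by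
  refine Measure.pi_eq fun s hs => ?_
  rw [withDensity_apply _ (MeasurableSet.univ_pi hs), volume_pi, Measure.restrict_pi_pi]
  refine (lintegral_fin_prod_eq_prod
    (f := fun _ z => ENNReal.ofReal (Real.pi⁻¹ * Real.exp (-‖z‖ ^ 2))) fun i => by fun_prop).trans
    (Finset.prod_congr rfl fun i _ => ?_)
  rw [stdComplexGaussian, withDensity_apply _ (hs i)]

/-- The real Jacobian of a complex linear map is the squared modulus of its complex determinant. -/
theorem lintegral_comp_affine {k : ℕ} {f : (Fin k → ℂ) → ENNReal} (hf : Measurable f)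
    {T : Matrix (Fin k) (Fin k) ℂ} (hT : T.det ≠ 0) (b : Fin k → ℂ) :
    ∫⁻ x, f x = ENNReal.ofReal (‖T.det‖ ^ 2) * ∫⁻ v, f (b + T.mulVec v) := by
  set L : (Fin k → ℂ) →ₗ[ℝ] (Fin k → ℂ) := (Matrix.toLin' T).restrictScalars ℝ with hL
  have hdet : LinearMap.det L = ‖T.det‖ ^ 2 := by
    rw [hL, LinearMap.det_restrictScalars, LinearMap.det_toLin', Algebra.norm_complex_apply,
      Complex.normSq_eq_norm_sq]
  have hpos : 0 < ‖T.det‖ ^ 2 := by positivity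
  have hmap := Measure.map_linearMap_addHaar_eq_smul_addHaar (volume : Measure (Fin k → ℂ))
    (f := L) (by rw [hdet]; exact hpos.ne')
  have hLm : Measurable L := L.continuous_of_finiteDimensional.measurable
  have h1 : ∫⁻ v, f (b + T.mulVec v)
      = ENNReal.ofReal (‖T.det‖ ^ 2)⁻¹ * ∫⁻ x, f x := by
    rw [← lintegral_add_left_eq_self f b]
    have : ∫⁻ x, f (b + x) ∂(volume.map L) = ∫⁻ v, f (b + T.mulVec v) :=
      lintegral_map (by fun_prop) hLm
    rw [← this, hmap, hdet, lintegral_smul_measure, abs_of_pos (by positivity), smul_eq_mul]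
  rw [h1, ← mul_assoc, ← ENNReal.ofReal_mul hpos.le, mul_inv_cancel₀ hpos.ne', ENNReal.ofReal_one,
    one_mul]

/-- The substitution `x = b + ε A⁻¹ v` has Jacobian `ε²ᵏ |det A|⁻²`, which cancels the powers of `ε`
in the normalisation and leaves an integral with a limit. -/
theorem gaussian_measure_div {k : ℕ} {E : Set (Fin k → ℂ)} (hE : MeasurableSet E)
    {A : Matrix (Fin k) (Fin k) ℂ} (hA : A.det ≠ 0) (b : Fin k → ℂ) {ε : ℝ} (hε : 0 < ε) :
    Measure.pi (fun _ : Fin k => stdComplexGaussian) E / ENNReal.ofReal ((Real.pi * ε ^ 2) ^ k)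
      = ENNReal.ofReal ((‖A.det‖ ^ 2)⁻¹ * Real.pi⁻¹ ^ k)
        * ∫⁻ v, E.indicator gaussianWeight (b + ((ε : ℂ) • A⁻¹).mulVec v) := by
  have hdet : ((ε : ℂ) • A⁻¹).det = (ε : ℂ) ^ k * A.det⁻¹ := by
    rw [Matrix.det_smul, Matrix.det_nonsing_inv, Fintype.card_fin, Ring.inverse_eq_inv']
  have hε' : (ε : ℂ) ≠ 0 := by exact_mod_cast hε.ne'
  have h0 : ((ε : ℂ) • A⁻¹).det ≠ 0 := by
    rw [hdet]; exact mul_ne_zero (pow_ne_zero _ hε') (inv_ne_zero hA)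
  have hA' : 0 < ‖A.det‖ := norm_pos_iff.2 hA
  rw [pi_stdComplexGaussian, withDensity_apply _ hE, ← lintegral_indicator hE,
    lintegral_comp_affine (continuous_gaussianWeight.measurable.indicator hE) h0 b, hdet,
    mul_comm, mul_div_assoc, mul_comm, ← ENNReal.ofReal_div_of_pos (by positivity)]
  congr 2
  rw [norm_mul, norm_pow, norm_inv, Complex.norm_real, Real.norm_of_nonneg hε.le]
  field_simp
  rw [← mul_pow, ← pow_mul, mul_comm k, pow_mul]
  congr 1
  field_simp

/-! ### Zeros of `g + ε p` in the disk of radius `ε` about a zero of `g`. -/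

/-- One-variable analysis of zeros of a small perturbation of an analytic function near a zero. -/
theorem eventually_perturbation_bound {G : Set ℂ} (hG : IsOpen G) {g p : ℂ → ℂ}
    (hg : DifferentiableOn ℂ g G) (hp : DifferentiableOn ℂ p G) {z : ℂ} (hz : z ∈ G)
    (h0 : g z = 0) {η : ℝ} (hη : 0 < η) :
    ∀ᶠ ε : ℝ in 𝓝[>] 0, Metric.closedBall z ε ⊆ G ∧ 0 < ε ∧ ∀ w ∈ Metric.closedBall z ε,
      ‖(g w + ε * p w) - (deriv g z * (w - z) + ε * p z)‖ ≤ 2 * η * ε := by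
  have hG' := hG.mem_nhds hz
  have h1 := (hasDerivAt_iff_isLittleO.1 (hg.differentiableAt hG').hasDerivAt).def hη
  have h2 : ∀ᶠ w in 𝓝 z, ‖p w - p z‖ < η := by
    have := (hp.continuousOn.continuousAt hG').tendsto.sub_const (p z)
    rw [sub_self] at this
    simpa using this.norm.eventually_lt_const (by simpa using hη)
  obtain ⟨r, hr, hrs⟩ := Metric.eventually_nhds_iff_ball.1
    (h1.and (h2.and (hG.eventually_mem hz)))
  filter_upwards [self_mem_nhdsWithin, mem_nhdsWithin_of_mem_nhds (Iio_mem_nhds hr)] with ε hε hεr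
  have hε : 0 < ε := hε
  have hsub : ∀ w ∈ Metric.closedBall z ε, w ∈ Metric.ball z r := fun w hw =>
    Metric.closedBall_subset_ball hεr hw
  refine ⟨fun w hw => (hrs w (hsub w hw)).2.2, hε, fun w hw => ?_⟩
  obtain ⟨ha, hb, -⟩ := hrs w (hsub w hw)
  have hwz : ‖w - z‖ ≤ ε := by simpa [dist_eq_norm] using hw
  simp only [h0, sub_zero, smul_eq_mul] at ha
  calc ‖(g w + ε * p w) - (deriv g z * (w - z) + ε * p z)‖
      = ‖(g w - (w - z) * deriv g z) + ε * (p w - p z)‖ := by congr 1; ring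
    _ ≤ ‖g w - (w - z) * deriv g z‖ + ‖(ε : ℂ) * (p w - p z)‖ := norm_add_le _ _
    _ ≤ η * ε + ε * η := by
        rw [norm_mul, Complex.norm_real, Real.norm_of_nonneg hε.le]
        gcongr
        exact ha.trans (by gcongr)
    _ = 2 * η * ε := by ring

theorem eventually_not_exists_zero {G : Set ℂ} (hG : IsOpen G) {g p : ℂ → ℂ}
    (hg : DifferentiableOn ℂ g G) (hp : DifferentiableOn ℂ p G) {z : ℂ} (hz : z ∈ G)
    (h0 : g z = 0) (hlt : ‖deriv g z‖ < ‖p z‖) :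
    ∀ᶠ ε : ℝ in 𝓝[>] 0, ¬ ∃ w, ‖w - z‖ ≤ ε ∧ g w + ε * p w = 0 := by
  -- The linear model `g'(z)(w - z) + ε p(z)` has modulus at least `(‖p z‖ - ‖deriv g z‖) ε` on the
  -- disk; this choice of `η` makes the error half of that.
  filter_upwards [eventually_perturbation_bound hG hg hp hz h0
    (η := (‖p z‖ - ‖deriv g z‖) / 4) (by linarith)] with ε ⟨_, hε, hb⟩
  rintro ⟨w, hw, hw0⟩
  have hb := hb w (by simpa [dist_eq_norm] using hw)
  rw [hw0, zero_sub, norm_neg] at hb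
  have h1 : ‖(ε : ℂ) * p z‖ ≤ ‖deriv g z * (w - z) + ε * p z‖ + ‖deriv g z * (w - z)‖ := by
    have := norm_sub_le (deriv g z * (w - z) + ε * p z) (deriv g z * (w - z))
    rwa [add_sub_cancel_left] at this
  rw [norm_mul, norm_mul, Complex.norm_real, Real.norm_of_nonneg hε.le] at h1
  have h2 : ‖deriv g z‖ * ‖w - z‖ ≤ ‖deriv g z‖ * ε := by gcongr
  nlinarith

/-- The linear model vanishes at `w₀ = z - ε p(z) / g'(z)`, inside the disk. Without a zero of `H =
g + ε p` there, `1 / H` would be analytic, yet larger at `w₀` than the maximum principle permits. -/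
theorem eventually_exists_zero {G : Set ℂ} (hG : IsOpen G) {g p : ℂ → ℂ}
    (hg : DifferentiableOn ℂ g G) (hp : DifferentiableOn ℂ p G) {z : ℂ} (hz : z ∈ G)
    (h0 : g z = 0) (hlt : ‖p z‖ < ‖deriv g z‖) :
    ∀ᶠ ε : ℝ in 𝓝[>] 0, ∃ w, ‖w - z‖ ≤ ε ∧ g w + ε * p w = 0 := by
  set d := deriv g z with hd
  have hd0 : 0 < ‖d‖ := (norm_nonneg _).trans_lt hlt
  have hd0' : d ≠ 0 := norm_pos_iff.1 hd0
  set t := -p z / d with ht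
  have ht1 : ‖t‖ < 1 := by
    rw [ht, norm_div, norm_neg, div_lt_one hd0]; exact hlt
  set ρ := 1 - ‖t‖ with hρ
  have hρ0 : 0 < ρ := by linarith
  -- The error is then `‖d‖ρε/8`: at `w₀` this bounds `|H|`, while on the circle of radius `ερ`
  -- about `w₀` it leaves `|H| ≥ ‖d‖ρε/2`.
  filter_upwards [eventually_perturbation_bound hG hg hp hz h0
    (η := ‖d‖ * ρ / 16) (by positivity)] with ε ⟨hεG, hε, hb⟩
  by_contra hne
  push Not at hne
  set H : ℂ → ℂ := fun w => g w + ε * p w with hH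
  set w₀ := z + ε * t with hw₀
  have hdt : d * (w₀ - z) + ε * p z = 0 := by
    rw [hw₀, ht]; field_simp; ring
  have hw₀z : ‖w₀ - z‖ = ε * ‖t‖ := by
    rw [hw₀, add_sub_cancel_left, norm_mul, Complex.norm_real, Real.norm_of_nonneg hε.le]
  have hsub : Metric.closedBall w₀ (ε * ρ) ⊆ Metric.closedBall z ε := by
    refine Metric.closedBall_subset_closedBall' ?_
    rw [dist_eq_norm, hw₀z, hρ]; linarith
  have hr : 0 < ε * ρ := by positivity
  have hHd : DifferentiableOn ℂ H G := hg.add (hp.const_mul _)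
  have hcl : closure (Metric.ball w₀ (ε * ρ)) = Metric.closedBall w₀ (ε * ρ) :=
    closure_ball _ hr.ne'
  have hdc : DiffContOnCl ℂ H (Metric.ball w₀ (ε * ρ)) :=
    (hHd.mono (hcl.trans_subset (hsub.trans hεG))).diffContOnCl
  have hinv := hdc.inv (fun x hx => hne x (by simpa [dist_eq_norm] using hsub (hcl ▸ hx)))
  have hlow : ∀ w ∈ frontier (Metric.ball w₀ (ε * ρ)), ‖H⁻¹ w‖ ≤ (‖d‖ * ρ * ε / 2)⁻¹ := by
    intro w hw
    rw [frontier_ball _ hr.ne'] at hw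
    have hb := hb w (hsub (Metric.sphere_subset_closedBall hw))
    have e : d * (w - z) + ε * p z = d * (w - w₀) := by linear_combination hdt
    rw [e] at hb
    have hw' : ‖w - w₀‖ = ε * ρ := by simpa [dist_eq_norm] using hw
    have h1 := norm_sub_norm_le (d * (w - w₀)) (H w)
    rw [norm_sub_rev, norm_mul, hw'] at h1
    rw [Pi.inv_apply, norm_inv]
    refine inv_anti₀ (by positivity) ?_
    have : 0 < ‖d‖ * ρ * ε := by positivity
    nlinarith
  have hcen := Complex.norm_le_of_forall_mem_frontier_norm_le Metric.isBounded_ball hinv hlow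
    (z := w₀) (subset_closure (Metric.mem_ball_self hr))
  have hw₀B : w₀ ∈ Metric.closedBall z ε := hsub (Metric.mem_closedBall_self hr.le)
  have hb0 := hb w₀ hw₀B
  rw [hdt, sub_zero] at hb0
  have hH0 : 0 < ‖H w₀‖ := norm_pos_iff.2 (hne w₀ (by simpa [dist_eq_norm] using hw₀B))
  rw [Pi.inv_apply, norm_inv] at hcen
  have := (inv_le_inv₀ hH0 (by positivity)).1 hcen
  have h3 : 0 < ‖d‖ * ρ * ε := by positivity
  change ‖H w₀‖ ≤ _ at hb0
  nlinarith

/-! ### Measurability of the event that all disks are hit. -/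

/-- A dense sequence in the closed disk of center `c` and radius `r ≥ 0`. -/
noncomputable def diskSeq (c : ℂ) (r : ℝ) (n : ℕ) : ℂ :=
  haveI : Nonempty (Metric.closedBall (0 : ℂ) 1) := ⟨⟨0, by simp⟩⟩
  c + r * (TopologicalSpace.denseSeq (Metric.closedBall (0 : ℂ) 1) n : ℂ)

theorem norm_diskSeq_sub_le (c : ℂ) {r : ℝ} (hr : 0 ≤ r) (n : ℕ) : ‖diskSeq c r n - c‖ ≤ r := by
  have : Nonempty (Metric.closedBall (0 : ℂ) 1) := ⟨⟨0, by simp⟩⟩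
  have h := (TopologicalSpace.denseSeq (Metric.closedBall (0 : ℂ) 1) n).2
  rw [mem_closedBall_zero_iff] at h
  rw [diskSeq, add_sub_cancel_left, norm_mul, Complex.norm_real, Real.norm_of_nonneg hr]
  exact mul_le_of_le_one_right hr h

/-- On a compact disk a zero exists iff the infimum of `|h|` is zero, and continuity lets a dense
sequence detect this. The event thus becomes a countable combination of conditions on point values.
-/
theorem exists_zero_iff_diskSeq {h : ℂ → ℂ} {c : ℂ} {r : ℝ} (hr : 0 ≤ r)
    (hc : ContinuousOn h (Metric.closedBall c r)) :
    (∃ w, ‖w - c‖ ≤ r ∧ h w = 0) ↔ ∀ m : ℕ, ∃ n, ‖h (diskSeq c r n)‖ < 1 / ((m : ℝ) + 1) := by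
  have : Nonempty (Metric.closedBall (0 : ℂ) 1) := ⟨⟨0, by simp⟩⟩
  constructor
  · rintro ⟨w, hw, hw0⟩ m
    set q : Metric.closedBall (0 : ℂ) 1 → ℂ := fun t => h (c + r * t) with hq
    have hmem : ∀ t : Metric.closedBall (0 : ℂ) 1, c + r * (t : ℂ) ∈ Metric.closedBall c r := by
      intro t
      have ht := t.2
      rw [mem_closedBall_zero_iff] at ht
      rw [mem_closedBall_iff_norm, add_sub_cancel_left, norm_mul, Complex.norm_real,
        Real.norm_of_nonneg hr]
      exact mul_le_of_le_one_right hr ht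
    have hqc : Continuous q := hc.comp_continuous (by fun_prop) hmem
    obtain ⟨t, ht⟩ : ∃ t : Metric.closedBall (0 : ℂ) 1, c + r * (t : ℂ) = w := by
      rcases hr.eq_or_lt with rfl | hr
      · refine ⟨⟨0, by simp⟩, ?_⟩
        have : w - c = 0 := norm_le_zero_iff.1 hw
        simp [sub_eq_zero.1 this]
      · refine ⟨⟨(w - c) / r, ?_⟩, ?_⟩
        · rw [mem_closedBall_zero_iff, norm_div, Complex.norm_real, Real.norm_of_nonneg hr.le,
            div_le_one hr]
          exact hw
        · have : (r : ℂ) ≠ 0 := by exact_mod_cast hr.ne'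
          field_simp
          ring
    have hopen : IsOpen {t | ‖q t‖ < 1 / ((m : ℝ) + 1)} :=
      isOpen_lt hqc.norm continuous_const
    obtain ⟨n, hn⟩ := (TopologicalSpace.denseRange_denseSeq
      (Metric.closedBall (0 : ℂ) 1)).exists_mem_open hopen ⟨t, by
        have : q t = 0 := by rw [hq]; simp only [ht, hw0]
        simp only [Set.mem_ofPred_eq, this, norm_zero]; positivity⟩
    exact ⟨n, hn⟩
  · intro hm
    obtain ⟨w, hw, hmin⟩ := (isCompact_closedBall c r).exists_isMinOn
      ⟨c, Metric.mem_closedBall_self hr⟩ hc.norm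
    refine ⟨w, by simpa [dist_eq_norm] using hw, ?_⟩
    by_contra hne
    obtain ⟨m, hm'⟩ := exists_nat_one_div_lt (norm_pos_iff.2 hne)
    obtain ⟨n, hn⟩ := hm m
    have := isMinOn_iff.1 hmin (diskSeq c r n)
      (by simpa [dist_eq_norm] using norm_diskSeq_sub_le c hr n)
    linarith

theorem measurableSet_approxHit {α : Type*} [MeasurableSpace α] {k : ℕ} (z : Fin k → ℂ) (ε : ℝ)
    {H : α → ℂ → ℂ} (hH : ∀ j n, Measurable fun y => H y (diskSeq (z j) ε n)) :
    MeasurableSet {y | ∀ j : Fin k, ∀ m : ℕ, ∃ n, ‖H y (diskSeq (z j) ε n)‖ < 1 / ((m : ℝ) + 1)} := by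
  simp only [Set.ofPred_forall, Set.ofPred_exists]
  exact .iInter fun j => .iInter fun m => .iUnion fun n =>
    measurableSet_lt (hH j n).norm measurable_const

/-- Coefficients `x` for which `∑ xₐ φₐ + R` has a zero within `ε` of every `z j`. -/
def hitSet {k : ℕ} (z : Fin k → ℂ) (ε : ℝ) (φ : Fin k → ℂ → ℂ) (R : ℂ → ℂ) : Set (Fin k → ℂ) :=
  {x | ∀ j, ∃ w, ‖w - z j‖ ≤ ε ∧ ∑ a, x a * φ a w + R w = 0}

theorem hitSet_eq_approx {k : ℕ} {G : Set ℂ} {z : Fin k → ℂ} {φ : Fin k → ℂ → ℂ}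
    (hφ : ∀ a, DifferentiableOn ℂ (φ a) G) {R : ℂ → ℂ} (hR : DifferentiableOn ℂ R G)
    {ε : ℝ} (hε : 0 ≤ ε) (hB : ∀ j, Metric.closedBall (z j) ε ⊆ G) :
    hitSet z ε φ R = {x | ∀ j : Fin k, ∀ m : ℕ, ∃ n,
      ‖∑ a, x a * φ a (diskSeq (z j) ε n) + R (diskSeq (z j) ε n)‖ < 1 / ((m : ℝ) + 1)} := by
  ext x
  refine forall_congr' fun j => exists_zero_iff_diskSeq hε ?_
  exact ((DifferentiableOn.fun_sum fun a _ => (hφ a).const_mul (x a)).add hR).continuousOn.mono (hB j)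

theorem measurableSet_hitSet {k : ℕ} {G : Set ℂ} {z : Fin k → ℂ} {φ : Fin k → ℂ → ℂ}
    (hφ : ∀ a, DifferentiableOn ℂ (φ a) G) {R : ℂ → ℂ} (hR : DifferentiableOn ℂ R G)
    {ε : ℝ} (hε : 0 ≤ ε) (hB : ∀ j, Metric.closedBall (z j) ε ⊆ G) :
    MeasurableSet (hitSet z ε φ R) := by
  rw [hitSet_eq_approx hφ hR hε hB]
  exact measurableSet_approxHit (H := fun (x : Fin k → ℂ) w => ∑ a, x a * φ a w + R w) z ε
    fun j n => by fun_prop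

theorem mem_hitSet_affine {k : ℕ} {z : Fin k → ℂ} {ε : ℝ} {φ : Fin k → ℂ → ℂ} {R : ℂ → ℂ}
    (xs v : Fin k → ℂ) (B : Matrix (Fin k) (Fin k) ℂ) :
    xs + ((ε : ℂ) • B).mulVec v ∈ hitSet z ε φ R ↔ ∀ j, ∃ w, ‖w - z j‖ ≤ ε ∧
      (∑ a, xs a * φ a w + R w) + ε * ∑ a, B.mulVec v a * φ a w = 0 := by
  refine forall_congr' fun j => exists_congr fun w => and_congr_right fun _ => ?_
  have : ∑ a, (xs + ((ε : ℂ) • B).mulVec v) a * φ a w + R w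
      = (∑ a, xs a * φ a w + R w) + ε * ∑ a, B.mulVec v a * φ a w := by
    rw [Matrix.smul_mulVec, Finset.mul_sum]
    simp only [Pi.add_apply, Pi.smul_apply, smul_eq_mul, add_mul, Finset.sum_add_distrib, mul_assoc]
    ring
  rw [this]

/-! ### Hitting probabilities for a frozen remainder `R`. -/

theorem eventually_forall_closedBall_subset {k : ℕ} {G : Set ℂ} (hG : IsOpen G) {z : Fin k → ℂ}
    (hz : ∀ j, z j ∈ G) : ∀ᶠ ε : ℝ in 𝓝[>] 0, 0 < ε ∧ ∀ j, Metric.closedBall (z j) ε ⊆ G :=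
  Eventually.and self_mem_nhdsWithin (eventually_all.2 fun j =>
    nhdsWithin_le_nhds (eventually_closedBall_subset (hG.mem_nhds (hz j))))

/-- Let `p = ∑ (A⁻¹v)ₐ φₐ`, so `p(z_j) = v_j`. A zero `w` near `z_j` gives `|p(w)| = |g(w)|/ε ≤
2m/r`, while `|p(w) - v_j| ≤ ‖v‖/2` for small `r`; hence `‖v‖ ≤ 2m/r + ‖v‖/2`, and the last term is
absorbed. The radius depends on `φ` and `z` only, so the bound is uniform in `ε` and in `g`. -/
theorem exists_norm_le_of_hit {k : ℕ} {G : Set ℂ} (hG : IsOpen G) {z : Fin k → ℂ}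
    (hz : ∀ j, z j ∈ G) {φ : Fin k → ℂ → ℂ} (hφ : ∀ a, DifferentiableOn ℂ (φ a) G)
    (hA : (Matrix.of fun j a => φ a (z j)).det ≠ 0) :
    ∃ r : ℝ, 0 < r ∧ (∀ j, Metric.closedBall (z j) r ⊆ G) ∧
      ∀ (g : ℂ → ℂ) (m : ℝ), DifferentiableOn ℂ g G → (∀ j, g (z j) = 0) →
        (∀ j, ∀ w ∈ Metric.closedBall (z j) r, ‖g w‖ ≤ m) →
        ∀ (v : Fin k → ℂ) (ε : ℝ), 0 < ε → ε ≤ r →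
          (∀ j, ∃ w, ‖w - z j‖ ≤ ε ∧
            g w + ε * ∑ a, (Matrix.of fun j a => φ a (z j))⁻¹.mulVec v a * φ a w = 0) →
          ∀ j, ‖v j‖ ≤ 4 * m / r := by
  set A := Matrix.of fun j a => φ a (z j) with hAdef
  set T := (Matrix.toLin' A⁻¹).toContinuousLinearMap
  have hTv : ∀ v, T v = A⁻¹.mulVec v := fun v => rfl
  have hev : ∀ j, ∀ᶠ w in 𝓝 (z j), ∀ i, z i = z j → ‖T‖ * ∑ a, ‖φ a w - φ a (z i)‖ < 1 / 2 := by
    intro j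
    refine eventually_all.2 fun i => ?_
    by_cases hij : z i = z j
    · have hc : ∀ a, Tendsto (φ a) (𝓝 (z j)) (𝓝 (φ a (z j))) := fun a =>
        ((hφ a).continuousOn.continuousAt (hG.mem_nhds (hz j))).tendsto
      have : Tendsto (fun w => ‖T‖ * ∑ a, ‖φ a w - φ a (z i)‖) (𝓝 (z j))
          (𝓝 (‖T‖ * ∑ a, ‖φ a (z j) - φ a (z i)‖)) :=
        (tendsto_finsetSum _ fun a _ => ((hc a).sub_const _).norm).const_mul _
      rw [hij] at this
      simp only [sub_self, norm_zero, Finset.sum_const_zero, mul_zero] at this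
      filter_upwards [this.eventually_lt_const (show (0 : ℝ) < 1 / 2 by norm_num)] with w hw _
      rwa [hij]
    · simp [hij]
  have hr : ∀ j, ∃ r : ℝ, 0 < r ∧ Metric.closedBall (z j) r ⊆ G ∧
      ∀ w ∈ Metric.closedBall (z j) r, ‖T‖ * ∑ a, ‖φ a w - φ a (z j)‖ < 1 / 2 := fun j => by
    obtain ⟨r, hr, hrs⟩ := Metric.nhds_basis_closedBall.mem_iff.1
      ((hG.eventually_mem (hz j)).and (hev j))
    exact ⟨r, hr, fun w hw => (hrs hw).1, fun w hw => (hrs hw).2 j rfl⟩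
  choose r hr hrG hrs using hr
  obtain ⟨r₀, hr₀, hr₀r⟩ : ∃ r₀ : ℝ, 0 < r₀ ∧ ∀ j, r₀ ≤ r j := by
    have : ∀ᶠ s : ℝ in 𝓝[>] 0, ∀ j, s ≤ r j := eventually_all.2 fun j =>
      mem_nhdsWithin_of_mem_nhds (Iic_mem_nhds (hr j))
    obtain ⟨s, h1, h2⟩ := (this.and self_mem_nhdsWithin).exists
    exact ⟨s, h2, h1⟩
  have hsub : ∀ j, Metric.closedBall (z j) r₀ ⊆ Metric.closedBall (z j) (r j) := fun j =>
    Metric.closedBall_subset_closedBall (hr₀r j)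
  refine ⟨r₀, hr₀, fun j => (hsub j).trans (hrG j), fun g m hg hg0 hm v ε hε hεr hhit => ?_⟩
  rcases isEmpty_or_nonempty (Fin k) with hk | ⟨⟨j₀⟩⟩
  · exact fun j => hk.elim j
  have hm0 : 0 ≤ m := (norm_nonneg _).trans (hm j₀ _ (Metric.mem_closedBall_self hr₀.le))
  have main : ∀ j, ‖v j‖ ≤ 2 * m / r₀ + ‖v‖ / 2 := by
    intro j
    obtain ⟨w, hw, hw0⟩ := hhit j
    have hwB : w ∈ Metric.closedBall (z j) r₀ := by simpa [dist_eq_norm] using hw.trans hεr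
    have hgw : ‖g w‖ ≤ ε * (2 * m / r₀) := by
      have h1 := sub_smul_dslope g (z j) w
      rw [hg0 j, sub_zero, smul_eq_mul] at h1
      rw [← h1, norm_mul]
      exact mul_le_mul hw (dslope_norm_le hG hg hr₀ ((hsub j).trans (hrG j)) (hm j) (hm j w hwB))
        (norm_nonneg _) hε.le
    have hpw : ‖∑ a, A⁻¹.mulVec v a * φ a w‖ ≤ 2 * m / r₀ := by
      have : (ε : ℂ) * ∑ a, A⁻¹.mulVec v a * φ a w = -g w := by linear_combination hw0
      have := congrArg norm this
      rw [norm_neg, norm_mul, Complex.norm_real, Real.norm_of_nonneg hε.le] at this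
      exact le_of_mul_le_mul_left (this.trans_le hgw) hε
    have hvj : v j = ∑ a, A⁻¹.mulVec v a * φ a (z j) := by
      have : A.mulVec (A⁻¹.mulVec v) = v := by
        rw [Matrix.mulVec_mulVec, Matrix.mul_nonsing_inv _ (isUnit_iff_ne_zero.2 hA),
          Matrix.one_mulVec]
      conv_lhs => rw [← this]
      simp only [Matrix.mulVec, dotProduct, hAdef, Matrix.of_apply]
      exact Finset.sum_congr rfl fun a _ => mul_comm _ _
    have hdiff : ‖∑ a, A⁻¹.mulVec v a * φ a w - v j‖ ≤ ‖v‖ / 2 := by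
      rw [hvj, ← Finset.sum_sub_distrib]
      calc ‖∑ a, (A⁻¹.mulVec v a * φ a w - A⁻¹.mulVec v a * φ a (z j))‖
          ≤ ∑ a, ‖A⁻¹.mulVec v a * φ a w - A⁻¹.mulVec v a * φ a (z j)‖ := norm_sum_le _ _
        _ ≤ ∑ a, (‖T‖ * ‖v‖) * ‖φ a w - φ a (z j)‖ := by
            refine Finset.sum_le_sum fun a _ => ?_
            rw [← mul_sub, norm_mul]
            gcongr
            rw [← hTv]
            exact (norm_le_pi_norm _ a).trans (T.le_opNorm v)
        _ = ‖v‖ * (‖T‖ * ∑ a, ‖φ a w - φ a (z j)‖) := by rw [← Finset.mul_sum]; ring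
        _ ≤ ‖v‖ * (1 / 2) := by
            gcongr
            exact (hrs j w (hsub j hwB)).le
        _ = ‖v‖ / 2 := by ring
    have := norm_le_norm_add_norm_sub (∑ a, A⁻¹.mulVec v a * φ a w) (v j)
    linarith
  have hv : ‖v‖ ≤ 2 * m / r₀ + ‖v‖ / 2 :=
    (pi_norm_le_iff_of_nonneg (by positivity)).2 main
  intro j
  have h1 := norm_le_pi_norm v j
  have h2 : 4 * m / r₀ = 2 * (2 * m / r₀) := by ring
  linarith

theorem volume_polydisk {k : ℕ} (r : Fin k → ℝ) :
    (volume : Measure (Fin k → ℂ)) (Set.univ.pi fun j => Metric.closedBall 0 (r j))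
      = ∏ j, (ENNReal.ofReal (r j) ^ 2 * NNReal.pi) := by
  rw [volume_pi_pi]
  simp only [Complex.volume_closedBall]

/-- The first-order analysis does not decide the borderline case `|v_j| = |g'(z_j)|`; it is
negligible. -/
theorem ae_norm_ne {k : ℕ} (r : Fin k → ℝ) : ∀ᵐ v : Fin k → ℂ, ∀ j, ‖v j‖ ≠ r j := by
  refine ae_all_iff.2 fun j => ?_
  have h : ∀ᵐ w : ℂ, ‖w‖ ≠ r j := by
    have := Measure.addHaar_sphere (volume : Measure ℂ) 0 (r j)
    refine measure_mono_null (fun w hw => ?_) this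
    simpa using hw
  exact (Measure.tendsto_eval_ae_ae (μ := fun _ : Fin k => (volume : Measure ℂ))
    (i := j)).eventually h

theorem gaussian_hit_tendsto {k : ℕ} {G : Set ℂ} (hG : IsOpen G) {z : Fin k → ℂ}
    (hz : ∀ j, z j ∈ G) {φ : Fin k → ℂ → ℂ} (hφ : ∀ a, DifferentiableOn ℂ (φ a) G)
    (hA : (Matrix.of fun j a => φ a (z j)).det ≠ 0) {R : ℂ → ℂ} (hR : DifferentiableOn ℂ R G)
    {xs : Fin k → ℂ} (hxs : ∀ j, ∑ a, xs a * φ a (z j) + R (z j) = 0) :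
    Tendsto (fun ε : ℝ => Measure.pi (fun _ : Fin k => stdComplexGaussian) (hitSet z ε φ R)
        / ENNReal.ofReal ((Real.pi * ε ^ 2) ^ k)) (𝓝[>] 0)
      (𝓝 (ENNReal.ofReal ((‖(Matrix.of fun j a => φ a (z j)).det‖ ^ 2)⁻¹ * Real.pi⁻¹ ^ k
        * Real.exp (-∑ a, ‖xs a‖ ^ 2)
        * ∏ j, ‖deriv (fun w => ∑ a, xs a * φ a w + R w) (z j)‖ ^ 2))) := by
  set A := Matrix.of fun j a => φ a (z j) with hAdef
  set g : ℂ → ℂ := fun w => ∑ a, xs a * φ a w + R w with hgdef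
  have hg : DifferentiableOn ℂ g G :=
    (DifferentiableOn.fun_sum fun a _ => (hφ a).const_mul (xs a)).add hR
  obtain ⟨r, hr, hrG, hbound⟩ := exists_norm_le_of_hit hG hz hφ hA
  obtain ⟨m, hm⟩ : ∃ m, ∀ j, ∀ w ∈ Metric.closedBall (z j) r, ‖g w‖ ≤ m := by
    have : IsCompact (⋃ j, Metric.closedBall (z j) r) :=
      isCompact_iUnion fun j => isCompact_closedBall _ _
    obtain ⟨m, hm⟩ := this.exists_bound_of_continuousOn
      (hg.continuousOn.mono (Set.iUnion_subset hrG))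
    exact ⟨m, fun j w hw => hm w (Set.mem_iUnion.2 ⟨j, hw⟩)⟩
  set d : Fin k → ℝ := fun j => ‖deriv g (z j)‖ with hd
  set D : Set (Fin k → ℂ) := Set.univ.pi fun j => Metric.closedBall 0 (d j) with hDdef
  set D' : Set (Fin k → ℂ) := Set.univ.pi fun j => Metric.closedBall 0 (4 * m / r) with hD'def
  have hD : MeasurableSet D := MeasurableSet.univ_pi fun j => measurableSet_closedBall
  have hD' : MeasurableSet D' := MeasurableSet.univ_pi fun j => measurableSet_closedBall
  have hp : ∀ v : Fin k → ℂ, DifferentiableOn ℂ (fun w => ∑ a, A⁻¹.mulVec v a * φ a w) G :=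
    fun v => DifferentiableOn.fun_sum fun a _ => (hφ a).const_mul _
  have hpz : ∀ (v : Fin k → ℂ) j, ∑ a, A⁻¹.mulVec v a * φ a (z j) = v j := by
    intro v j
    have : A.mulVec (A⁻¹.mulVec v) = v := by
      rw [Matrix.mulVec_mulVec, Matrix.mul_nonsing_inv _ (isUnit_iff_ne_zero.2 hA),
        Matrix.one_mulVec]
    conv_rhs => rw [← this]
    simp only [Matrix.mulVec, dotProduct, hAdef, Matrix.of_apply]
    exact Finset.sum_congr rfl fun a _ => mul_comm _ _
  have hlim : Tendsto (fun ε : ℝ => ∫⁻ v, (hitSet z ε φ R).indicator gaussianWeight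
      (xs + ((ε : ℂ) • A⁻¹).mulVec v)) (𝓝[>] 0)
      (𝓝 (∫⁻ v, D.indicator (fun _ => gaussianWeight xs) v)) := by
    -- By `exists_norm_le_of_hit` the rescaled hitting sets lie in one polydisk `D'` of finite
    -- volume; their limit is `D`.
    refine tendsto_lintegral_filter_of_dominated_convergence (D'.indicator 1) ?_ ?_ ?_ ?_
    · filter_upwards [eventually_forall_closedBall_subset hG hz] with ε ⟨hε, hεG⟩
      exact (continuous_gaussianWeight.measurable.indicator
        (measurableSet_hitSet hφ hR hε.le hεG)).comp
          (by fun_prop : Continuous fun v => xs + ((ε : ℂ) • A⁻¹).mulVec v).measurable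
    · filter_upwards [self_mem_nhdsWithin, mem_nhdsWithin_of_mem_nhds (Iic_mem_nhds hr)]
        with ε hε hεr
      refine Eventually.of_forall fun v => ?_
      by_cases hv : xs + ((ε : ℂ) • A⁻¹).mulVec v ∈ hitSet z ε φ R
      · rw [Set.indicator_of_mem hv]
        have := hbound g m hg hxs hm v ε hε hεr ((mem_hitSet_affine xs v A⁻¹).1 hv)
        rw [Set.indicator_of_mem (by simpa [hD'def] using this)]
        exact gaussianWeight_le_one _
      · rw [Set.indicator_of_notMem hv]
        exact zero_le
    · rw [lintegral_indicator_one hD', hD'def, volume_polydisk]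
      exact ENNReal.prod_ne_top fun j _ => by finiteness
    · filter_upwards [ae_norm_ne d] with v hv
      by_cases hlt : ∀ j, ‖v j‖ < d j
      · have hvD : v ∈ D := by simpa [hDdef] using fun j => (hlt j).le
        rw [Set.indicator_of_mem hvD]
        have h1 : ∀ᶠ ε : ℝ in 𝓝[>] 0, xs + ((ε : ℂ) • A⁻¹).mulVec v ∈ hitSet z ε φ R := by
          simp only [mem_hitSet_affine]
          refine eventually_all.2 fun j => ?_
          exact eventually_exists_zero hG hg (hp v) (hz j) (hxs j) (by
            rw [hpz]; exact hlt j)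
        have h2 : Tendsto (fun ε : ℝ => gaussianWeight (xs + ((ε : ℂ) • A⁻¹).mulVec v)) (𝓝[>] 0)
            (𝓝 (gaussianWeight xs)) := by
          have hc : Continuous fun ε : ℝ => gaussianWeight (xs + ((ε : ℂ) • A⁻¹).mulVec v) :=
            continuous_gaussianWeight.comp (by fun_prop)
          have := hc.tendsto 0
          simp only [Complex.ofReal_zero, zero_smul, Matrix.zero_mulVec, add_zero] at this
          exact this.mono_left nhdsWithin_le_nhds
        refine h2.congr' ?_
        filter_upwards [h1] with ε hε
        rw [Set.indicator_of_mem hε]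
      · push Not at hlt
        obtain ⟨j, hj⟩ := hlt
        have hj : d j < ‖v j‖ := lt_of_le_of_ne hj (hv j).symm
        have hvD : v ∉ D := by
          intro h
          have : ∀ j, ‖v j‖ ≤ d j := by simpa [hDdef] using h
          linarith [this j]
        rw [Set.indicator_of_notMem hvD]
        refine tendsto_const_nhds.congr' ?_
        filter_upwards [eventually_not_exists_zero hG hg (hp v) (hz j) (hxs j)
          (by rw [hpz]; exact hj)] with ε hε
        rw [Set.indicator_of_notMem]
        rw [mem_hitSet_affine]
        exact fun h => hε (h j)
  have hval : ENNReal.ofReal ((‖A.det‖ ^ 2)⁻¹ * Real.pi⁻¹ ^ k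
        * Real.exp (-∑ a, ‖xs a‖ ^ 2) * ∏ j, ‖deriv g (z j)‖ ^ 2)
      = ENNReal.ofReal ((‖A.det‖ ^ 2)⁻¹ * Real.pi⁻¹ ^ k)
        * ∫⁻ v, D.indicator (fun _ => gaussianWeight xs) v := by
    rw [lintegral_indicator_const hD, hDdef, volume_polydisk, gaussianWeight_eq]
    have : ∏ j, (ENNReal.ofReal (d j) ^ 2 * NNReal.pi)
        = ENNReal.ofReal (∏ j, (d j ^ 2 * Real.pi)) := by
      rw [ENNReal.ofReal_prod_of_nonneg fun _ _ => by positivity]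
      refine Finset.prod_congr rfl fun j _ => ?_
      rw [ENNReal.ofReal_mul (by positivity), ENNReal.ofReal_pow (norm_nonneg _),
        ← NNReal.coe_real_pi, ENNReal.ofReal_coe_nnreal]
    rw [this, ← ENNReal.ofReal_mul (by positivity), ← ENNReal.ofReal_mul (by positivity)]
    congr 1
    rw [Finset.prod_mul_distrib, Finset.prod_const, Finset.card_univ, Fintype.card_fin]
    have : Real.pi⁻¹ ^ k * Real.pi ^ k = 1 := by
      rw [← mul_pow, inv_mul_cancel₀ Real.pi_ne_zero, one_pow]
    linear_combination (-(‖A.det‖ ^ 2)⁻¹ * Real.pi⁻¹ ^ k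
        * Real.exp (-∑ a, ‖xs a‖ ^ 2) * ∏ j, ‖deriv g (z j)‖ ^ 2) * this
  rw [hval]
  refine (ENNReal.Tendsto.const_mul hlim (Or.inr ENNReal.ofReal_ne_top)).congr' ?_
  filter_upwards [eventually_forall_closedBall_subset hG hz] with ε ⟨hε, hεG⟩
  exact (gaussian_measure_div (measurableSet_hitSet hφ hR hε.le hεG) hA xs hε).symm

/-- Both `x* = -A⁻¹ R(z)` and `g` are bounded by multiples of `m`, so the rescaled hitting set lies
in a polydisk of radius proportional to `m`, with volume of order `m²ᵏ`. The range of `ε` is fixed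
before `R`, as domination over a random `R` requires. -/
theorem gaussian_hit_le {k : ℕ} {G : Set ℂ} (hG : IsOpen G) {z : Fin k → ℂ}
    (hz : ∀ j, z j ∈ G) {φ : Fin k → ℂ → ℂ} (hφ : ∀ a, DifferentiableOn ℂ (φ a) G)
    (hA : (Matrix.of fun j a => φ a (z j)).det ≠ 0) :
    ∃ K, IsCompact K ∧ K ⊆ G ∧ ∃ C : ℝ, 0 ≤ C ∧ ∀ᶠ ε : ℝ in 𝓝[>] 0, ∀ (R : ℂ → ℂ) (m : ℝ),
      DifferentiableOn ℂ R G → 0 ≤ m → (∀ w ∈ K, ‖R w‖ ≤ m) →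
        Measure.pi (fun _ : Fin k => stdComplexGaussian) (hitSet z ε φ R)
          / ENNReal.ofReal ((Real.pi * ε ^ 2) ^ k) ≤ ENNReal.ofReal (C * m ^ (2 * k)) := by
  obtain ⟨r, hr, hrG, hbound⟩ := exists_norm_le_of_hit hG hz hφ hA
  set A := Matrix.of fun j a => φ a (z j) with hAdef
  set T := (Matrix.toLin' A⁻¹).toContinuousLinearMap
  have hTv : ∀ v, T v = A⁻¹.mulVec v := fun v => rfl
  set K := ⋃ j, Metric.closedBall (z j) r with hK
  have hKc : IsCompact K := isCompact_iUnion fun j => isCompact_closedBall _ _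
  have hKG : K ⊆ G := Set.iUnion_subset hrG
  have hM : ∃ M : ℝ, ∀ a, ∀ w ∈ K, ‖φ a w‖ ≤ M := by
    have := fun a => hKc.exists_bound_of_continuousOn ((hφ a).continuousOn.mono hKG)
    choose M hM using this
    exact ⟨∑ a, |M a|, fun a w hw => (hM a w hw).trans ((le_abs_self _).trans
      (Finset.single_le_sum (f := fun a => |M a|) (fun _ _ => abs_nonneg _) (Finset.mem_univ a)))⟩
  obtain ⟨M, hM⟩ := hM
  set c₁ : ℝ := 1 + k * (‖T‖ * |M|) with hc₁
  have hc₁0 : 0 ≤ c₁ := by positivity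
  refine ⟨K, hKc, hKG, (‖A.det‖ ^ 2)⁻¹ * (4 * c₁ / r) ^ (2 * k), by positivity, ?_⟩
  filter_upwards [self_mem_nhdsWithin, mem_nhdsWithin_of_mem_nhds (Iic_mem_nhds hr)] with
    ε hε hεr R m hR hm0 hm
  have hε : 0 < ε := hε
  set xs : Fin k → ℂ := T (fun j => -R (z j)) with hxs
  have hxsn : ∀ a, ‖xs a‖ ≤ ‖T‖ * m := fun a => by
    refine (norm_le_pi_norm xs a).trans ((T.le_opNorm _).trans ?_)
    gcongr
    refine (pi_norm_le_iff_of_nonneg hm0).2 fun j => ?_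
    rw [norm_neg]
    exact hm _ (Set.mem_iUnion.2 ⟨j, Metric.mem_closedBall_self hr.le⟩)
  set g : ℂ → ℂ := fun w => ∑ a, xs a * φ a w + R w with hgdef
  have hg : DifferentiableOn ℂ g G :=
    (DifferentiableOn.fun_sum fun a _ => (hφ a).const_mul (xs a)).add hR
  have hg0 : ∀ j, g (z j) = 0 := by
    intro j
    have : A.mulVec xs = fun j => -R (z j) := by
      rw [hxs, hTv, Matrix.mulVec_mulVec, Matrix.mul_nonsing_inv _ (isUnit_iff_ne_zero.2 hA),
        Matrix.one_mulVec]
    have := congrFun this j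
    simp only [Matrix.mulVec, dotProduct, hAdef, Matrix.of_apply] at this
    simp only [hgdef]
    rw [show ∑ a, xs a * φ a (z j) = ∑ a, φ a (z j) * xs a from
      Finset.sum_congr rfl fun a _ => mul_comm _ _, this]
    ring
  have hgm : ∀ j, ∀ w ∈ Metric.closedBall (z j) r, ‖g w‖ ≤ c₁ * m := by
    intro j w hw
    have hwK : w ∈ K := Set.mem_iUnion.2 ⟨j, hw⟩
    calc ‖g w‖ ≤ ‖∑ a, xs a * φ a w‖ + ‖R w‖ := norm_add_le _ _
      _ ≤ ∑ a : Fin k, (‖T‖ * m) * |M| + m := by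
          refine add_le_add ((norm_sum_le _ _).trans (Finset.sum_le_sum fun a _ => ?_)) (hm w hwK)
          rw [norm_mul]
          exact mul_le_mul (hxsn a) ((hM a w hwK).trans (le_abs_self M)) (norm_nonneg _)
            (by positivity)
      _ = c₁ * m := by simp [hc₁]; ring
  set D' : Set (Fin k → ℂ) := Set.univ.pi fun j => Metric.closedBall 0 (4 * (c₁ * m) / r) with hD'def
  have hD' : MeasurableSet D' := MeasurableSet.univ_pi fun j => measurableSet_closedBall
  rw [gaussian_measure_div (measurableSet_hitSet hφ hR hε.le fun j =>
    (Metric.closedBall_subset_closedBall hεr).trans (hrG j)) hA xs hε]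
  have hint : ∫⁻ v, (hitSet z ε φ R).indicator gaussianWeight (xs + ((ε : ℂ) • A⁻¹).mulVec v)
      ≤ ∫⁻ v, D'.indicator 1 v := by
    refine lintegral_mono fun v => ?_
    by_cases hv : xs + ((ε : ℂ) • A⁻¹).mulVec v ∈ hitSet z ε φ R
    · rw [Set.indicator_of_mem hv]
      have := hbound g _ hg hg0 hgm v ε hε hεr ((mem_hitSet_affine xs v A⁻¹).1 hv)
      rw [Set.indicator_of_mem (by simpa [hD'def] using this)]
      exact gaussianWeight_le_one _
    · rw [Set.indicator_of_notMem hv]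
      exact zero_le
  refine (mul_le_mul_right hint _).trans_eq ?_
  rw [lintegral_indicator_one hD', hD'def, volume_polydisk, Finset.prod_const, Finset.card_univ,
    Fintype.card_fin, ← ENNReal.ofReal_coe_nnreal, NNReal.coe_real_pi,
    ← ENNReal.ofReal_pow (by positivity), ← ENNReal.ofReal_mul (by positivity),
    ← ENNReal.ofReal_pow (by positivity), ← ENNReal.ofReal_mul (by positivity)]
  congr 1
  have : Real.pi⁻¹ ^ k * Real.pi ^ k = 1 := by
    rw [← mul_pow, inv_mul_cancel₀ Real.pi_ne_zero, one_pow]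
  rw [mul_pow _ Real.pi, ← pow_mul,
    show 4 * (c₁ * m) / r = (4 * c₁ / r) * m by ring, mul_pow (4 * c₁ / r) m]
  linear_combination ((‖A.det‖ ^ 2)⁻¹ * (4 * c₁ / r) ^ (2 * k) * m ^ (2 * k)) * this

/-! ### Moments of finite Gaussian sums. -/

/-- Completing the square and translating by `conj c / 2`. The total mass enters as `h1`, which the
law of any `ζ n` supplies, so no Gaussian integral is computed. -/
theorem lintegral_exp_re_stdComplexGaussian (h1 : stdComplexGaussian Set.univ = 1) (c : ℂ) :
    ∫⁻ z, ENNReal.ofReal (Real.exp (c * z).re) ∂stdComplexGaussian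
      = ENNReal.ofReal (Real.exp (‖c‖ ^ 2 / 4)) := by
  have hdens : Measurable fun z : ℂ => ENNReal.ofReal (Real.pi⁻¹ * Real.exp (-‖z‖ ^ 2)) := by
    fun_prop
  have key : ∀ z : ℂ, -‖z‖ ^ 2 + (c * z).re
      = -‖z - (starRingEnd ℂ) c / 2‖ ^ 2 + ‖c‖ ^ 2 / 4 := by
    intro z
    rw [← Complex.normSq_eq_norm_sq, ← Complex.normSq_eq_norm_sq, ← Complex.normSq_eq_norm_sq]
    simp [Complex.normSq_apply]
    ring
  rw [stdComplexGaussian, lintegral_withDensity_eq_lintegral_mul _ hdens (by fun_prop)]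
  rw [stdComplexGaussian, withDensity_apply _ MeasurableSet.univ, Measure.restrict_univ] at h1
  calc _ = ∫⁻ z : ℂ, ENNReal.ofReal (Real.exp (‖c‖ ^ 2 / 4)) *
        ENNReal.ofReal (Real.pi⁻¹ * Real.exp (-‖z - (starRingEnd ℂ) c / 2‖ ^ 2)) := by
        refine lintegral_congr fun z => ?_
        rw [Pi.mul_apply, ← ENNReal.ofReal_mul (by positivity),
          ← ENNReal.ofReal_mul (by positivity), mul_assoc, ← Real.exp_add, key z, Real.exp_add]
        congr 1
        ring
    _ = _ := by
        rw [lintegral_const_mul _ (by fun_prop),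
          lintegral_sub_right_eq_self
            (fun z : ℂ => ENNReal.ofReal (Real.pi⁻¹ * Real.exp (-‖z‖ ^ 2))), h1, mul_one]

/-- Constant in the moment bound for complex Gaussian variables. -/
noncomputable def gaussianMomentConst (p : ℕ) : ENNReal :=
  ENNReal.ofReal ((2 * p).factorial * 4 * Real.exp (1 / 2))

section Moments

variable {Ω : Type*} [MeasurableSpace Ω] {μ : Measure Ω} [IsProbabilityMeasure μ]
  {ζ : ℕ → Ω → ℂ}

theorem stdComplexGaussian_univ {X : Ω → ℂ} (hX : Measurable X)
    (hl : μ.map X = stdComplexGaussian) : stdComplexGaussian Set.univ = 1 := by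
  rw [← hl, Measure.map_apply hX MeasurableSet.univ, Set.preimage_univ, measure_univ]

theorem lintegral_exp_re_sum (hm : ∀ n, Measurable (ζ n))
    (hl : ∀ n, μ.map (ζ n) = stdComplexGaussian) (hi : iIndepFun ζ μ) (s : Finset ℕ) (c : ℕ → ℂ) :
    ∫⁻ ω, ENNReal.ofReal (Real.exp (∑ n ∈ s, c n * ζ n ω).re) ∂μ
      = ENNReal.ofReal (Real.exp ((∑ n ∈ s, ‖c n‖ ^ 2) / 4)) := by
  have h1 := stdComplexGaussian_univ (hm 0) (hl 0)
  have hX : ∀ n, Measurable fun z : ℂ => ENNReal.ofReal (Real.exp (c n * z).re) := fun n => by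
    fun_prop
  have hind := hi.comp (fun n z => ENNReal.ofReal (Real.exp (c n * z).re)) hX
  calc _ = ∫⁻ ω, ∏ n ∈ s, ENNReal.ofReal (Real.exp (c n * ζ n ω).re) ∂μ := by
        refine lintegral_congr fun ω => ?_
        rw [← ENNReal.ofReal_prod_of_nonneg fun _ _ => (Real.exp_pos _).le, ← Real.exp_sum,
          Complex.re_sum]
    _ = ∏ n ∈ s, ∫⁻ ω, ENNReal.ofReal (Real.exp (c n * ζ n ω).re) ∂μ :=
        lintegral_prod_eq_prod_lintegral_of_indepFun s
          (fun n ω => ENNReal.ofReal (Real.exp (c n * ζ n ω).re)) hind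
          fun n => (hX n).comp (hm n)
    _ = ∏ n ∈ s, ENNReal.ofReal (Real.exp (‖c n‖ ^ 2 / 4)) := by
        refine Finset.prod_congr rfl fun n _ => ?_
        rw [← lintegral_exp_re_stdComplexGaussian h1, ← hl n, lintegral_map (hX n) (hm n)]
    _ = _ := by
        rw [← ENNReal.ofReal_prod_of_nonneg fun _ _ => (Real.exp_pos _).le, ← Real.exp_sum,
          Finset.sum_div]

/-- From `|x|ᵖ ≤ p! exp |x|` and `|x| ≤ |Re x| + |Im x|`; the four exponentials cover the sign
choices. Moments are thereby reduced to `lintegral_exp_re_sum`. -/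
theorem norm_pow_le_exp_sum (x : ℂ) (p : ℕ) :
    ‖x‖ ^ p ≤ p.factorial * (Real.exp ((1 - Complex.I) * x).re + Real.exp ((1 + Complex.I) * x).re
      + Real.exp ((-1 - Complex.I) * x).re + Real.exp ((-1 + Complex.I) * x).re) := by
  have h1 := Real.pow_div_factorial_le_exp ‖x‖ (norm_nonneg x) p
  rw [div_le_iff₀ (by positivity), mul_comm] at h1
  refine h1.trans ?_
  gcongr
  have h2 := Complex.norm_le_abs_re_add_abs_im x
  have e1 : ((1 - Complex.I) * x).re = x.re + x.im := by simp
  have e2 : ((1 + Complex.I) * x).re = x.re - x.im := by simp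
  have e3 : ((-1 - Complex.I) * x).re = -x.re + x.im := by simp
  have e4 : ((-1 + Complex.I) * x).re = -x.re - x.im := by simp
  rw [e1, e2, e3, e4]
  have p1 := Real.exp_pos (x.re + x.im)
  have p2 := Real.exp_pos (x.re - x.im)
  have p3 := Real.exp_pos (-x.re + x.im)
  have p4 := Real.exp_pos (-x.re - x.im)
  refine (Real.exp_le_exp.2 h2).trans ?_
  rcases abs_cases x.re with ⟨ha, -⟩ | ⟨ha, -⟩ <;> rcases abs_cases x.im with ⟨hb, -⟩ | ⟨hb, -⟩ <;>
    rw [ha, hb] <;> try simp only [← sub_eq_add_neg]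
  all_goals linarith

theorem lintegral_moment_le_of_sum_eq_one (hm : ∀ n, Measurable (ζ n))
    (hl : ∀ n, μ.map (ζ n) = stdComplexGaussian) (hi : iIndepFun ζ μ) (s : Finset ℕ) (c : ℕ → ℂ)
    (hc : ∑ n ∈ s, ‖c n‖ ^ 2 = 1) (p : ℕ) :
    ∫⁻ ω, ‖∑ n ∈ s, ζ n ω * c n‖ₑ ^ (2 * p) ∂μ ≤ gaussianMomentConst p := by
  -- The four multipliers `±1 ± i` have squared modulus `2`, whence the exponent `2/4`.
  have hb : ∀ t : ℂ, ‖t‖ ^ 2 = 2 →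
      ∫⁻ ω, ENNReal.ofReal (Real.exp (t * ∑ n ∈ s, ζ n ω * c n).re) ∂μ
        = ENNReal.ofReal (Real.exp (1 / 2)) := by
    intro t ht
    have := lintegral_exp_re_sum (μ := μ) hm hl hi s (fun n => t * c n)
    simp only [norm_mul, mul_pow, ← Finset.mul_sum, hc, ht, mul_one] at this
    rw [show (1 : ℝ) / 2 = 2 / 4 by norm_num, ← this]
    refine lintegral_congr fun ω => ?_
    congr 3
    rw [Finset.mul_sum]
    exact Finset.sum_congr rfl fun n _ => by ring
  have hS : Measurable fun ω => ∑ n ∈ s, ζ n ω * c n :=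
    Finset.measurable_fun_sum _ fun n _ => (hm n).mul_const _
  have hmeas : ∀ t : ℂ, Measurable fun ω =>
      ENNReal.ofReal (Real.exp (t * ∑ n ∈ s, ζ n ω * c n).re) := fun t => by fun_prop
  have ht : ∀ t : ℂ, t = 1 - Complex.I ∨ t = 1 + Complex.I ∨ t = -1 - Complex.I ∨
      t = -1 + Complex.I → ‖t‖ ^ 2 = 2 := by
    rintro t (rfl | rfl | rfl | rfl) <;> rw [← Complex.normSq_eq_norm_sq] <;>
      norm_num [Complex.normSq_apply]
  calc _ ≤ ∫⁻ ω, ENNReal.ofReal (2 * p).factorial *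
        (ENNReal.ofReal (Real.exp ((1 - Complex.I) * ∑ n ∈ s, ζ n ω * c n).re)
        + ENNReal.ofReal (Real.exp ((1 + Complex.I) * ∑ n ∈ s, ζ n ω * c n).re)
        + ENNReal.ofReal (Real.exp ((-1 - Complex.I) * ∑ n ∈ s, ζ n ω * c n).re)
        + ENNReal.ofReal (Real.exp ((-1 + Complex.I) * ∑ n ∈ s, ζ n ω * c n).re)) ∂μ := by
        refine lintegral_mono fun ω => ?_
        have := norm_pow_le_exp_sum (∑ n ∈ s, ζ n ω * c n) (2 * p)
        rw [← ofReal_norm, ← ENNReal.ofReal_pow (norm_nonneg _),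
          ← ENNReal.ofReal_add (by positivity) (by positivity),
          ← ENNReal.ofReal_add (by positivity) (by positivity),
          ← ENNReal.ofReal_add (by positivity) (by positivity),
          ← ENNReal.ofReal_mul (by positivity)]
        exact ENNReal.ofReal_le_ofReal this
    _ = gaussianMomentConst p := by
        rw [lintegral_const_mul _ (by fun_prop), lintegral_add_right _ (hmeas _),
          lintegral_add_right _ (hmeas _), lintegral_add_right _ (hmeas _),
          hb _ (ht _ (by simp)), hb _ (ht _ (by simp)), hb _ (ht _ (by simp)), hb _ (ht _ (by simp)),
          gaussianMomentConst, ← ENNReal.ofReal_add (by positivity) (by positivity),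
          ← ENNReal.ofReal_add (by positivity) (by positivity),
          ← ENNReal.ofReal_add (by positivity) (by positivity),
          ← ENNReal.ofReal_mul (by positivity)]
        congr 1
        ring

/-- Rescaling to unit variance. Zero variance is separate, and its case `p = 0` needs the constant
to be at least `1`. -/
theorem lintegral_moment_le (hm : ∀ n, Measurable (ζ n))
    (hl : ∀ n, μ.map (ζ n) = stdComplexGaussian) (hi : iIndepFun ζ μ) (s : Finset ℕ) (c : ℕ → ℂ)
    (p : ℕ) :
    ∫⁻ ω, ‖∑ n ∈ s, ζ n ω * c n‖ₑ ^ (2 * p) ∂μ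
      ≤ gaussianMomentConst p * (∑ n ∈ s, ‖c n‖ₑ ^ 2) ^ p := by
  rcases (Finset.sum_nonneg fun n (_ : n ∈ s) => sq_nonneg ‖c n‖).eq_or_lt with h0 | h0
  · have hz : ∀ n ∈ s, c n = 0 := by
      intro n hn
      have := (Finset.sum_eq_zero_iff_of_nonneg fun n _ => sq_nonneg ‖c n‖).1 h0.symm n hn
      simpa using this
    have h1 : ∀ ω, ∑ n ∈ s, ζ n ω * c n = 0 := fun ω =>
      Finset.sum_eq_zero fun n hn => by rw [hz n hn, mul_zero]
    have h2 : ∑ n ∈ s, ‖c n‖ₑ ^ 2 = 0 := Finset.sum_eq_zero fun n hn => by simp [hz n hn]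
    have hC : 1 ≤ gaussianMomentConst p := by
      rw [gaussianMomentConst, ENNReal.one_le_ofReal]
      have h1 : (1 : ℝ) ≤ (2 * p).factorial := by exact_mod_cast Nat.one_le_iff_ne_zero.2 (by positivity)
      have h2 := Real.one_le_exp (x := 1 / 2) (by norm_num)
      nlinarith
    simp only [h1, h2, enorm_zero]
    rcases p with _ | p
    · simpa using hC
    · simp
  · set σ := Real.sqrt (∑ n ∈ s, ‖c n‖ ^ 2) with hσ
    have hσ0 : 0 < σ := Real.sqrt_pos.2 h0
    have hσ2 : σ ^ 2 = ∑ n ∈ s, ‖c n‖ ^ 2 := Real.sq_sqrt h0.le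
    have hσc : (σ : ℂ) ≠ 0 := by exact_mod_cast hσ0.ne'
    have := lintegral_moment_le_of_sum_eq_one (μ := μ) hm hl hi s (fun n => c n / σ) (by
      simp only [norm_div, Complex.norm_real, Real.norm_of_nonneg hσ0.le, div_pow,
        ← Finset.sum_div, ← hσ2]
      exact div_self (by positivity)) p
    have e : ∀ ω, ∑ n ∈ s, ζ n ω * c n = σ * ∑ n ∈ s, ζ n ω * (c n / σ) := fun ω => by
      rw [Finset.mul_sum]
      exact Finset.sum_congr rfl fun n _ => by field_simp
    have e2 : (∑ n ∈ s, ‖c n‖ₑ ^ 2) = ‖(σ : ℂ)‖ₑ ^ 2 := by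
      rw [← ofReal_norm, Complex.norm_real, Real.norm_of_nonneg hσ0.le,
        ← ENNReal.ofReal_pow hσ0.le, hσ2, ENNReal.ofReal_sum_of_nonneg fun _ _ => sq_nonneg _]
      refine Finset.sum_congr rfl fun n _ => ?_
      rw [← ofReal_norm, ENNReal.ofReal_pow (norm_nonneg _)]
    have hS : Measurable fun ω => ∑ n ∈ s, ζ n ω * (c n / σ) :=
      Finset.measurable_fun_sum _ fun n _ => (hm n).mul_const _
    simp only [e, enorm_mul, mul_pow]
    rw [lintegral_const_mul _ (by fun_prop), e2, ← pow_mul, mul_comm]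
    gcongr

end Moments

/-! ### Suprema of Gaussian series and analyticity of the sum. -/

/-- A mean value inequality for powers of analytic functions. -/
theorem enorm_pow_le_lintegral_circle {G : Set ℂ} {h : ℂ → ℂ} (hh : DifferentiableOn ℂ h G)
    {c a : ℂ} {r : ℝ} (hr : 0 < r) (hG : Metric.closedBall c (2 * r) ⊆ G)
    (ha : a ∈ Metric.closedBall c r) (q : ℕ) :
    ‖h a‖ₑ ^ q ≤ ∫⁻ θ in Set.Ioc 0 (2 * Real.pi), ‖h (circleMap c (2 * r) θ)‖ₑ ^ q := by
  have hr2 : (0 : ℝ) < 2 * r := by positivity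
  have hd : DiffContOnCl ℂ (fun w => h w ^ q) (Metric.ball c (2 * r)) :=
    ((hh.pow q).mono ((closure_ball c hr2.ne').trans_subset hG)).diffContOnCl
  have hab : a ∈ Metric.ball c (2 * r) :=
    Metric.closedBall_subset_ball (by linarith) ha
  have h1 := hd.two_pi_i_inv_smul_circleIntegral_sub_inv_smul hab
  rw [← enorm_pow, ← h1, circleIntegral, intervalIntegral.integral_of_le (by positivity),
    enorm_smul]
  -- The Cauchy kernel times the speed is at most `2r / r = 2`; with the prefactor `1/(2π)` the
  -- total constant stays below `1`.
  have h2 : ∀ θ : ℝ, ‖deriv (circleMap c (2 * r)) θ •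
      (circleMap c (2 * r) θ - a)⁻¹ • h (circleMap c (2 * r) θ) ^ q‖ₑ
      ≤ 2 * ‖h (circleMap c (2 * r) θ)‖ₑ ^ q := by
    intro θ
    rw [enorm_smul, enorm_smul, ← mul_assoc, enorm_pow]
    gcongr
    rw [← enorm_mul, ← ofReal_norm, ← ENNReal.ofReal_ofNat]
    refine ENNReal.ofReal_le_ofReal ?_
    have hdist : r ≤ ‖circleMap c (2 * r) θ - a‖ := by
      have h3 : ‖circleMap c (2 * r) θ - c‖ = 2 * r := by
        simp [circleMap, abs_of_pos hr]
      have h4 : ‖a - c‖ ≤ r := by simpa [dist_eq_norm] using ha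
      have h5 := norm_sub_norm_le (circleMap c (2 * r) θ - c) (a - c)
      rw [sub_sub_sub_cancel_right] at h5
      linarith
    rw [deriv_circleMap, norm_mul, norm_mul, norm_inv, Complex.norm_I, mul_one,
      norm_circleMap_zero, abs_of_pos hr2, ← div_eq_mul_inv, div_le_iff₀ (by linarith)]
    linarith
  refine (mul_le_mul_right ((enorm_integral_le_lintegral_enorm _).trans (lintegral_mono h2)) _).trans ?_
  rw [lintegral_const_mul' _ _ (by simp), ← mul_assoc]
  refine mul_le_of_le_one_left zero_le ?_
  rw [← ofReal_norm, ← ENNReal.ofReal_ofNat, ← ENNReal.ofReal_mul (norm_nonneg _),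
    ENNReal.ofReal_le_one, norm_inv, norm_mul, norm_mul, Complex.norm_I, Complex.norm_real,
    Real.norm_of_nonneg Real.pi_pos.le, mul_one, Complex.norm_ofNat, inv_mul_le_iff₀ (by positivity)]
  linarith [Real.pi_gt_three]

section Series

/-- The data of a Gaussian analytic function, with a locally bounded covariance. -/
structure GaussianSeries {Ω : Type*} [MeasurableSpace Ω] (μ : Measure Ω) (G : Set ℂ)
    (ζ : ℕ → Ω → ℂ) (f : ℕ → ℂ → ℂ) (F : Ω → ℂ → ℂ) : Prop where
  measurable : ∀ n, Measurable (ζ n)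
  law : ∀ n, μ.map (ζ n) = stdComplexGaussian
  indep : iIndepFun ζ μ
  diff : ∀ n, DifferentiableOn ℂ (f n) G
  bdd : ∀ K, IsCompact K → K ⊆ G → ∃ C : NNReal, ∀ w ∈ K, ∑' n, ‖f n w‖ₑ ^ 2 ≤ C
  tendsto : ∀ᵐ ω ∂μ, ∀ z ∈ G,
    Tendsto (fun N => ∑ n ∈ Finset.range N, ζ n ω * f n z) atTop (𝓝 (F ω z))

variable {Ω : Type*} [MeasurableSpace Ω] {μ : Measure Ω} {G : Set ℂ}
  {ζ : ℕ → Ω → ℂ} {f : ℕ → ℂ → ℂ} {F : Ω → ℂ → ℂ}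

/-- The variance `∑ |fₙ|²` is a locally uniform limit of continuous functions, hence continuous and
bounded on compact sets. -/
theorem IsGaussianAnalyticFunction.exists_gaussianSeries (h : IsGaussianAnalyticFunction μ G F) :
    ∃ ζ f, GaussianSeries μ G ζ f F := by
  obtain ⟨ζ, f, hm, hl, hi, hd, hs, ht⟩ := h
  refine ⟨ζ, f, hm, hl, hi, hd, fun K hK hKG => ?_, ht⟩
  have h1 := hs.hasSumLocallyUniformlyOn
  have h2 := hasSumLocallyUniformlyOn_iff_tendstoLocallyUniformlyOn.1 h1
  have hc : ContinuousOn (fun z => ∑' n, ‖f n z‖ ^ 2) G := h2.continuousOn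
    (Frequently.of_forall fun s => continuousOn_finsetSum _ fun n _ => (hd n).continuousOn.norm.pow 2)
  obtain ⟨C, hC⟩ := hK.exists_bound_of_continuousOn (hc.mono hKG)
  refine ⟨C.toNNReal, fun w hw => ?_⟩
  have hsum : Summable fun n => ‖f n w‖ ^ 2 := (h1.hasSum (hKG hw)).summable
  have e : ∑' n, ‖f n w‖ₑ ^ 2 = ENNReal.ofReal (∑' n, ‖f n w‖ ^ 2) := by
    rw [ENNReal.ofReal_tsum_of_nonneg (fun n => sq_nonneg _) hsum]
    refine tsum_congr fun n => ?_
    rw [← ofReal_norm, ENNReal.ofReal_pow (norm_nonneg _)]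
  rw [e]
  exact ENNReal.ofReal_le_ofReal ((le_abs_self _).trans (hC w hw))

namespace GaussianSeries

/-- Replacing removed terms by zero, without reindexing, makes every result on Gaussian series
available for remainders and tails. -/
theorem remove (h : GaussianSeries μ G ζ f F) (s : Finset ℕ) :
    GaussianSeries μ G ζ (fun n w => if n ∈ s then 0 else f n w)
      (fun ω w => F ω w - ∑ n ∈ s, ζ n ω * f n w) where
  measurable := h.measurable
  law := h.law
  indep := h.indep
  diff n := by
    by_cases hn : n ∈ s
    · simp only [hn, if_true]; exact differentiableOn_const 0
    · simp only [hn, if_false]; exact h.diff n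
  bdd K hK hKG := by
    obtain ⟨C, hC⟩ := h.bdd K hK hKG
    refine ⟨C, fun w hw => (ENNReal.tsum_le_tsum fun n => ?_).trans (hC w hw)⟩
    split_ifs <;> simp
  tendsto := by
    filter_upwards [h.tendsto] with ω hω z hz
    refine ((hω z hz).sub_const (∑ n ∈ s, ζ n ω * f n z)).congr' ?_
    filter_upwards [eventually_ge_atTop (s.sup id + 1)] with N hN
    have hs : s ⊆ Finset.range N := fun n hn => Finset.mem_range.2
      (lt_of_lt_of_le (Nat.lt_succ_of_le (Finset.le_sup (f := id) hn)) hN)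
    rw [← Finset.sum_sdiff hs, add_sub_cancel_right, ← Finset.sum_sdiff hs]
    rw [Finset.sum_eq_zero (s := s) (fun n hn => by simp [hn]), add_zero]
    exact Finset.sum_congr rfl fun n hn => by simp [(Finset.mem_sdiff.1 hn).2]

/-- The supremum of `F` need not be measurable, so a measurable majorant is used: the lower limit of
circle integrals of the partial sums, whose mean is controlled by Fatou's lemma and the moment
bound. -/
theorem exists_disk_bound [IsProbabilityMeasure μ] (h : GaussianSeries μ G ζ f F) (p : ℕ) {c : ℂ}
    {r : ℝ} (hr : 0 < r) (hG : Metric.closedBall c (2 * r) ⊆ G) :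
    ∃ M : Ω → ENNReal, Measurable M ∧
      (∀ᵐ ω ∂μ, ∀ w ∈ Metric.closedBall c r, ‖F ω w‖ₑ ^ (2 * p) ≤ M ω) ∧
      ∫⁻ ω, M ω ∂μ ≤ ∫⁻ θ in Set.Ioc 0 (2 * Real.pi),
        gaussianMomentConst p * (∑' n, ‖f n (circleMap c (2 * r) θ)‖ₑ ^ 2) ^ p := by
  have hcirc : ∀ θ, circleMap c (2 * r) θ ∈ G := fun θ =>
    hG (circleMap_mem_closedBall c (by positivity) θ)
  have hfc : ∀ n, Continuous fun θ => f n (circleMap c (2 * r) θ) := fun n =>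
    (h.diff n).continuousOn.comp_continuous (continuous_circleMap c _) hcirc
  have hmeas : ∀ N : ℕ, Measurable fun q : Ω × ℝ =>
      ‖∑ n ∈ Finset.range N, ζ n q.1 * f n (circleMap c (2 * r) q.2)‖ₑ ^ (2 * p) := fun N =>
    (Finset.measurable_fun_sum _ fun n _ => ((h.measurable n).comp measurable_fst).mul
      ((hfc n).measurable.comp measurable_snd)).enorm.pow_const _
  have hmeas' : ∀ N : ℕ, Measurable fun ω => ∫⁻ θ in Set.Ioc 0 (2 * Real.pi),
      ‖∑ n ∈ Finset.range N, ζ n ω * f n (circleMap c (2 * r) θ)‖ₑ ^ (2 * p) := fun N =>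
    (hmeas N).lintegral_prod_right'
  refine ⟨fun ω => liminf (fun N : ℕ => ∫⁻ θ in Set.Ioc 0 (2 * Real.pi),
    ‖∑ n ∈ Finset.range N, ζ n ω * f n (circleMap c (2 * r) θ)‖ₑ ^ (2 * p)) atTop,
    .liminf hmeas', ?_, ?_⟩
  · filter_upwards [h.tendsto] with ω hω w hw
    have hwG : w ∈ G := hG (Metric.closedBall_subset_closedBall (by linarith) hw)
    have hlim : Tendsto (fun N => ‖∑ n ∈ Finset.range N, ζ n ω * f n w‖ₑ ^ (2 * p)) atTop
        (𝓝 (‖F ω w‖ₑ ^ (2 * p))) :=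
      ((ENNReal.continuous_pow _).tendsto _).comp (hω w hwG).enorm
    rw [← hlim.liminf_eq]
    refine liminf_le_liminf (Eventually.of_forall fun N => ?_)
    exact enorm_pow_le_lintegral_circle (h := fun w => ∑ n ∈ Finset.range N, ζ n ω * f n w)
      (DifferentiableOn.fun_sum fun n _ => (h.diff n).const_mul _) hr hG hw _
  · refine (lintegral_liminf_le hmeas').trans ?_
    refine liminf_le_of_frequently_le' (Frequently.of_forall fun N => ?_)
    rw [lintegral_lintegral_swap (hmeas N).aemeasurable]
    refine lintegral_mono fun θ => ?_
    refine (lintegral_moment_le h.measurable h.law h.indep _ _ p).trans ?_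
    gcongr
    exact ENNReal.sum_le_tsum _

/-- Moments of the supremum over a compact set. -/
theorem exists_compact_bound [IsProbabilityMeasure μ] (h : GaussianSeries μ G ζ f F)
    (hGo : IsOpen G) (p : ℕ) {K : Set ℂ} (hK : IsCompact K) (hKG : K ⊆ G) :
    ∃ M : Ω → ENNReal, Measurable M ∧
      (∀ᵐ ω ∂μ, ∀ w ∈ K, ‖F ω w‖ₑ ^ (2 * p) ≤ M ω) ∧ ∫⁻ ω, M ω ∂μ ≠ ⊤ := by
  refine hK.induction_on (p := fun K => ∃ M : Ω → ENNReal, Measurable M ∧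
      (∀ᵐ ω ∂μ, ∀ w ∈ K, ‖F ω w‖ₑ ^ (2 * p) ≤ M ω) ∧ ∫⁻ ω, M ω ∂μ ≠ ⊤) ?_ ?_ ?_ ?_
  · exact ⟨fun _ => 0, measurable_const, by simp, by simp⟩
  · rintro s t hst ⟨M, h1, h2, h3⟩
    exact ⟨M, h1, h2.mono fun ω hω w hw => hω w (hst hw), h3⟩
  · rintro s t ⟨M, h1, h2, h3⟩ ⟨N, h4, h5, h6⟩
    refine ⟨fun ω => M ω + N ω, h1.add h4, ?_, ?_⟩
    · filter_upwards [h2, h5] with ω h2 h5 w hw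
      rcases hw with hw | hw
      · exact (h2 w hw).trans le_self_add
      · exact (h5 w hw).trans le_add_self
    · rw [lintegral_add_left h1]
      exact ENNReal.add_ne_top.2 ⟨h3, h6⟩
  · intro c hc
    obtain ⟨ρ, hρ, hρG⟩ := Metric.nhds_basis_closedBall.mem_iff.1 (hGo.mem_nhds (hKG hc))
    have hρ2 : 2 * (ρ / 2) = ρ := by ring
    obtain ⟨M, h1, h2, h3⟩ := h.exists_disk_bound p (r := ρ / 2) (by positivity)
      (by rwa [hρ2])
    refine ⟨Metric.closedBall c (ρ / 2),
      mem_nhdsWithin_of_mem_nhds (Metric.closedBall_mem_nhds _ (by positivity)), M, h1, h2,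
      (h3.trans_lt ?_).ne⟩
    rw [hρ2]
    obtain ⟨C, hC⟩ := h.bdd _ (isCompact_closedBall c ρ) hρG
    calc _ ≤ ∫⁻ θ in Set.Ioc 0 (2 * Real.pi), gaussianMomentConst p * (C : ENNReal) ^ p := by
          refine lintegral_mono fun θ => ?_
          gcongr
          exact hC _ (circleMap_mem_closedBall c hρ.le θ)
      _ < ⊤ := by
          rw [setLIntegral_const, gaussianMomentConst]
          have : volume (Set.Ioc 0 (2 * Real.pi)) < ⊤ := measure_Ioc_lt_top
          finiteness

theorem tail_tendsto (h : GaussianSeries μ G ζ f F) {c : ℂ}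
    {r : ℝ} (hr : 0 < r) (hG : Metric.closedBall c (2 * r) ⊆ G) :
    Tendsto (fun N => ∫⁻ θ in Set.Ioc 0 (2 * Real.pi),
        gaussianMomentConst 1 * (∑' n, ‖if n ∈ Finset.range N then 0
          else f n (circleMap c (2 * r) θ)‖ₑ ^ 2) ^ 1) atTop (𝓝 0) := by
  have hcirc : ∀ θ, circleMap c (2 * r) θ ∈ Metric.closedBall c (2 * r) := fun θ =>
    circleMap_mem_closedBall c (by positivity) θ
  have hfc : ∀ n, Continuous fun θ => f n (circleMap c (2 * r) θ) := fun n =>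
    (h.diff n).continuousOn.comp_continuous (continuous_circleMap c _) fun θ => hG (hcirc θ)
  set a : ℕ → ENNReal := fun n => ∫⁻ θ in Set.Ioc 0 (2 * Real.pi),
    ‖f n (circleMap c (2 * r) θ)‖ₑ ^ 2 with ha
  have hsum : ∑' n, a n ≠ ⊤ := by
    rw [ha, ← lintegral_tsum fun n => ((hfc n).measurable.enorm.pow_const _).aemeasurable]
    obtain ⟨C, hC⟩ := h.bdd _ (isCompact_closedBall c (2 * r)) hG
    refine ((lintegral_mono fun θ => hC _ (hcirc θ)).trans_lt ?_).ne
    rw [setLIntegral_const]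
    have : volume (Set.Ioc 0 (2 * Real.pi)) < ⊤ := measure_Ioc_lt_top
    finiteness
  have hCne : gaussianMomentConst 1 ≠ ⊤ := ENNReal.ofReal_ne_top
  have h1 := ENNReal.Tendsto.const_mul (a := gaussianMomentConst 1)
    (ENNReal.tendsto_sum_nat_add a hsum) (Or.inr hCne)
  rw [mul_zero] at h1
  refine h1.congr fun N => ?_
  simp only [pow_one]
  rw [lintegral_const_mul' _ _ hCne, lintegral_tsum fun n => by
    by_cases hn : n ∈ Finset.range N
    · simp only [hn, if_true]; exact aemeasurable_const
    · simp only [hn, if_false]; exact ((hfc n).measurable.enorm.pow_const _).aemeasurable]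
  congr 1
  conv_rhs => rw [← ENNReal.summable.sum_add_tsum_nat_add' (k := N)]
  rw [Finset.sum_eq_zero fun n hn => by simp [Finset.mem_range.1 hn], zero_add]
  refine tsum_congr fun n => ?_
  simp [ha]

/-- Almost surely a fixed subsequence of the partial sums converges locally uniformly. -/
theorem exists_subseq [IsProbabilityMeasure μ] (h : GaussianSeries μ G ζ f F) (hGo : IsOpen G) :
    ∃ N : ℕ → ℕ, ∀ᵐ ω ∂μ, TendstoLocallyUniformlyOn
      (fun j w => ∑ n ∈ Finset.range (N j), ζ n ω * f n w) (F ω) atTop G := by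
  -- Countably many disks, with dense centres and radii `1/(n+1)`; those whose doubles lie in `G`
  -- form a neighbourhood cover of `G`.
  set c : ℕ → ℂ := fun i => TopologicalSpace.denseSeq ℂ i.unpair.1 with hc
  set r : ℕ → ℝ := fun i => 1 / ((i.unpair.2 : ℝ) + 1) with hr
  have hr0 : ∀ i, 0 < r i := fun i => by positivity
  set P : ℕ → Prop := fun i => Metric.closedBall (c i) (2 * r i) ⊆ G with hP
  set T : ℕ → ℕ → ENNReal := fun i N => ∫⁻ θ in Set.Ioc 0 (2 * Real.pi),
        gaussianMomentConst 1 * (∑' n, ‖if n ∈ Finset.range N then 0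
          else f n (circleMap (c i) (2 * r i) θ)‖ₑ ^ 2) ^ 1 with hT
  -- Diagonal choice: `N j` makes the mean error at most `2⁻ʲ` on the first `j + 1` disks at once.
  -- For disk `i` the errors from `j = i` on have summable means, so they tend to zero almost
  -- surely.
  have hsel : ∀ j : ℕ, ∃ N, ∀ i ∈ Finset.range (j + 1), P i → T i N ≤ (2⁻¹ : ENNReal) ^ j := by
    intro j
    have : ∀ᶠ N in atTop, ∀ i ∈ Finset.range (j + 1), P i → T i N ≤ (2⁻¹ : ENNReal) ^ j := by
      refine (Filter.eventually_all_finset _).2 fun i _ => ?_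
      by_cases hi : P i
      · have h0 : (0 : ENNReal) < (2⁻¹ : ENNReal) ^ j := ENNReal.pow_pos (by simp) j
        filter_upwards [(h.tail_tendsto (hr0 i) hi).eventually_lt_const h0] with N hN _
        exact hN.le
      · simp [hi]
    exact this.exists
  choose N hN using hsel
  refine ⟨N, ?_⟩
  have hM : ∀ i j, ∃ M : Ω → ENNReal, P i → Measurable M ∧
      (∀ᵐ ω ∂μ, ∀ w ∈ Metric.closedBall (c i) (r i),
        ‖F ω w - ∑ n ∈ Finset.range (N j), ζ n ω * f n w‖ₑ ^ (2 * 1) ≤ M ω) ∧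
      ∫⁻ ω, M ω ∂μ ≤ T i (N j) := by
    intro i j
    by_cases hi : P i
    · obtain ⟨M, hM⟩ := (h.remove (Finset.range (N j))).exists_disk_bound 1 (hr0 i) hi
      exact ⟨M, fun _ => hM⟩
    · exact ⟨0, fun h => absurd h hi⟩
  choose M hM using hM
  have hzero : ∀ i, P i → ∀ᵐ ω ∂μ, Tendsto (fun j => M i j ω) atTop (𝓝 0) := by
    intro i hi
    have hfin : ∫⁻ ω, ∑' j, M i (j + i) ω ∂μ ≠ ⊤ := by
      rw [lintegral_tsum fun j => ((hM i (j + i) hi).1).aemeasurable]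
      refine ne_top_of_le_ne_top (b := ∑' j : ℕ, (2⁻¹ : ENNReal) ^ j) ?_
        (ENNReal.tsum_le_tsum fun j => ?_)
      · rw [ENNReal.tsum_geometric]; simp
      · refine (hM i (j + i) hi).2.2.trans ((hN (j + i) i (by simp) hi).trans ?_)
        exact pow_le_pow_right_of_le_one' (by simp) (by omega)
    have := ae_lt_top (Measurable.tsum fun j => (hM i (j + i) hi).1) hfin
    filter_upwards [this] with ω hω
    exact (tendsto_add_atTop_iff_nat i).1 (ENNReal.tendsto_atTop_zero_of_tsum_ne_top hω.ne)
  have hae : ∀ᵐ ω ∂μ, ∀ i, P i → Tendsto (fun j => M i j ω) atTop (𝓝 0) ∧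
      ∀ j, ∀ w ∈ Metric.closedBall (c i) (r i),
        ‖F ω w - ∑ n ∈ Finset.range (N j), ζ n ω * f n w‖ₑ ^ (2 * 1) ≤ M i j ω := by
    refine ae_all_iff.2 fun i => ?_
    by_cases hi : P i
    · filter_upwards [hzero i hi, ae_all_iff.2 fun j => (hM i j hi).2.1] with ω h1 h2 _
      exact ⟨h1, h2⟩
    · exact Eventually.of_forall fun ω h => absurd h hi
  filter_upwards [hae] with ω hω
  rw [Metric.tendstoLocallyUniformlyOn_iff]
  intro ε hε w hw
  obtain ⟨ρ, hρ, hρG⟩ := Metric.nhds_basis_closedBall.mem_iff.1 (hGo.mem_nhds hw)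
  obtain ⟨m, hm⟩ := exists_nat_one_div_lt (show 0 < ρ / 3 by positivity)
  obtain ⟨l, hl⟩ := (TopologicalSpace.denseRange_denseSeq ℂ).exists_dist_lt w
    (show (0 : ℝ) < 1 / ((m : ℝ) + 1) by positivity)
  set i := Nat.pair l m with hi
  have hci : c i = TopologicalSpace.denseSeq ℂ l := by simp [hc, hi]
  have hri : r i = 1 / ((m : ℝ) + 1) := by simp [hr, hi]
  rw [← hci, ← hri] at hl
  rw [← hri] at hm
  have hPi : P i := by
    refine (Metric.closedBall_subset_closedBall' ?_).trans hρG
    rw [dist_comm]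
    linarith
  obtain ⟨h1, h2⟩ := hω i hPi
  refine ⟨Metric.closedBall (c i) (r i), mem_nhdsWithin_of_mem_nhds
    (mem_of_superset (Metric.isOpen_ball.mem_nhds (Metric.mem_ball.2 hl))
      Metric.ball_subset_closedBall), ?_⟩
  have hε' : (0 : ENNReal) < ENNReal.ofReal ε ^ 2 := ENNReal.pow_pos (by simpa using hε) 2
  filter_upwards [h1.eventually_lt_const hε'] with j hj x hx
  have h3 := (h2 j x hx).trans_lt hj
  rw [mul_one] at h3
  have h4 := lt_of_pow_lt_pow_left' _ h3
  rw [← ofReal_norm, ENNReal.ofReal_lt_ofReal_iff hε] at h4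
  rwa [dist_eq_norm]

theorem differentiableOn [IsProbabilityMeasure μ] (h : GaussianSeries μ G ζ f F)
    (hGo : IsOpen G) : ∀ᵐ ω ∂μ, DifferentiableOn ℂ (F ω) G := by
  obtain ⟨N, hN⟩ := h.exists_subseq hGo
  filter_upwards [hN] with ω hω
  exact hω.differentiableOn (Eventually.of_forall fun j =>
    DifferentiableOn.fun_sum fun n _ => (h.diff n).const_mul _) hGo

end GaussianSeries

end Series

/-! ### Independence and the zero-one law for linear functionals. -/

section ZeroOne

variable {Ω : Type*} [MeasurableSpace Ω] {μ : Measure Ω} {G : Set ℂ}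
  {ζ : ℕ → Ω → ℂ} {f : ℕ → ℂ → ℂ} {F : Ω → ℂ → ℂ}

/-- The functional `g ↦ ∑ cᵢ g[z₀, …, zᵢ]`. -/
noncomputable def newtonFunctional (z : ℕ → ℂ) (m : ℕ) (c : ℕ → ℂ) (g : ℂ → ℂ) : ℂ :=
  ∑ i ∈ Finset.range m, c i * newton z g i (z i)

theorem newtonFunctional_add (hG : IsOpen G) {z : ℕ → ℂ} {m : ℕ} (hz : ∀ i < m, z i ∈ G)
    (c : ℕ → ℂ) {g h : ℂ → ℂ} (hg : DifferentiableOn ℂ g G) (hh : DifferentiableOn ℂ h G) :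
    newtonFunctional z m c (fun w => g w + h w)
      = newtonFunctional z m c g + newtonFunctional z m c h := by
  simp only [newtonFunctional, ← Finset.sum_add_distrib]
  refine Finset.sum_congr rfl fun i hi => ?_
  have hi := Finset.mem_range.1 hi
  rw [newton_add hG (fun j hj => hz j (by omega)) hg hh, mul_add]

theorem newtonFunctional_sum (hG : IsOpen G) {z : ℕ → ℂ} {m : ℕ} (hz : ∀ i < m, z i ∈ G)
    (c : ℕ → ℂ) {κ : Type*} (s : Finset κ) (x : κ → ℂ) {g : κ → ℂ → ℂ}
    (hg : ∀ n ∈ s, DifferentiableOn ℂ (g n) G) :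
    newtonFunctional z m c (fun w => ∑ n ∈ s, x n * g n w)
      = ∑ n ∈ s, x n * newtonFunctional z m c (g n) := by
  simp only [newtonFunctional, Finset.mul_sum]
  rw [Finset.sum_comm]
  refine Finset.sum_congr rfl fun i hi => ?_
  have hi := Finset.mem_range.1 hi
  rw [newton_sum hG (fun j hj => hz j (by omega)) s x hg, Finset.mul_sum]
  exact Finset.sum_congr rfl fun n _ => by ring

theorem TendstoLocallyUniformlyOn.tendsto_prod {P : Type*} {l : Filter P} {g : P → ℂ → ℂ}
    {g₀ : ℂ → ℂ} (hG : IsOpen G) (h : TendstoLocallyUniformlyOn g g₀ l G)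
    (hc : ContinuousOn g₀ G) : ∀ w ∈ G,
      Tendsto (fun q : P × ℂ => g q.1 q.2) (l ×ˢ 𝓝 w) (𝓝 (g₀ w)) := by
  intro w hw
  rw [Metric.tendsto_nhds]
  intro ε hε
  obtain ⟨t, ht, hj⟩ := Metric.tendstoLocallyUniformlyOn_iff.1 h (ε / 2) (by positivity) w hw
  rw [hG.nhdsWithin_eq hw] at ht
  have hc := Metric.tendsto_nhds.1 (hc.continuousAt (hG.mem_nhds hw)) (ε / 2) (by positivity)
  filter_upwards [tendsto_fst.eventually hj, tendsto_snd.eventually ht,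
    tendsto_snd.eventually hc] with q h1 h2 h3
  have h4 := h1 q.2 h2
  rw [dist_comm] at h4
  linarith [dist_triangle (g q.1 q.2) (g₀ q.2) (g₀ w)]

theorem newtonFunctional_tendsto {P : Type*} {l : Filter P} [l.NeBot] (hG : IsOpen G) {z : ℕ → ℂ}
    {m : ℕ} (hz : ∀ i < m, z i ∈ G) (c : ℕ → ℂ) {g : P → ℂ → ℂ} {g₀ : ℂ → ℂ}
    (hg : ∀ p, DifferentiableOn ℂ (g p) G) (h : TendstoLocallyUniformlyOn g g₀ l G) :
    Tendsto (fun p => newtonFunctional z m c (g p)) l (𝓝 (newtonFunctional z m c g₀)) := by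
  have hg₀ : DifferentiableOn ℂ g₀ G := h.differentiableOn (Eventually.of_forall hg) hG
  refine tendsto_finsetSum _ fun i hi => ?_
  have hi := Finset.mem_range.1 hi
  exact (newton_tendsto_at hG (z := fun _ => z) (w := fun _ => z i) (Eventually.of_forall hg) hg₀
    (fun j _ => tendsto_const_nhds) (fun j hj => hz j (by omega))
    (h.tendsto_prod hG hg₀.continuousOn) tendsto_const_nhds (hz i hi)).const_mul _

/-- Filling the missing coordinates with zeros keeps both independent blocks in `ℕ → ℂ`, avoiding
subtypes of indices. -/
theorem indepFun_split (hm : ∀ n, Measurable (ζ n)) (hi : iIndepFun ζ μ) (s : Finset ℕ) :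
    IndepFun (fun ω (n : ℕ) => if n ∈ s then ζ n ω else 0)
      (fun ω (n : ℕ) => if n ∈ s then 0 else ζ n ω) μ := by
  have h := indep_iSup_of_disjoint (fun n => (hm n).comap_le) hi
    (S := {n | n ∈ s}) (T := {n | n ∉ s})
    (Set.disjoint_left.2 fun n h1 h2 => h2 h1)
  rw [IndepFun_iff_Indep]
  refine indep_of_indep_of_le_left (indep_of_indep_of_le_right h ?_) ?_
  · rw [← measurable_iff_comap_le]
    refine @measurable_pi_lambda _ _ _ (_) _ _ fun n => ?_
    by_cases hn : n ∈ s
    · simp only [hn, if_true]; exact measurable_const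
    · simp only [hn, if_false]
      exact measurable_iff_comap_le.2 (le_iSup₂_of_le n hn le_rfl)
  · rw [← measurable_iff_comap_le]
    refine @measurable_pi_lambda _ _ _ (_) _ _ fun n => ?_
    by_cases hn : n ∈ s
    · simp only [hn, if_true]
      exact measurable_iff_comap_le.2 (le_iSup₂_of_le n hn le_rfl)
    · simp only [hn, if_false]; exact measurable_const

/-- Conditioning on `Y` by Fubini; this is how the remainder gets frozen. -/
theorem measure_prodMk_eq_lintegral [IsProbabilityMeasure μ] {α β : Type*} [MeasurableSpace α]
    [MeasurableSpace β] {X : Ω → α} {Y : Ω → β} (hX : Measurable X) (hY : Measurable Y)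
    (hXY : IndepFun X Y μ) {E : Set (α × β)} (hE : MeasurableSet E) :
    μ {ω | (X ω, Y ω) ∈ E} = ∫⁻ ω, μ.map X {x | (x, Y ω) ∈ E} ∂μ := by
  have : IsProbabilityMeasure (μ.map X) := Measure.isProbabilityMeasure_map hX.aemeasurable
  have : IsProbabilityMeasure (μ.map Y) := Measure.isProbabilityMeasure_map hY.aemeasurable
  have h := (indepFun_iff_map_prod_eq_prod_map_map hX.aemeasurable hY.aemeasurable).1 hXY
  have h1 : μ {ω | (X ω, Y ω) ∈ E} = μ.map (fun ω => (X ω, Y ω)) E :=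
    (Measure.map_apply (hX.prodMk hY) hE).symm
  rw [h1, h, Measure.prod_apply_symm hE, lintegral_map (measurable_measure_prodMk_right hE) hY]
  rfl

theorem stdComplexGaussian_singleton (z : ℂ) : stdComplexGaussian {z} = 0 :=
  withDensity_absolutelyContinuous _ _ (measure_singleton z)

namespace GaussianSeries

theorem exists_newtonFunctional_tendsto [IsProbabilityMeasure μ] (h : GaussianSeries μ G ζ f F)
    (hG : IsOpen G) {z : ℕ → ℂ} {m : ℕ} (hz : ∀ i < m, z i ∈ G) (c : ℕ → ℂ) :
    ∃ N : ℕ → ℕ, ∀ᵐ ω ∂μ, Tendsto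
      (fun j => ∑ n ∈ Finset.range (N j), ζ n ω * newtonFunctional z m c (f n)) atTop
      (𝓝 (newtonFunctional z m c (F ω))) := by
  obtain ⟨N, hN⟩ := h.exists_subseq hG
  refine ⟨N, hN.mono fun ω hω => ?_⟩
  refine (newtonFunctional_tendsto hG hz c (fun j => DifferentiableOn.fun_sum fun n _ =>
    (h.diff n).const_mul _) hω).congr fun j => ?_
  exact newtonFunctional_sum hG hz c _ _ fun n _ => h.diff n

theorem aemeasurable_newtonFunctional [IsProbabilityMeasure μ] (h : GaussianSeries μ G ζ f F)
    (hG : IsOpen G) {z : ℕ → ℂ} {m : ℕ} (hz : ∀ i < m, z i ∈ G) (c : ℕ → ℂ) :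
    AEMeasurable (fun ω => newtonFunctional z m c (F ω)) μ := by
  obtain ⟨N, hN⟩ := h.exists_newtonFunctional_tendsto hG hz c
  exact aemeasurable_of_tendsto_metrizable_ae atTop (fun j => (Finset.measurable_fun_sum _
    fun n _ => (h.measurable n).mul_const _).aemeasurable) hN

theorem exists_newtonFunctional_ne_zero [IsProbabilityMeasure μ] (h : GaussianSeries μ G ζ f F)
    (hG : IsOpen G) {z : ℕ → ℂ} {m : ℕ} (hz : ∀ i < m, z i ∈ G) {c : ℕ → ℂ}
    (hne : ¬ ∀ᵐ ω ∂μ, newtonFunctional z m c (F ω) = 0) :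
    ∃ n, newtonFunctional z m c (f n) ≠ 0 := by
  by_contra! hcon
  obtain ⟨N, hN⟩ := h.exists_newtonFunctional_tendsto hG hz c
  refine hne (hN.mono fun ω hω => ?_)
  simp only [hcon, mul_zero, Finset.sum_const_zero] at hω
  exact tendsto_nhds_unique hω tendsto_const_nhds

/-- A linear functional of a Gaussian analytic function vanishes with probability `0` or `1`. -/
theorem ae_newtonFunctional_ne_zero [IsProbabilityMeasure μ] (h : GaussianSeries μ G ζ f F)
    (hG : IsOpen G) {z : ℕ → ℂ} {m : ℕ} (hz : ∀ i < m, z i ∈ G) {c : ℕ → ℂ}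
    (hne : ¬ ∀ᵐ ω ∂μ, newtonFunctional z m c (F ω) = 0) :
    ∀ᵐ ω ∂μ, newtonFunctional z m c (F ω) ≠ 0 := by
  obtain ⟨n₀, hn₀⟩ := h.exists_newtonFunctional_ne_zero hG hz hne
  set b := newtonFunctional z m c (f n₀) with hb
  have h' := h.remove {n₀}
  obtain ⟨N, hN⟩ := h'.exists_newtonFunctional_tendsto hG hz c
  set Y : Ω → ℕ → ℂ := fun ω n => if n ∈ ({n₀} : Finset ℕ) then 0 else ζ n ω with hY
  set a : ℕ → ℂ := fun n => newtonFunctional z m c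
    (fun w => if n ∈ ({n₀} : Finset ℕ) then 0 else f n w) with ha
  have ha0 : a n₀ = 0 := by
    have := newtonFunctional_sum hG hz c (∅ : Finset ℕ) (fun _ => 0) (g := f) (by simp)
    simpa [ha] using this
  -- The functional is affine in `ζ n₀` with slope `b ≠ 0`, so for fixed other variables it vanishes
  -- at a single value, a null event. `W` is an everywhere defined measurable version of the part
  -- not involving `ζ n₀`.
  set W : (ℕ → ℂ) → ℂ := fun y => limUnder atTop fun j => ∑ n ∈ Finset.range (N j), y n * a n
    with hW
  have hWm : Measurable W := (StronglyMeasurable.limUnder fun j => Measurable.stronglyMeasurable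
    (Finset.measurable_fun_sum _ fun n _ => (measurable_pi_apply n).mul_const _)).measurable
  have hYm : Measurable Y := measurable_pi_lambda _ fun n => by
    by_cases hn : n ∈ ({n₀} : Finset ℕ)
    · simp only [hY, hn, if_true]; exact measurable_const
    · simp only [hY, hn, if_false]; exact h.measurable n
  have hind : IndepFun (ζ n₀) (W ∘ Y) μ := by
    have := (indepFun_split h.measurable h.indep {n₀}).comp (measurable_pi_apply n₀) hWm
    simpa [Function.comp_def, hY] using this
  have hE : MeasurableSet {q : ℂ × ℂ | q.1 * b + q.2 = 0} :=
    measurableSet_eq_fun (by fun_prop) measurable_const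
  have hzero := measure_prodMk_eq_lintegral (h.measurable n₀) (hWm.comp hYm) hind hE
  have hsec : ∀ ω, μ.map (ζ n₀) {x | (x, (W ∘ Y) ω) ∈ {q : ℂ × ℂ | q.1 * b + q.2 = 0}} = 0 := by
    intro ω
    rw [h.law]
    refine measure_mono_null (fun x hx => ?_) (stdComplexGaussian_singleton (-(W (Y ω)) / b))
    have hx : x * b + W (Y ω) = 0 := hx
    rw [Set.mem_singleton_iff, eq_div_iff hn₀]
    linear_combination hx
  simp only [hsec, lintegral_zero] at hzero
  have hae : ∀ᵐ ω ∂μ, ¬ (ζ n₀ ω * b + W (Y ω) = 0) := measure_eq_zero_iff_ae_notMem.1 hzero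
  filter_upwards [hae, hN, h'.differentiableOn hG] with ω h1 h2 h3 h4
  apply h1
  have hWY : W (Y ω) = newtonFunctional z m c (fun w => F ω w - ∑ n ∈ {n₀}, ζ n ω * f n w) := by
    refine Tendsto.limUnder_eq (h2.congr fun j => Finset.sum_congr rfl fun n _ => ?_)
    by_cases hn : n = n₀
    · subst hn
      change _ * a n = _
      rw [ha0, mul_zero, mul_zero]
    · simp [hY, hn, ha]
  rw [hWY]
  have h5 := newtonFunctional_add hG hz c h3 ((h.diff n₀).const_mul (ζ n₀ ω))
  simp only [Finset.sum_singleton, sub_add_cancel] at h5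
  have h6 := newtonFunctional_sum hG hz c {n₀} (fun n => ζ n ω) (g := f) (fun n _ => h.diff n)
  simp only [Finset.sum_singleton] at h6
  rw [h6, h4] at h5
  simp only [Finset.sum_singleton]
  rw [hb]
  linear_combination -h5

theorem exists_compact_norm_bound [IsProbabilityMeasure μ] (h : GaussianSeries μ G ζ f F)
    (hGo : IsOpen G) (p : ℕ) {K : Set ℂ} (hK : IsCompact K) (hKG : K ⊆ G) :
    ∃ m : Ω → ℝ, (∀ᵐ ω ∂μ, 0 ≤ m ω ∧ ∀ w ∈ K, ‖F ω w‖ ≤ m ω) ∧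
      ∫⁻ ω, ENNReal.ofReal (m ω ^ (2 * p)) ∂μ ≠ ⊤ := by
  have key : ∀ q : ℕ, q ≠ 0 → ∃ m : Ω → ℝ, (∀ᵐ ω ∂μ, 0 ≤ m ω ∧ ∀ w ∈ K, ‖F ω w‖ ≤ m ω) ∧
      ∫⁻ ω, ENNReal.ofReal (m ω ^ (2 * q)) ∂μ ≠ ⊤ := by
    intro q hq
    obtain ⟨M, hM, hb, hfin⟩ := h.exists_compact_bound hGo q hK hKG
    have h2q : 2 * q ≠ 0 := by omega
    have hpow : ∀ ω, ((M ω).toReal ^ (((2 * q : ℕ) : ℝ)⁻¹)) ^ (2 * q) = (M ω).toReal := fun ω =>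
      Real.rpow_inv_natCast_pow ENNReal.toReal_nonneg h2q
    refine ⟨fun ω => (M ω).toReal ^ (((2 * q : ℕ) : ℝ)⁻¹), ?_, ?_⟩
    · filter_upwards [hb, ae_lt_top hM hfin] with ω h1 h2
      refine ⟨by positivity, fun w hw => ?_⟩
      refine (pow_le_pow_iff_left₀ (norm_nonneg _) (by positivity) h2q).1 ?_
      rw [hpow]
      have := ENNReal.toReal_mono h2.ne (h1 w hw)
      simpa using this
    · simp only [hpow]
      exact ne_top_of_le_ne_top hfin (lintegral_mono fun ω => ENNReal.ofReal_toReal_le)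
  -- The root of order `2p` is meaningless for `p = 0`; any majorant then does.
  rcases p with _ | p
  · obtain ⟨m, h1, -⟩ := key 1 one_ne_zero
    exact ⟨m, h1, by simp⟩
  · exact key (p + 1) (by omega)

/-- The Kac–Rice formula for the hitting probabilities of small disks. -/
theorem zeroHit_tendsto [IsProbabilityMeasure μ] (h : GaussianSeries μ G ζ f F)
    (hG : IsOpen G) {k : ℕ} {z : Fin k → ℂ} (hz : ∀ j, z j ∈ G) {ι : Fin k → ℕ}
    (hι : Function.Injective ι) (hA : (Matrix.of fun j a => f (ι a) (z j)).det ≠ 0)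
    {xs : Ω → Fin k → ℂ}
    (hxs : ∀ᵐ ω ∂μ, ∀ j, ∑ a, xs ω a * f (ι a) (z j)
      + (F ω (z j) - ∑ a, ζ (ι a) ω * f (ι a) (z j)) = 0) :
    Tendsto (fun ε : ℝ => μ {ω | ∀ j, ∃ w ∈ G, ‖w - z j‖ ≤ ε ∧ F ω w = 0}
        / ENNReal.ofReal ((Real.pi * ε ^ 2) ^ k)) (𝓝[>] 0)
      (𝓝 (∫⁻ ω, ENNReal.ofReal ((‖(Matrix.of fun j a => f (ι a) (z j)).det‖ ^ 2)⁻¹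
        * Real.pi⁻¹ ^ k * Real.exp (-∑ a, ‖xs ω a‖ ^ 2)
        * ∏ j, ‖deriv (fun w => ∑ a, xs ω a * f (ι a) w
          + (F ω w - ∑ a, ζ (ι a) ω * f (ι a) w)) (z j)‖ ^ 2) ∂μ)) := by
  classical
  set s : Finset ℕ := Finset.univ.image ι with hs
  set φ : Fin k → ℂ → ℂ := fun a => f (ι a) with hφdef
  have hφ : ∀ a, DifferentiableOn ℂ (φ a) G := fun a => h.diff _
  set R : Ω → ℂ → ℂ := fun ω w => F ω w - ∑ a, ζ (ι a) ω * f (ι a) w with hR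
  set f' : ℕ → ℂ → ℂ := fun n w => if n ∈ s then 0 else f n w with hf'
  have h' : GaussianSeries μ G ζ f' R := by
    have := h.remove s
    rw [hs] at this
    simp only [Finset.sum_image (fun a _ b _ hab => hι hab)] at this
    exact this
  set X : Ω → Fin k → ℂ := fun ω a => ζ (ι a) ω with hX
  set Y : Ω → ℕ → ℂ := fun ω n => if n ∈ s then 0 else ζ n ω with hY
  have hXm : Measurable X := measurable_pi_lambda _ fun a => h.measurable _
  have hYm : Measurable Y := measurable_pi_lambda _ fun n => by
    by_cases hn : n ∈ s
    · simp only [hY, hn, if_true]; exact measurable_const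
    · simp only [hY, hn, if_false]; exact h.measurable n
  have hXY : IndepFun X Y μ := by
    have := (indepFun_split h.measurable h.indep s).comp
      (φ := fun (x : ℕ → ℂ) (a : Fin k) => x (ι a)) (by fun_prop) measurable_id
    have hmem : ∀ a, ι a ∈ s := fun a => Finset.mem_image_of_mem _ (Finset.mem_univ _)
    simpa [Function.comp_def, hmem] using this
  have hlaw : μ.map X = Measure.pi fun _ : Fin k => stdComplexGaussian := by
    have := (iIndepFun_iff_map_fun_eq_pi_map fun a => (h.measurable (ι a)).aemeasurable).1
      (h.indep.precomp hι)
    simpa only [h.law] using this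
  have : IsProbabilityMeasure (Measure.pi fun _ : Fin k => stdComplexGaussian) :=
    hlaw ▸ Measure.isProbabilityMeasure_map hXm.aemeasurable
  -- A version of `R` depending measurably on the variables outside the chosen block. Only its
  -- values at the countably many points of `diskSeq` enter the event `E ε`.
  set Rd : (ℕ → ℂ) → ℂ → ℂ := fun y w => limUnder atTop fun N =>
    ∑ n ∈ Finset.range N, y n * f' n w with hRd
  have hRdm : ∀ w, Measurable fun y => Rd y w := fun w =>
    (StronglyMeasurable.limUnder fun j => Measurable.stronglyMeasurable
      (Finset.measurable_fun_sum _ fun n _ => (measurable_pi_apply n).mul_const _)).measurable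
  have hRdR : ∀ᵐ ω ∂μ, ∀ w ∈ G, Rd (Y ω) w = R ω w := by
    filter_upwards [h'.tendsto] with ω hω w hw
    refine Tendsto.limUnder_eq ((hω w hw).congr fun N => Finset.sum_congr rfl fun n _ => ?_)
    by_cases hn : n ∈ s <;> simp [hY, hf', hn]
  set E : ℝ → Set ((Fin k → ℂ) × (ℕ → ℂ)) := fun ε => {q | ∀ j : Fin k, ∀ m : ℕ, ∃ n,
    ‖∑ a, q.1 a * φ a (diskSeq (z j) ε n) + Rd q.2 (diskSeq (z j) ε n)‖ < 1 / ((m : ℝ) + 1)}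
    with hEdef
  have hE : ∀ ε, MeasurableSet (E ε) := fun ε =>
    measurableSet_approxHit (H := fun (q : (Fin k → ℂ) × (ℕ → ℂ)) w =>
      ∑ a, q.1 a * φ a w + Rd q.2 w) z ε fun j n =>
      (by fun_prop : Measurable fun q : (Fin k → ℂ) × (ℕ → ℂ) =>
        ∑ a, q.1 a * φ a (diskSeq (z j) ε n)).add ((hRdm _).comp measurable_snd)
  have hsec : ∀ᵐ ω ∂μ, ∀ ε : ℝ, 0 < ε → (∀ j, Metric.closedBall (z j) ε ⊆ G) →
      {x | (x, Y ω) ∈ E ε} = hitSet z ε φ (R ω) := by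
    filter_upwards [hRdR, h'.differentiableOn hG] with ω h1 h2 ε hε hεG
    rw [hitSet_eq_approx hφ h2 hε.le hεG]
    ext x
    refine forall_congr' fun j => forall_congr' fun m => exists_congr fun n => ?_
    rw [h1 _ (hεG j (by simpa [dist_eq_norm] using norm_diskSeq_sub_le (z j) hε.le n))]
  have hprob : ∀ ε : ℝ, 0 < ε → (∀ j, Metric.closedBall (z j) ε ⊆ G) →
      μ {ω | ∀ j, ∃ w ∈ G, ‖w - z j‖ ≤ ε ∧ F ω w = 0}
        = ∫⁻ ω, Measure.pi (fun _ : Fin k => stdComplexGaussian) {x | (x, Y ω) ∈ E ε} ∂μ := by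
    intro ε hε hεG
    rw [← hlaw, ← measure_prodMk_eq_lintegral hXm hYm hXY (hE ε)]
    refine measure_congr ?_
    filter_upwards [hsec] with ω hω
    have h1 : X ω ∈ {x | (x, Y ω) ∈ E ε} ↔ X ω ∈ hitSet z ε φ (R ω) := by rw [hω ε hε hεG]
    refine propext (Iff.trans ?_ h1.symm)
    refine forall_congr' fun j => exists_congr fun w => ?_
    have h2 : ∑ a, X ω a * φ a w + R ω w = F ω w := by simp [hX, hφdef, hR]
    rw [h2]
    refine ⟨fun h => h.2, fun h => ⟨hεG j (by simpa [dist_eq_norm] using h.1), h⟩⟩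
  -- The dominating function is `C m²ᵏ`, with `m` a majorant of `|R|` on `K` having a finite moment
  -- of order `2k`.
  obtain ⟨K, hK, hKG, C, hC, hbound⟩ := gaussian_hit_le hG hz hφ hA
  obtain ⟨m, hm, hmfin⟩ := h'.exists_compact_norm_bound hG k hK hKG
  have hlim : Tendsto (fun ε : ℝ => ∫⁻ ω,
      Measure.pi (fun _ : Fin k => stdComplexGaussian) {x | (x, Y ω) ∈ E ε}
        / ENNReal.ofReal ((Real.pi * ε ^ 2) ^ k) ∂μ) (𝓝[>] 0)
      (𝓝 (∫⁻ ω, ENNReal.ofReal ((‖(Matrix.of fun j a => f (ι a) (z j)).det‖ ^ 2)⁻¹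
        * Real.pi⁻¹ ^ k * Real.exp (-∑ a, ‖xs ω a‖ ^ 2)
        * ∏ j, ‖deriv (fun w => ∑ a, xs ω a * φ a w + R ω w) (z j)‖ ^ 2) ∂μ)) := by
    refine tendsto_lintegral_filter_of_dominated_convergence
      (fun ω => ENNReal.ofReal C * ENNReal.ofReal (m ω ^ (2 * k))) ?_ ?_ ?_ ?_
    · exact Eventually.of_forall fun ε =>
        ((measurable_measure_prodMk_right (hE ε)).comp hYm).div_const _
    · filter_upwards [hbound, eventually_forall_closedBall_subset hG hz] with ε hb ⟨hε, hεG⟩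
      filter_upwards [hsec, h'.differentiableOn hG, hm] with ω h1 h2 h3
      rw [h1 ε hε hεG, ← ENNReal.ofReal_mul hC]
      exact hb (R ω) (m ω) h2 h3.1 h3.2
    · rw [lintegral_const_mul' _ _ ENNReal.ofReal_ne_top]
      exact ENNReal.mul_ne_top ENNReal.ofReal_ne_top hmfin
    · filter_upwards [hsec, h'.differentiableOn hG, hxs] with ω h1 h2 h3
      refine (gaussian_hit_tendsto hG hz hφ hA h2 h3).congr' ?_
      filter_upwards [eventually_forall_closedBall_subset hG hz] with ε ⟨hε, hεG⟩
      rw [h1 ε hε hεG]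
  refine hlim.congr' ?_
  filter_upwards [eventually_forall_closedBall_subset hG hz] with ε ⟨hε, hεG⟩
  rw [hprob ε hε hεG]
  simp only [div_eq_mul_inv]
  refine lintegral_mul_const' _ _ (ENNReal.inv_ne_top.2 ?_)
  rw [Ne, ENNReal.ofReal_eq_zero, not_le]
  positivity

end GaussianSeries

end ZeroOne

/-! ### Extraction of Vandermonde factors. -/

/-- The sequence of nodes `z₀, …, z_{k-1}, b, b, …`. -/
def nodeSeq {k : ℕ} (z : Fin k → ℂ) (b : ℂ) (i : ℕ) : ℂ := if h : i < k then z ⟨i, h⟩ else b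

theorem nodeSeq_val {k : ℕ} (z : Fin k → ℂ) (b : ℂ) (i : Fin k) : nodeSeq z b i = z i := by
  simp [nodeSeq]

theorem nodeSeq_self {k : ℕ} (z : Fin k → ℂ) (b : ℂ) : nodeSeq z b k = b := by
  simp [nodeSeq]

theorem nodeSeq_mem {k : ℕ} {G : Set ℂ} {z : Fin k → ℂ} (hz : ∀ j, z j ∈ G) (b : ℂ) :
    ∀ i < k, nodeSeq z b i ∈ G := fun i hi => by simp [nodeSeq, hi, hz]

theorem nodeSeq_mem_succ {k : ℕ} {G : Set ℂ} {z : Fin k → ℂ} (hz : ∀ j, z j ∈ G) {b : ℂ}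
    (hb : b ∈ G) : ∀ i < k + 1, nodeSeq z b i ∈ G := fun i hi => by
  rcases Nat.lt_succ_iff_lt_or_eq.1 hi with hi | rfl
  · exact nodeSeq_mem hz b i hi
  · rwa [nodeSeq_self]

theorem newton_nodeSeq {k : ℕ} (z : Fin k → ℂ) (b b' : ℂ) (g : ℂ → ℂ) {i : ℕ} (hi : i ≤ k) :
    newton (nodeSeq z b) g i = newton (nodeSeq z b') g i :=
  newton_congr g fun j hj => by simp [nodeSeq, show j < k by omega]

/-- The divided differences `g[z₀, …, zᵢ]`. -/
noncomputable def divDiff {k : ℕ} (z : Fin k → ℂ) (g : ℂ → ℂ) (i : Fin k) : ℂ :=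
  newton (nodeSeq z 0) g i (z i)

/-- The matrix of divided differences of a family of functions. -/
noncomputable def divDiffMatrix {k : ℕ} (z : Fin k → ℂ) (φ : Fin k → ℂ → ℂ) :
    Matrix (Fin k) (Fin k) ℂ := Matrix.of fun i a => divDiff z (φ a) i

/-- The squared modulus of the Vandermonde determinant. -/
noncomputable def vandermondeSq {k : ℕ} (z : Fin k → ℂ) : ℝ :=
  ∏ i, ∏ j ∈ Finset.Ioi i, ‖z i - z j‖ ^ 2

theorem vandermondeSq_nonneg {k : ℕ} (z : Fin k → ℂ) : 0 ≤ vandermondeSq z :=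
  Finset.prod_nonneg fun _ _ => Finset.prod_nonneg fun _ _ => sq_nonneg _

theorem vandermondeSq_pos {k : ℕ} {z : Fin k → ℂ} (hz : Function.Injective z) :
    0 < vandermondeSq z :=
  Finset.prod_pos fun _ _ => Finset.prod_pos fun _ hj => pow_pos (norm_pos_iff.2
    (sub_ne_zero.2 (hz.ne (Finset.mem_Ioi.1 hj).ne))) 2

theorem vandermondeSq_eq_Iio {k : ℕ} (z : Fin k → ℂ) :
    ∏ j, ∏ l ∈ Finset.Iio j, ‖z j - z l‖ ^ 2 = vandermondeSq z := by
  rw [vandermondeSq, Finset.prod_comm' (t' := Finset.univ) (s' := fun j => Finset.Ioi j)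
    (by simp)]
  exact Finset.prod_congr rfl fun i _ => Finset.prod_congr rfl fun j _ => by rw [norm_sub_rev]

/-- Every unordered pair of nodes is counted twice. -/
theorem prod_erase_eq_vandermondeSq {k : ℕ} (z : Fin k → ℂ) :
    ∏ j, ∏ l ∈ Finset.univ.erase j, ‖z j - z l‖ ^ 2 = vandermondeSq z ^ 2 := by
  have : ∀ j : Fin k, ∏ l ∈ Finset.univ.erase j, ‖z j - z l‖ ^ 2
      = (∏ l ∈ Finset.Iio j, ‖z j - z l‖ ^ 2) * ∏ l ∈ Finset.Ioi j, ‖z j - z l‖ ^ 2 := by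
    intro j
    rw [← Finset.prod_union (Finset.disjoint_left.2 fun l h1 h2 =>
      lt_asymm (Finset.mem_Iio.1 h1) (Finset.mem_Ioi.1 h2))]
    refine Finset.prod_congr ?_ fun _ _ => rfl
    ext l
    simp
  simp only [this, Finset.prod_mul_distrib]
  rw [vandermondeSq_eq_Iio, sq]
  rfl

theorem eq_sum_divDiff {k : ℕ} (z : Fin k → ℂ) (g : ℂ → ℂ) (w : ℂ) :
    g w = ∑ i, divDiff z g i * ∏ l ∈ Finset.Iio i, (w - z l)
      + newton (nodeSeq z 0) g k w * ∏ l, (w - z l) := by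
  have h := newton_interpolation (nodeSeq z 0) g k w
  rw [Finset.sum_range, Finset.prod_range] at h
  simp only [nodeSeq_val] at h
  refine h.trans ?_
  congr 1
  refine Finset.sum_congr rfl fun i _ => ?_
  rw [divDiff, ← Nat.Iio_eq_range, ← Fin.map_valEmbedding_Iio, Finset.prod_map]
  simp only [Fin.valEmbedding_apply, nodeSeq_val]

/-- Newton's formula at the nodes factors the evaluation matrix as a lower triangular matrix times
the divided differences; the diagonal of the former yields the Vandermonde product. -/
theorem det_eval_eq {k : ℕ} (z : Fin k → ℂ) (φ : Fin k → ℂ → ℂ) :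
    (Matrix.of fun j a => φ a (z j)).det
      = (∏ j, ∏ l ∈ Finset.Iio j, (z j - z l)) * (divDiffMatrix z φ).det := by
  set T : Matrix (Fin k) (Fin k) ℂ := Matrix.of fun j i => ∏ l ∈ Finset.Iio i, (z j - z l) with hT
  have hmul : (Matrix.of fun j a => φ a (z j)) = T * divDiffMatrix z φ := by
    ext j a
    rw [Matrix.of_apply, eq_sum_divDiff z (φ a) (z j),
      Finset.prod_eq_zero (Finset.mem_univ j) (sub_self (z j)), mul_zero, add_zero,
      Matrix.mul_apply]
    exact Finset.sum_congr rfl fun i _ => mul_comm _ _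
  have hlow : T.IsLowerTriangular := by
    intro j i hij
    exact Finset.prod_eq_zero (Finset.mem_Iio.2 hij) (sub_self (z j))
  rw [hmul, Matrix.det_mul, Matrix.det_of_isLowerTriangular T hlow]
  rfl

theorem norm_det_eval_sq {k : ℕ} (z : Fin k → ℂ) (φ : Fin k → ℂ → ℂ) :
    ‖(Matrix.of fun j a => φ a (z j)).det‖ ^ 2
      = vandermondeSq z * ‖(divDiffMatrix z φ).det‖ ^ 2 := by
  rw [det_eval_eq, norm_mul, mul_pow, norm_prod, ← vandermondeSq_eq_Iio]
  simp only [norm_prod, Finset.prod_pow]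

theorem eval_eq_zero_of_divDiff {k : ℕ} {z : Fin k → ℂ} {g : ℂ → ℂ} (h0 : ∀ i, divDiff z g i = 0)
    (j : Fin k) : g (z j) = 0 := by
  rw [eq_sum_divDiff z g (z j), Finset.prod_eq_zero (Finset.mem_univ j) (sub_self (z j))]
  simp [h0]

/-- Only the remainder in Newton's formula survives, and differentiating it at `z j` hits just the
factor `w - z j`. -/
theorem deriv_eq_of_divDiff {k : ℕ} {G : Set ℂ} (hG : IsOpen G) {z : Fin k → ℂ}
    (hz : ∀ j, z j ∈ G) {g : ℂ → ℂ} (hg : DifferentiableOn ℂ g G) (h0 : ∀ i, divDiff z g i = 0)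
    (j : Fin k) :
    deriv g (z j) = newton (nodeSeq z 0) g k (z j) * ∏ l ∈ Finset.univ.erase j, (z j - z l) := by
  have e : g = fun w => (w - z j) *
      (newton (nodeSeq z 0) g k w * ∏ l ∈ Finset.univ.erase j, (w - z l)) := by
    ext w
    rw [eq_sum_divDiff z g w, ← Finset.mul_prod_erase _ _ (Finset.mem_univ j)]
    simp only [h0, zero_mul, Finset.sum_const_zero, zero_add]
    ring
  have hd : DifferentiableAt ℂ
      (fun w => newton (nodeSeq z 0) g k w * ∏ l ∈ Finset.univ.erase j, (w - z l)) (z j) :=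
    ((newton_differentiableOn hG (nodeSeq_mem hz 0) hg).differentiableAt
      (hG.mem_nhds (hz j))).mul (by fun_prop)
  have h1 : HasDerivAt (fun w => w - z j) 1 (z j) := (hasDerivAt_id (z j)).sub_const _
  have := (h1.mul hd.hasDerivAt).deriv
  simp only [sub_self, zero_mul, add_zero, one_mul] at this
  conv_lhs => rw [e]
  exact this

theorem divDiff_sum_add {k : ℕ} {G : Set ℂ} (hG : IsOpen G) {z : Fin k → ℂ}
    (hz : ∀ j, z j ∈ G) {φ : Fin k → ℂ → ℂ} (hφ : ∀ a, DifferentiableOn ℂ (φ a) G) {R : ℂ → ℂ}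
    (hR : DifferentiableOn ℂ R G) (x : Fin k → ℂ) :
    divDiff z (fun w => ∑ a, x a * φ a w + R w)
      = (divDiffMatrix z φ).mulVec x + divDiff z R := by
  ext i
  have hz' : ∀ j < (i : ℕ), nodeSeq z 0 j ∈ G := fun j hj => nodeSeq_mem hz 0 j (by omega)
  rw [divDiff, newton_add hG hz' (DifferentiableOn.fun_sum fun a _ => (hφ a).const_mul _) hR,
    newton_sum hG hz' _ _ fun a _ => hφ a]
  simp only [Pi.add_apply, divDiff, Matrix.mulVec, dotProduct, divDiffMatrix, Matrix.of_apply]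
  congr 1
  exact Finset.sum_congr rfl fun a _ => mul_comm _ _

theorem divDiff_tendsto {k : ℕ} {G : Set ℂ} (hG : IsOpen G) {z₀ : Fin k → ℂ}
    (hz : ∀ j, z₀ j ∈ G) {g : ℂ → ℂ} (hg : DifferentiableOn ℂ g G) (i : Fin k) :
    Tendsto (fun z => divDiff z g i) (𝓝 z₀) (𝓝 (divDiff z₀ g i)) := by
  have hp : ∀ j : Fin k, Tendsto (fun z : Fin k → ℂ => z j) (𝓝 z₀) (𝓝 (z₀ j)) := fun j =>
    (continuous_apply j).tendsto z₀
  refine newton_tendsto_nodes hG hg (fun j hj => ?_) (fun j hj => nodeSeq_mem hz 0 j (by omega))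
    (hp i) (hz i)
  have hjk : j < k := by omega
  simp only [nodeSeq, hjk, dite_true]
  exact hp _

theorem newton_nodeSeq_tendsto {k : ℕ} {G : Set ℂ} (hG : IsOpen G) {z₀ : Fin k → ℂ}
    (hz : ∀ j, z₀ j ∈ G) {g : ℂ → ℂ} (hg : DifferentiableOn ℂ g G) (j : Fin k) :
    Tendsto (fun z => newton (nodeSeq z 0) g k (z j)) (𝓝 z₀)
      (𝓝 (newton (nodeSeq z₀ 0) g k (z₀ j))) := by
  have hp : ∀ j : Fin k, Tendsto (fun z : Fin k → ℂ => z j) (𝓝 z₀) (𝓝 (z₀ j)) := fun j =>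
    (continuous_apply j).tendsto z₀
  refine newton_tendsto_nodes hG hg (fun i hi => ?_) (fun i hi => nodeSeq_mem hz 0 i hi)
    (hp j) (hz j)
  simp only [nodeSeq, hi, dite_true]
  exact hp _

theorem exists_injective_det_ne_zero {k : ℕ} {u : ℕ → Fin k → ℂ}
    (h : ∀ c : Fin k → ℂ, (∀ n, ∑ i, c i * u n i = 0) → c = 0) :
    ∃ ι : Fin k → ℕ, Function.Injective ι ∧ (Matrix.of fun i a => u (ι a) i).det ≠ 0 := by
  have hspan : Submodule.span ℂ (Set.range u) = ⊤ := by
    by_contra hne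
    obtain ⟨L, hL, hker⟩ := Submodule.exists_le_ker_of_lt_top _ (lt_top_iff_ne_top.2 hne)
    have hLx : ∀ x, L x = ∑ i, (L fun j => if i = j then 1 else 0) * x i := fun x => by
      rw [LinearMap.pi_apply_eq_sum_univ L x]
      exact Finset.sum_congr rfl fun i _ => by rw [smul_eq_mul, mul_comm]
    have hc := h _ fun n => by
      rw [← hLx]
      exact hker (Submodule.subset_span ⟨n, rfl⟩)
    refine hL (LinearMap.ext fun x => ?_)
    rw [hLx]
    exact Finset.sum_eq_zero fun i _ => by
      have := congrFun hc i
      simp only [Pi.zero_apply] at this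
      rw [this, zero_mul]
  obtain ⟨g, hg, -, hli⟩ := Submodule.exists_fun_fin_finrank_span_eq ℂ (Set.range u)
  have hk : k = Module.finrank ℂ (Submodule.span ℂ (Set.range u)) := by
    rw [hspan, finrank_top, Module.finrank_fin_fun]
  choose ι hι using hg
  have hli' := hli.comp (Fin.cast hk) (Fin.cast_injective hk)
  refine ⟨fun a => ι (Fin.cast hk a), fun a b hab => hli'.injective ?_, ?_⟩
  · simp only [Function.comp_apply, ← hι]
    exact congrArg u hab
  · have : (Matrix.of fun i a => u (ι (Fin.cast hk a)) i).col = g ∘ Fin.cast hk := by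
      ext a i
      simp [Matrix.col, hι]
    rw [← this, Matrix.linearIndependent_cols_iff_isUnit] at hli'
    exact ((Matrix.isUnit_iff_isUnit_det _).1 hli').ne_zero

/-- If the vectors of divided differences of the `fₙ` failed to span `ℂᵏ`, a nontrivial functional
would kill every `fₙ`, hence `F` almost surely. Nodes may coincide, so the indices chosen at `z₀`
serve all nearby configurations. -/
theorem GaussianSeries.exists_det_divDiff_ne_zero {Ω : Type*} [MeasurableSpace Ω] {μ : Measure Ω}
    [IsProbabilityMeasure μ] {G : Set ℂ} {ζ : ℕ → Ω → ℂ} {f : ℕ → ℂ → ℂ} {F : Ω → ℂ → ℂ}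
    (h : GaussianSeries μ G ζ f F) (hG : IsOpen G) {k d : ℕ} (hkd : k ≤ d)
    (hnd : IsNondegenerate μ G F d) {z : Fin k → ℂ} (hz : ∀ j, z j ∈ G) :
    ∃ ι : Fin k → ℕ, Function.Injective ι ∧
      (divDiffMatrix z fun a => f (ι a)).det ≠ 0 := by
  refine exists_injective_det_ne_zero (u := fun n => divDiff z (f n)) fun c hc => ?_
  set c' : ℕ → ℂ := fun i => if hi : i < k then c ⟨i, hi⟩ else 0 with hc'
  have key : ∀ g, newtonFunctional (nodeSeq z 0) k c' g = ∑ i, c i * divDiff z g i := fun g => by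
    rw [newtonFunctional, Finset.sum_range]
    exact Finset.sum_congr rfl fun i _ => by simp [hc', nodeSeq_val, divDiff]
  have h0 : ∀ᵐ ω ∂μ, newtonFunctional (nodeSeq z 0) k c' (F ω) = 0 := by
    by_contra hne
    obtain ⟨n, hn⟩ := h.exists_newtonFunctional_ne_zero hG (nodeSeq_mem hz 0) hne
    exact hn (by rw [key, hc n])
  have := hnd.newton_coeff_eq_zero hG (h.differentiableOn hG) hkd (nodeSeq_mem hz 0) h0
  ext i
  simpa [hc'] using this i i.2

/-! ### The density after division by the Vandermonde factor. -/

section Density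

variable {k : ℕ}

/-- Coefficients `x` for which `∑ xₐ φₐ + R` vanishes at all nodes. -/
noncomputable def interpCoeff (z : Fin k → ℂ) (φ : Fin k → ℂ → ℂ) (R : ℂ → ℂ) : Fin k → ℂ :=
  -((divDiffMatrix z φ)⁻¹.mulVec (divDiff z R))

/-- Coefficients of the divided differences of `R` in `interpResidual`. -/
noncomputable def residualCoeff (z : Fin k → ℂ) (φ : Fin k → ℂ → ℂ) (j i : Fin k) : ℂ :=
  -∑ a, (divDiffMatrix z φ)⁻¹ a i * newton (nodeSeq z 0) (φ a) k (z j)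

/-- The divided difference `g[z₀, …, z_{k-1}, zⱼ]` of `g = R + ∑ xₐ φₐ` with `x = interpCoeff`. -/
noncomputable def interpResidual (z : Fin k → ℂ) (φ : Fin k → ℂ → ℂ) (R : ℂ → ℂ) (j : Fin k) : ℂ :=
  newton (nodeSeq z 0) R k (z j) + ∑ i, residualCoeff z φ j i * divDiff z R i

/-- The integrand of the Kac–Rice formula, divided by the squared Vandermonde determinant. -/
noncomputable def kacRiceDensity (z : Fin k → ℂ) (φ : Fin k → ℂ → ℂ) (R : ℂ → ℂ) : ℝ :=
  (‖(divDiffMatrix z φ).det‖ ^ 2)⁻¹ * Real.pi⁻¹ ^ k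
    * Real.exp (-∑ a, ‖interpCoeff z φ R a‖ ^ 2) * ∏ j, ‖interpResidual z φ R j‖ ^ 2

variable {G : Set ℂ}

theorem divDiff_interp (hG : IsOpen G) {z : Fin k → ℂ} (hz : ∀ j, z j ∈ G)
    {φ : Fin k → ℂ → ℂ} (hφ : ∀ a, DifferentiableOn ℂ (φ a) G)
    (hB : (divDiffMatrix z φ).det ≠ 0) {R : ℂ → ℂ} (hR : DifferentiableOn ℂ R G) (i : Fin k) :
    divDiff z (fun w => ∑ a, interpCoeff z φ R a * φ a w + R w) i = 0 := by
  rw [divDiff_sum_add hG hz hφ hR, interpCoeff, Matrix.mulVec_neg, Matrix.mulVec_mulVec,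
    Matrix.mul_nonsing_inv _ (isUnit_iff_ne_zero.2 hB), Matrix.one_mulVec, neg_add_cancel]
  rfl

/-- Exchanging sums writes the residual as a functional of `R` alone, the form to which
nondegeneracy applies. -/
theorem newton_interp (hG : IsOpen G) {z : Fin k → ℂ} (hz : ∀ j, z j ∈ G)
    {φ : Fin k → ℂ → ℂ} (hφ : ∀ a, DifferentiableOn ℂ (φ a) G)
    {R : ℂ → ℂ} (hR : DifferentiableOn ℂ R G) (j : Fin k) :
    newton (nodeSeq z 0) (fun w => ∑ a, interpCoeff z φ R a * φ a w + R w) k (z j)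
      = interpResidual z φ R j := by
  have hz' := nodeSeq_mem hz 0
  rw [newton_add hG hz' (DifferentiableOn.fun_sum fun a _ => (hφ a).const_mul _) hR,
    newton_sum hG hz' _ _ fun a _ => hφ a]
  dsimp only
  rw [interpResidual, add_comm]
  congr 1
  simp only [interpCoeff, residualCoeff, Pi.neg_apply, Matrix.mulVec, dotProduct, neg_mul,
    Finset.sum_mul, Finset.sum_neg_distrib]
  rw [Finset.sum_comm]
  simp only [mul_right_comm]

theorem divDiffMatrix_tendsto (hG : IsOpen G) {z₀ : Fin k → ℂ} (hz : ∀ j, z₀ j ∈ G)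
    {φ : Fin k → ℂ → ℂ} (hφ : ∀ a, DifferentiableOn ℂ (φ a) G) :
    Tendsto (fun z => divDiffMatrix z φ) (𝓝 z₀) (𝓝 (divDiffMatrix z₀ φ)) :=
  tendsto_pi_nhds.2 fun i => tendsto_pi_nhds.2 fun a => divDiff_tendsto hG hz (hφ a) i

theorem det_divDiffMatrix_tendsto (hG : IsOpen G) {z₀ : Fin k → ℂ} (hz : ∀ j, z₀ j ∈ G)
    {φ : Fin k → ℂ → ℂ} (hφ : ∀ a, DifferentiableOn ℂ (φ a) G) :
    Tendsto (fun z => (divDiffMatrix z φ).det) (𝓝 z₀) (𝓝 (divDiffMatrix z₀ φ).det) :=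
  ((continuous_id.matrix_det).tendsto _).comp (divDiffMatrix_tendsto hG hz hφ)

theorem inv_divDiffMatrix_tendsto (hG : IsOpen G) {z₀ : Fin k → ℂ} (hz : ∀ j, z₀ j ∈ G)
    {φ : Fin k → ℂ → ℂ} (hφ : ∀ a, DifferentiableOn ℂ (φ a) G)
    (hB : (divDiffMatrix z₀ φ).det ≠ 0) :
    Tendsto (fun z => (divDiffMatrix z φ)⁻¹) (𝓝 z₀) (𝓝 (divDiffMatrix z₀ φ)⁻¹) := by
  simp only [Matrix.inv_def, Ring.inverse_eq_inv']
  exact ((det_divDiffMatrix_tendsto hG hz hφ).inv₀ hB).smul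
    ((continuous_id.matrix_adjugate.tendsto _).comp (divDiffMatrix_tendsto hG hz hφ))

theorem interpCoeff_tendsto (hG : IsOpen G) {z₀ : Fin k → ℂ} (hz : ∀ j, z₀ j ∈ G)
    {φ : Fin k → ℂ → ℂ} (hφ : ∀ a, DifferentiableOn ℂ (φ a) G)
    (hB : (divDiffMatrix z₀ φ).det ≠ 0) {R : ℂ → ℂ} (hR : DifferentiableOn ℂ R G) (a : Fin k) :
    Tendsto (fun z => interpCoeff z φ R a) (𝓝 z₀) (𝓝 (interpCoeff z₀ φ R a)) := by
  have h := inv_divDiffMatrix_tendsto hG hz hφ hB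
  simp only [interpCoeff, Pi.neg_apply, Matrix.mulVec, dotProduct]
  exact (tendsto_finsetSum _ fun i _ =>
    (tendsto_pi_nhds.1 (tendsto_pi_nhds.1 h a) i).mul (divDiff_tendsto hG hz hR i)).neg

theorem residualCoeff_tendsto (hG : IsOpen G) {z₀ : Fin k → ℂ} (hz : ∀ j, z₀ j ∈ G)
    {φ : Fin k → ℂ → ℂ} (hφ : ∀ a, DifferentiableOn ℂ (φ a) G)
    (hB : (divDiffMatrix z₀ φ).det ≠ 0) (j i : Fin k) :
    Tendsto (fun z => residualCoeff z φ j i) (𝓝 z₀) (𝓝 (residualCoeff z₀ φ j i)) := by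
  have h := inv_divDiffMatrix_tendsto hG hz hφ hB
  refine Tendsto.neg (tendsto_finsetSum _ fun a _ => ?_)
  exact (tendsto_pi_nhds.1 (tendsto_pi_nhds.1 h a) i).mul
    (newton_nodeSeq_tendsto hG hz (hφ a) j)

theorem kacRiceDensity_tendsto (hG : IsOpen G) {z₀ : Fin k → ℂ} (hz : ∀ j, z₀ j ∈ G)
    {φ : Fin k → ℂ → ℂ} (hφ : ∀ a, DifferentiableOn ℂ (φ a) G)
    (hB : (divDiffMatrix z₀ φ).det ≠ 0) {R : ℂ → ℂ} (hR : DifferentiableOn ℂ R G) :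
    Tendsto (fun z => kacRiceDensity z φ R) (𝓝 z₀) (𝓝 (kacRiceDensity z₀ φ R)) := by
  have h1 := (((det_divDiffMatrix_tendsto hG hz hφ).norm.pow 2).inv₀
    (pow_ne_zero 2 (norm_ne_zero_iff.2 hB))).mul_const (Real.pi⁻¹ ^ k)
  have h2 : Tendsto (fun z => Real.exp (-∑ a, ‖interpCoeff z φ R a‖ ^ 2)) (𝓝 z₀)
      (𝓝 (Real.exp (-∑ a, ‖interpCoeff z₀ φ R a‖ ^ 2))) :=
    (Real.continuous_exp.tendsto _).comp (tendsto_finsetSum _ fun a _ =>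
      (interpCoeff_tendsto hG hz hφ hB hR a).norm.pow 2).neg
  have h3 : Tendsto (fun z => ∏ j, ‖interpResidual z φ R j‖ ^ 2) (𝓝 z₀)
      (𝓝 (∏ j, ‖interpResidual z₀ φ R j‖ ^ 2)) :=
    tendsto_finsetProd _ fun j _ => ((newton_nodeSeq_tendsto hG hz hR j).add
      (tendsto_finsetSum _ fun i _ => (residualCoeff_tendsto hG hz hφ hB j i).mul
        (divDiff_tendsto hG hz hR i))).norm.pow 2
  exact (h1.mul h2).mul h3

/-- Counterpart of `gaussian_hit_le`, now uniform for nodes near a possibly degenerate `z₀`: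
`newton_norm_le` controls divided differences of `R` without dividing by node distances. -/
theorem kacRiceDensity_le (hG : IsOpen G) {z₀ : Fin k → ℂ} (hz : ∀ j, z₀ j ∈ G)
    {φ : Fin k → ℂ → ℂ} (hφ : ∀ a, DifferentiableOn ℂ (φ a) G)
    (hB : (divDiffMatrix z₀ φ).det ≠ 0) :
    ∃ K, IsCompact K ∧ K ⊆ G ∧ ∃ C : ℝ, 0 ≤ C ∧ ∀ᶠ z in 𝓝 z₀, ∀ (R : ℂ → ℂ) (m : ℝ),
      DifferentiableOn ℂ R G → 0 ≤ m → (∀ w ∈ K, ‖R w‖ ≤ m) →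
        kacRiceDensity z φ R ≤ C * m ^ (2 * k) := by
  obtain ⟨δ, hδ, hδG⟩ := (eventually_forall_closedBall_subset hG hz).exists
  set S := ⋃ j, Metric.closedBall (z₀ j) δ with hS
  have hSc : IsCompact S := isCompact_iUnion fun j => isCompact_closedBall _ _
  choose K hK hKG c hc hb using fun n => newton_norm_le hG n hSc (Set.iUnion_subset hδG)
  set c₁ : ℝ := ∑ n ∈ Finset.range (k + 1), c n with hc₁
  have hcle : ∀ n ≤ k, c n ≤ c₁ := fun n hn =>
    Finset.single_le_sum (f := c) (fun n _ => hc n) (Finset.mem_range.2 (by omega))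
  have hc₁0 : 0 ≤ c₁ := Finset.sum_nonneg fun n _ => hc n
  set d : Fin k → ℝ := fun j => c₁ * (1 + ∑ i, (‖residualCoeff z₀ φ j i‖ + 1)) with hd
  set e : ℝ := (‖(divDiffMatrix z₀ φ).det‖ ^ 2)⁻¹ + 1 with he
  refine ⟨⋃ n ∈ Finset.range (k + 1), K n,
    (Finset.range (k + 1)).isCompact_biUnion fun n _ => hK n,
    Set.iUnion₂_subset fun n _ => hKG n, e * Real.pi⁻¹ ^ k * ∏ j, d j ^ 2, by positivity, ?_⟩
  have hev1 : ∀ᶠ z in 𝓝 z₀, ∀ j, z j ∈ S := by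
    refine eventually_all.2 fun j => ?_
    filter_upwards [((continuous_apply j).tendsto z₀).eventually
      (Metric.closedBall_mem_nhds (z₀ j) hδ)] with z hz
    exact Set.mem_iUnion.2 ⟨j, hz⟩
  have hev2 : ∀ᶠ z in 𝓝 z₀, ∀ j i, ‖residualCoeff z φ j i‖ ≤ ‖residualCoeff z₀ φ j i‖ + 1 :=
    eventually_all.2 fun j => eventually_all.2 fun i =>
      (residualCoeff_tendsto hG hz hφ hB j i).norm.eventually_le_const (by linarith)
  have hev3 : ∀ᶠ z in 𝓝 z₀, (‖(divDiffMatrix z φ).det‖ ^ 2)⁻¹ ≤ e :=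
    (((det_divDiffMatrix_tendsto hG hz hφ).norm.pow 2).inv₀
      (pow_ne_zero 2 (norm_ne_zero_iff.2 hB))).eventually_le_const (by linarith)
  filter_upwards [hev1, hev2, hev3] with z h1 h2 h3 R m hR hm0 hm
  have hnewton : ∀ n ≤ k, ∀ w ∈ S, ‖newton (nodeSeq z 0) R n w‖ ≤ c₁ * m := fun n hn w hw =>
    (hb n _ (fun i hi => nodeSeq_mem h1 0 i (by omega)) R hR m
      (fun x hx => hm x (Set.mem_biUnion (Finset.mem_coe.2 (Finset.mem_range.2 (by omega))) hx))
      w hw).trans (mul_le_mul_of_nonneg_right (hcle n hn) hm0)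
  have hres : ∀ j, ‖interpResidual z φ R j‖ ≤ d j * m := by
    intro j
    calc ‖interpResidual z φ R j‖ ≤ ‖newton (nodeSeq z 0) R k (z j)‖
          + ∑ i, ‖residualCoeff z φ j i * divDiff z R i‖ :=
          (norm_add_le _ _).trans (by gcongr; exact norm_sum_le _ _)
      _ ≤ c₁ * m + ∑ i, (‖residualCoeff z₀ φ j i‖ + 1) * (c₁ * m) := by
          refine add_le_add (hnewton k le_rfl _ (h1 j)) (Finset.sum_le_sum fun i _ => ?_)
          rw [norm_mul]
          exact mul_le_mul (h2 j i) (hnewton i i.2.le _ (h1 i)) (norm_nonneg _) (by positivity)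
      _ = d j * m := by rw [← Finset.sum_mul, hd]; ring
  have hprod : ∏ j, ‖interpResidual z φ R j‖ ^ 2 ≤ (∏ j, d j ^ 2) * m ^ (2 * k) := by
    calc ∏ j, ‖interpResidual z φ R j‖ ^ 2 ≤ ∏ j, (d j * m) ^ 2 := by
          refine Finset.prod_le_prod (fun _ _ => sq_nonneg _) fun j _ => ?_
          gcongr
          exact hres j
      _ = _ := by simp [mul_pow, Finset.prod_mul_distrib, ← pow_mul]
  have hexp : Real.exp (-∑ a, ‖interpCoeff z φ R a‖ ^ 2) ≤ 1 :=
    Real.exp_le_one_iff.2 (neg_nonpos.2 (Finset.sum_nonneg fun _ _ => sq_nonneg _))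
  calc kacRiceDensity z φ R
      ≤ e * Real.pi⁻¹ ^ k * 1 * ((∏ j, d j ^ 2) * m ^ (2 * k)) := by
        unfold kacRiceDensity; gcongr
    _ = _ := by ring

end Density

/-! ### Two-sided bounds near an arbitrary configuration. -/

theorem tendsto_lintegral_filter_of_dominated_convergence_ae {α κ : Type*} [MeasurableSpace α]
    {μ : Measure α} {l : Filter κ} [l.IsCountablyGenerated] {H : κ → α → ENNReal}
    {h : α → ENNReal} (bound : α → ENNReal) (hm : ∀ᶠ n in l, AEMeasurable (H n) μ)
    (hb : ∀ᶠ n in l, H n ≤ᵐ[μ] bound) (hfin : ∫⁻ a, bound a ∂μ ≠ ⊤)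
    (hlim : ∀ᵐ a ∂μ, Tendsto (fun n => H n a) l (𝓝 (h a))) :
    Tendsto (fun n => ∫⁻ a, H n a ∂μ) l (𝓝 (∫⁻ a, h a ∂μ)) := by
  refine tendsto_of_seq_tendsto fun x hx => ?_
  obtain ⟨n₀, hn₀⟩ := eventually_atTop.1 (hx.eventually (hm.and hb))
  rw [← tendsto_add_atTop_iff_nat n₀]
  refine tendsto_lintegral_of_dominated_convergence' bound
    (fun n => (hn₀ (n + n₀) (by omega)).1) (fun n => (hn₀ (n + n₀) (by omega)).2) hfin ?_
  filter_upwards [hlim] with a ha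
  exact (ha.comp hx).comp (tendsto_add_atTop_nat n₀)

namespace GaussianSeries

variable {Ω : Type*} [MeasurableSpace Ω] {μ : Measure Ω} [IsProbabilityMeasure μ] {G : Set ℂ}
  {ζ : ℕ → Ω → ℂ} {f : ℕ → ℂ → ℂ} {F : Ω → ℂ → ℂ} {k : ℕ}

theorem aemeasurable_divDiff (h : GaussianSeries μ G ζ f F) (hG : IsOpen G)
    {z : Fin k → ℂ} (hz : ∀ j, z j ∈ G) (i : Fin k) :
    AEMeasurable (fun ω => divDiff z (F ω) i) μ := by
  have := h.aemeasurable_newtonFunctional hG (nodeSeq_mem hz 0)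
    (fun n => if n = (i : ℕ) then 1 else 0)
  simpa [newtonFunctional, nodeSeq_val, divDiff] using this

theorem aemeasurable_newton_nodeSeq (h : GaussianSeries μ G ζ f F) (hG : IsOpen G)
    {z : Fin k → ℂ} (hz : ∀ j, z j ∈ G) (j : Fin k) :
    AEMeasurable (fun ω => newton (nodeSeq z 0) (F ω) k (z j)) μ := by
  have := h.aemeasurable_newtonFunctional hG (nodeSeq_mem_succ hz (hz j))
    (fun n => if n = k then 1 else 0)
  simpa [newtonFunctional, nodeSeq_self, newton_nodeSeq z (z j) 0 _ le_rfl] using this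

theorem aemeasurable_kacRiceDensity (h : GaussianSeries μ G ζ f F) (hG : IsOpen G)
    {z : Fin k → ℂ} (hz : ∀ j, z j ∈ G) (φ : Fin k → ℂ → ℂ) :
    AEMeasurable (fun ω => kacRiceDensity z φ (F ω)) μ := by
  have hD := fun i => h.aemeasurable_divDiff hG hz i
  have h1 : ∀ a, AEMeasurable (fun ω => interpCoeff z φ (F ω) a) μ := fun a =>
    (Finset.aemeasurable_fun_sum _ fun i _ => (hD i).const_mul _).neg
  have h2 : ∀ j, AEMeasurable (fun ω => interpResidual z φ (F ω) j) μ := fun j =>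
    (h.aemeasurable_newton_nodeSeq hG hz j).add
      (Finset.aemeasurable_fun_sum _ fun i _ => (hD i).const_mul _)
  exact ((Real.measurable_exp.comp_aemeasurable (Finset.aemeasurable_fun_sum _ fun a _ =>
    (h1 a).norm.pow_const 2).neg).const_mul _).mul
      (Finset.aemeasurable_fun_prod _ fun j _ => (h2 j).norm.pow_const 2)

/-- The remainder of a Gaussian series after removal of the terms indexed by `ι`. -/
theorem remove_range (h : GaussianSeries μ G ζ f F) {ι : Fin k → ℕ} (hι : Function.Injective ι) :
    GaussianSeries μ G ζ (fun n w => if n ∈ Finset.univ.image ι then 0 else f n w)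
      (fun ω w => F ω w - ∑ a, ζ (ι a) ω * f (ι a) w) := by
  have := h.remove (Finset.univ.image ι)
  simp only [Finset.sum_image (fun a _ b _ hab => hι hab)] at this
  exact this

/-- The residual functional kills each `φₐ`, being what remains after interpolation by the `φ`'s, so
it agrees on `F` and on the remainder. It has top coefficient `1` at the nodes `z₀, …, z_{k-1},
z_j`, and `k + 1 ≤ 2k` since an index `j` exists; nondegeneracy and the zero-one law conclude. -/
theorem ae_residual_ne_zero (h : GaussianSeries μ G ζ f F) (hG : IsOpen G)
    (hnd : IsNondegenerate μ G F (2 * k)) {z : Fin k → ℂ} (hz : ∀ j, z j ∈ G)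
    {ι : Fin k → ℕ} (hι : Function.Injective ι)
    (hB : (divDiffMatrix z fun a => f (ι a)).det ≠ 0) (j : Fin k) :
    ∀ᵐ ω ∂μ, interpResidual z (fun a => f (ι a))
      (fun w => F ω w - ∑ a, ζ (ι a) ω * f (ι a) w) j ≠ 0 := by
  set φ : Fin k → ℂ → ℂ := fun a => f (ι a) with hφdef
  have hφ : ∀ a, DifferentiableOn ℂ (φ a) G := fun a => h.diff _
  have hz' := nodeSeq_mem_succ hz (hz j)
  set c : ℕ → ℂ := fun i => if hi : i < k then residualCoeff z φ j ⟨i, hi⟩ else 1 with hc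
  have key : ∀ g, newtonFunctional (nodeSeq z (z j)) (k + 1) c g = interpResidual z φ g j := fun g => by
    rw [newtonFunctional, Finset.sum_range_succ, Finset.sum_range, interpResidual, add_comm]
    congr 1
    · simp [hc, nodeSeq_self, newton_nodeSeq z (z j) 0 _ le_rfl]
    · refine Finset.sum_congr rfl fun i _ => ?_
      simp [hc, nodeSeq_val, divDiff, newton_nodeSeq z (z j) 0 _ i.2.le]
  have hker : ∀ a, interpResidual z φ (φ a) j = 0 := fun a => by
    have h1 : ∀ b, ∑ i, (divDiffMatrix z φ)⁻¹ b i * divDiff z (φ a) i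
        = if b = a then 1 else 0 := fun b => by
      have := congrFun (congrFun (Matrix.nonsing_inv_mul _ (isUnit_iff_ne_zero.2 hB)) b) a
      rwa [Matrix.mul_apply, Matrix.one_apply] at this
    have h2 : ∑ i, residualCoeff z φ j i * divDiff z (φ a) i
        = -∑ b, (∑ i, (divDiffMatrix z φ)⁻¹ b i * divDiff z (φ a) i)
          * newton (nodeSeq z 0) (φ b) k (z j) := by
      simp only [residualCoeff, neg_mul, Finset.sum_mul, Finset.sum_neg_distrib]
      rw [Finset.sum_comm]
      simp only [mul_right_comm]
    rw [interpResidual, h2]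
    simp [h1]
  have hne : ¬ ∀ᵐ ω ∂μ, newtonFunctional (nodeSeq z (z j)) (k + 1) c (F ω) = 0 := fun h0 => by
    have hk : k + 1 ≤ 2 * k := by have := j.2; omega
    have := hnd.newton_coeff_eq_zero hG (h.differentiableOn hG) hk hz' h0 k (by omega)
    simp [hc] at this
  filter_upwards [h.ae_newtonFunctional_ne_zero hG hz' hne,
    (h.remove_range hι).differentiableOn hG] with ω h1 h2
  have h3 := newtonFunctional_add hG hz' c (DifferentiableOn.fun_sum (u := Finset.univ)
    fun a _ => (hφ a).const_mul (ζ (ι a) ω)) h2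
  rw [newtonFunctional_sum hG hz' c _ _ fun a _ => hφ a] at h3
  simp only [hφdef, add_sub_cancel, key] at h3 h1 hker
  simp only [hker, mul_zero, Finset.sum_const_zero, zero_add] at h3
  rwa [h3] at h1

/-- The determinant contributes `Δ⁻¹` and the derivatives `Δ²`, so exactly one factor `Δ` remains.
-/
theorem zeroHitProb_tendsto (h : GaussianSeries μ G ζ f F) (hG : IsOpen G)
    {z : Fin k → ℂ} (hz : ∀ j, z j ∈ G) (hzi : Function.Injective z)
    {ι : Fin k → ℕ} (hι : Function.Injective ι)
    (hB : (divDiffMatrix z fun a => f (ι a)).det ≠ 0)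
    (hfin : ∫⁻ ω, ENNReal.ofReal (kacRiceDensity z (fun a => f (ι a))
      fun w => F ω w - ∑ a, ζ (ι a) ω * f (ι a) w) ∂μ ≠ ⊤) :
    Tendsto (fun ε : ℝ => zeroHitProb μ G F ε z / (Real.pi * ε ^ 2) ^ k) (𝓝[>] 0)
      (𝓝 (vandermondeSq z * (∫⁻ ω, ENNReal.ofReal (kacRiceDensity z (fun a => f (ι a))
        fun w => F ω w - ∑ a, ζ (ι a) ω * f (ι a) w) ∂μ).toReal)) := by
  set φ : Fin k → ℂ → ℂ := fun a => f (ι a) with hφdef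
  have hφ : ∀ a, DifferentiableOn ℂ (φ a) G := fun a => h.diff _
  set R : Ω → ℂ → ℂ := fun ω w => F ω w - ∑ a, ζ (ι a) ω * f (ι a) w with hR
  have hRd : ∀ᵐ ω ∂μ, DifferentiableOn ℂ (R ω) G := (h.remove_range hι).differentiableOn hG
  have hΔ := vandermondeSq_pos hzi
  have hA : (Matrix.of fun j a => φ a (z j)).det ≠ 0 := by
    have := norm_det_eval_sq z φ
    intro h0
    rw [h0, norm_zero] at this
    have h1 : 0 < vandermondeSq z * ‖(divDiffMatrix z φ).det‖ ^ 2 := by positivity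
    rw [← this] at h1
    norm_num at h1
  have hmain := h.zeroHit_tendsto hG hz hι hA (xs := fun ω => interpCoeff z φ (R ω)) (by
    filter_upwards [hRd] with ω hω j
    exact eval_eq_zero_of_divDiff (divDiff_interp hG hz hφ hB hω) j)
  have hval : ∫⁻ ω, ENNReal.ofReal ((‖(Matrix.of fun j a => f (ι a) (z j)).det‖ ^ 2)⁻¹
        * Real.pi⁻¹ ^ k * Real.exp (-∑ a, ‖interpCoeff z φ (R ω) a‖ ^ 2)
        * ∏ j, ‖deriv (fun w => ∑ a, interpCoeff z φ (R ω) a * f (ι a) w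
          + (F ω w - ∑ a, ζ (ι a) ω * f (ι a) w)) (z j)‖ ^ 2) ∂μ
      = ENNReal.ofReal (vandermondeSq z)
        * ∫⁻ ω, ENNReal.ofReal (kacRiceDensity z φ (R ω)) ∂μ := by
    rw [← lintegral_const_mul' _ _ ENNReal.ofReal_ne_top]
    refine lintegral_congr_ae ?_
    filter_upwards [hRd] with ω hω
    have hg : DifferentiableOn ℂ (fun w => ∑ a, interpCoeff z φ (R ω) a * φ a w + R ω w) G :=
      (DifferentiableOn.fun_sum fun a _ => (hφ a).const_mul _).add hω
    have hder : ∏ j, ‖deriv (fun w => ∑ a, interpCoeff z φ (R ω) a * φ a w + R ω w) (z j)‖ ^ 2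
        = (∏ j, ‖interpResidual z φ (R ω) j‖ ^ 2) * vandermondeSq z ^ 2 := by
      rw [← prod_erase_eq_vandermondeSq, ← Finset.prod_mul_distrib]
      refine Finset.prod_congr rfl fun j _ => ?_
      rw [deriv_eq_of_divDiff hG hz hg (divDiff_interp hG hz hφ hB hω), newton_interp hG hz hφ hω,
        norm_mul, mul_pow, norm_prod, Finset.prod_pow]
    rw [← ENNReal.ofReal_mul hΔ.le]
    congr 1
    have hdet := norm_det_eval_sq z φ
    change (‖(Matrix.of fun j a => φ a (z j)).det‖ ^ 2)⁻¹ * _ * _ *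
      (∏ j, ‖deriv (fun w => ∑ a, interpCoeff z φ (R ω) a * φ a w + R ω w) (z j)‖ ^ 2) = _
    rw [hder, hdet, kacRiceDensity, mul_inv]
    field_simp
  change Tendsto _ _ (𝓝 (∫⁻ ω, ENNReal.ofReal ((‖(Matrix.of fun j a => f (ι a) (z j)).det‖ ^ 2)⁻¹
        * Real.pi⁻¹ ^ k * Real.exp (-∑ a, ‖interpCoeff z φ (R ω) a‖ ^ 2)
        * ∏ j, ‖deriv (fun w => ∑ a, interpCoeff z φ (R ω) a * f (ι a) w
          + (F ω w - ∑ a, ζ (ι a) ω * f (ι a) w)) (z j)‖ ^ 2) ∂μ)) at hmain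
  rw [hval] at hmain
  have hreal := (ENNReal.tendsto_toReal (ENNReal.mul_ne_top ENNReal.ofReal_ne_top hfin)).comp hmain
  rw [ENNReal.toReal_mul, ENNReal.toReal_ofReal hΔ.le] at hreal
  refine hreal.congr' ?_
  filter_upwards [self_mem_nhdsWithin] with ε hε
  rw [Function.comp_apply, ENNReal.toReal_div, ENNReal.toReal_ofReal (by positivity)]
  rfl

theorem local_bound (h : GaussianSeries μ G ζ f F) (hG : IsOpen G)
    (hnd : IsNondegenerate μ G F (2 * k)) {z₀ : Fin k → ℂ} (hz₀ : ∀ j, z₀ j ∈ G) :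
    ∃ C : ℝ, 0 < C ∧ ∀ᶠ z in 𝓝 z₀, Function.Injective z → ∃ r : ℝ,
      Tendsto (fun ε : ℝ => zeroHitProb μ G F ε z / (Real.pi * ε ^ 2) ^ k) (𝓝[>] 0) (𝓝 r) ∧
      C⁻¹ * vandermondeSq z ≤ r ∧ r ≤ C * vandermondeSq z := by
  obtain ⟨ι, hι, hB⟩ := h.exists_det_divDiff_ne_zero hG (by omega : k ≤ 2 * k) hnd hz₀
  set φ : Fin k → ℂ → ℂ := fun a => f (ι a) with hφdef
  have hφ : ∀ a, DifferentiableOn ℂ (φ a) G := fun a => h.diff _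
  set R : Ω → ℂ → ℂ := fun ω w => F ω w - ∑ a, ζ (ι a) ω * f (ι a) w with hR
  have hRs := h.remove_range hι
  have hRd : ∀ᵐ ω ∂μ, DifferentiableOn ℂ (R ω) G := hRs.differentiableOn hG
  set Φ : (Fin k → ℂ) → ENNReal := fun z => ∫⁻ ω, ENNReal.ofReal (kacRiceDensity z φ (R ω)) ∂μ
    with hΦ
  obtain ⟨K, hK, hKG, C, hC, hbound⟩ := kacRiceDensity_le hG hz₀ hφ hB
  obtain ⟨m, hm, hmfin⟩ := hRs.exists_compact_norm_bound hG k hK hKG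
  have hzG : ∀ᶠ z : Fin k → ℂ in 𝓝 z₀, ∀ j, z j ∈ G := eventually_all.2 fun j =>
    ((continuous_apply j).tendsto z₀).eventually (hG.mem_nhds (hz₀ j))
  have hmeas : ∀ z : Fin k → ℂ, (∀ j, z j ∈ G) →
      AEMeasurable (fun ω => ENNReal.ofReal (kacRiceDensity z φ (R ω))) μ := fun z hz =>
    (hRs.aemeasurable_kacRiceDensity hG hz φ).ennreal_ofReal
  have hdom : ∀ᶠ z in 𝓝 z₀, (fun ω => ENNReal.ofReal (kacRiceDensity z φ (R ω)))
      ≤ᵐ[μ] fun ω => ENNReal.ofReal C * ENNReal.ofReal (m ω ^ (2 * k)) := by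
    filter_upwards [hbound] with z hz
    filter_upwards [hRd, hm] with ω h1 h2
    rw [← ENNReal.ofReal_mul hC]
    exact ENNReal.ofReal_le_ofReal (hz _ _ h1 h2.1 h2.2)
  have hdomfin : ∫⁻ ω, ENNReal.ofReal C * ENNReal.ofReal (m ω ^ (2 * k)) ∂μ ≠ ⊤ := by
    rw [lintegral_const_mul' _ _ ENNReal.ofReal_ne_top]
    exact ENNReal.mul_ne_top ENNReal.ofReal_ne_top hmfin
  -- Continuity of the averaged density at `z₀`, even with coincident nodes: positivity at `z₀` then
  -- propagates to nearby configurations.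
  have hcont : Tendsto Φ (𝓝 z₀) (𝓝 (Φ z₀)) :=
    tendsto_lintegral_filter_of_dominated_convergence_ae _ (hzG.mono hmeas) hdom hdomfin
      (hRd.mono fun ω hω => (ENNReal.continuous_ofReal.tendsto _).comp
        (kacRiceDensity_tendsto hG hz₀ hφ hB hω))
  have hΦfin : ∀ᶠ z in 𝓝 z₀, Φ z ≠ ⊤ := hdom.mono fun z hz =>
    ne_top_of_le_ne_top hdomfin (lintegral_mono_ae hz)
  have hΦ0 : Φ z₀ ≠ 0 := by
    intro h0
    rw [hΦ, lintegral_eq_zero_iff' (hmeas z₀ hz₀)] at h0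
    have hpos : ∀ᵐ ω ∂μ, ∀ j, interpResidual z₀ φ (R ω) j ≠ 0 :=
      ae_all_iff.2 fun j => h.ae_residual_ne_zero hG hnd hz₀ hι hB j
    obtain ⟨ω, h1, h2⟩ := (h0.and hpos).exists
    have h1 : ENNReal.ofReal (kacRiceDensity z₀ φ (R ω)) = 0 := h1
    rw [ENNReal.ofReal_eq_zero] at h1
    have h3 : 0 < ∏ j, ‖interpResidual z₀ φ (R ω) j‖ ^ 2 :=
      Finset.prod_pos fun j _ => pow_pos (norm_pos_iff.2 (h2 j)) 2
    have h4 : 0 < kacRiceDensity z₀ φ (R ω) := by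
      unfold kacRiceDensity
      have : 0 < ‖(divDiffMatrix z₀ φ).det‖ := norm_pos_iff.2 hB
      positivity
    linarith
  set t := (Φ z₀).toReal with ht
  have ht0 : 0 < t := ENNReal.toReal_pos hΦ0 hΦfin.self_of_nhds
  have htend : Tendsto (fun z => (Φ z).toReal) (𝓝 z₀) (𝓝 t) :=
    (ENNReal.tendsto_toReal hΦfin.self_of_nhds).comp hcont
  -- Near `z₀` the averaged density lies between `t/2` and `2t`; this constant exceeds both `2t` and
  -- `(t/2)⁻¹`.
  refine ⟨2 * t + 2 / t, by positivity, ?_⟩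
  filter_upwards [hzG, hΦfin, htend.eventually_le_const (show t < 2 * t by linarith),
    htend.eventually_const_le (show t / 2 < t by linarith),
    (det_divDiffMatrix_tendsto hG hz₀ hφ).eventually_ne hB] with z h1 h2 h3 h4 h5 hzi
  have hΔ := vandermondeSq_nonneg z
  refine ⟨_, h.zeroHitProb_tendsto hG h1 hzi hι h5 h2, ?_, ?_⟩
  · rw [mul_comm]
    refine mul_le_mul_of_nonneg_left (le_trans ?_ h4) hΔ
    rw [inv_le_comm₀ (by positivity) (by positivity), inv_div]
    linarith
  · rw [mul_comm]
    refine mul_le_mul_of_nonneg_right (h3.trans ?_) hΔ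
    have : 0 < 2 / t := by positivity
    linarith

end GaussianSeries

/-! ### From local bounds to compact sets. -/

theorem mainTheorem10 {Ω : Type*} [MeasurableSpace Ω] (μ : Measure Ω) [IsProbabilityMeasure μ]
    (G : Set ℂ) (hGo : IsOpen G) (hGc : IsConnected G)
    (F : Ω → ℂ → ℂ) (hF : IsGaussianAnalyticFunction μ G F)
    (k : ℕ) (hnd : IsNondegenerate μ G F (2 * k)) :
    ∃ ρ : (Fin k → ℂ) → ℝ, IsKPointFunction μ G F k ρ ∧
      ∀ K : Set ℂ, IsCompact K → K ⊆ G →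
        ∃ C : ℝ, 0 < C ∧ ∀ z : Fin k → ℂ, (∀ j, z j ∈ K) → Function.Injective z →
          C⁻¹ * ∏ i, ∏ j ∈ Finset.Ioi i, ‖z i - z j‖ ^ 2 ≤ ρ z ∧
          ρ z ≤ C * ∏ i, ∏ j ∈ Finset.Ioi i, ‖z i - z j‖ ^ 2 := by
  obtain ⟨ζ, f, h⟩ := hF.exists_gaussianSeries
  set ρ : (Fin k → ℂ) → ℝ := fun z =>
    limUnder (𝓝[>] 0) fun ε : ℝ => zeroHitProb μ G F ε z / (Real.pi * ε ^ 2) ^ k with hρ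
  refine ⟨ρ, fun z hz hzi => ?_, fun K hK hKG => ?_⟩
  · obtain ⟨C, -, hC⟩ := h.local_bound hGo hnd hz
    obtain ⟨r, hr, -⟩ := hC.self_of_nhds hzi
    exact tendsto_nhds_limUnder ⟨r, hr⟩
  -- The configurations of distinct points in `K` are not compact, but the local bounds hold around
  -- every point of `Kᵏ`, diagonals included, so finitely many neighbourhoods suffice.
  · have hKk : IsCompact (Set.univ.pi fun _ : Fin k => K) := isCompact_univ_pi fun _ => hK
    have hloc : ∃ C : ℝ, 0 < C ∧ ∀ z ∈ Set.univ.pi fun _ : Fin k => K, Function.Injective z →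
        C⁻¹ * vandermondeSq z ≤ ρ z ∧ ρ z ≤ C * vandermondeSq z := by
      refine hKk.induction_on (p := fun s => ∃ C : ℝ, 0 < C ∧ ∀ z ∈ s, Function.Injective z →
        C⁻¹ * vandermondeSq z ≤ ρ z ∧ ρ z ≤ C * vandermondeSq z) ⟨1, one_pos, by simp⟩ ?_ ?_ ?_
      · rintro s t hst ⟨C, hC, hb⟩
        exact ⟨C, hC, fun z hz => hb z (hst hz)⟩
      · rintro s t ⟨C₁, hC₁, h₁⟩ ⟨C₂, hC₂, h₂⟩
        refine ⟨max C₁ C₂, lt_max_of_lt_left hC₁, fun z hz hzi => ?_⟩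
        have hΔ := vandermondeSq_nonneg z
        rcases hz with hz | hz
        · obtain ⟨ha, hb⟩ := h₁ z hz hzi
          exact ⟨(mul_le_mul_of_nonneg_right (inv_anti₀ hC₁ (le_max_left _ _)) hΔ).trans ha,
            hb.trans (mul_le_mul_of_nonneg_right (le_max_left _ _) hΔ)⟩
        · obtain ⟨ha, hb⟩ := h₂ z hz hzi
          exact ⟨(mul_le_mul_of_nonneg_right (inv_anti₀ hC₂ (le_max_right _ _)) hΔ).trans ha,
            hb.trans (mul_le_mul_of_nonneg_right (le_max_right _ _) hΔ)⟩
      · intro z₀ hz₀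
        obtain ⟨C, hC, hb⟩ := h.local_bound hGo hnd fun j => hKG (hz₀ j (Set.mem_univ j))
        refine ⟨_, mem_nhdsWithin_of_mem_nhds hb, C, hC, fun z hz hzi => ?_⟩
        obtain ⟨r, hr, h1, h2⟩ := hz hzi
        have : ρ z = r := hr.limUnder_eq
        rw [this]
        exact ⟨h1, h2⟩
    obtain ⟨C, hC, hb⟩ := hloc
    exact ⟨C, hC, fun z hz hzi => hb z (fun j _ => hz j) hzi⟩
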